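/- **Proposition 5.4.** Let $n\ge 1$, let $M=\mathbb R^n/\Lambda$ be a compact flat torus ($\Lambda\subset\mathbb R^n$ a lattice of full rank, $M$ with the flat metric), let $\theta$ be a smooth closed real 1-form on $M$, and let $0\le j\le n$. On the universal cover $\widetilde M=\mathbb R^n$ let $\nabla_\theta=d+\theta\wedge$ be the closed operator on complex $L^2$ differential forms obtained as the closure of $d+\theta\wedge$ on smooth compactly supported forms (with $\theta$ lifted to $\mathbb R^n$), and let $\Delta_{\theta,j}=\nabla_\theta^*\nabla_\theta+\nabla_\theta\nabla_\theta^*$ be the twisted Laplacian on $L^2$ $j$-forms. Let $\mathrm{Tr}_\tau$ and $\dim_\tau$ be the von Neumann trace and dimension of the group $\pi_1(M)=\Lambda$, with $\tau(1)=1$; thus $\mathrm{Tr}_\tau(T)=\mathrm{Tr}(\chi_F T\chi_F)$ for a positive $\Lambda$-invariant operator $T$ on $L^2$ forms and a fundamental domain $F$ of $\Lambda$. Put $$b^j=\dim_\tau\big(\operatorname{Ker}\nabla_\theta/\overline{\operatorname{Im}\nabla_\theta}\big)\quad\text{(in degree }j),$$ $$N_j(\lambda)=\mathrm{Tr}_\tau(E_\lambda)\quad\text{where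 }\Delta_{\theta,j}=\int\lambda\,dE_\lambda,$$ $$\alpha_j=\sup\{\beta\in\mathbb R: N_j(\lambda)-b^j=O(\lambda^\beta)\text{ as }\lambda\to0^+\}.$$ The operator $\Delta_{\theta,j}$ has such a spectral decomposition, and: 1. $b^j=0$. 2. $\alpha_j=n/2$ if $[\theta]=0$ in $H^1(M,\mathbb R)$, and $\alpha_j=\infty$ if $[\theta]\ne0$. 3. If $\theta$ is the harmonic representative of its class (that is, $\theta$ is also coclosed; equivalently, $\theta$ is translation invariant), then its pointwise norm is a constant $\|\theta\|$, and the spectrum of $\Delta_{\theta,j}$ is $[\|\theta\|^2,\infty)$. 4. If $\theta$ is harmonic, then the bottom of the spectrum of $\Delta_{\theta,j}$ is $\|\theta\|^2$. -/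

import Mathlib

open MeasureTheory Filter Topology
open scoped ENNReal NNReal

noncomputable section

namespace TwistedL2

/-! ## Unbounded operators on Hilbert spaces -/

section Operators

variable {H H₁ H₂ H₃ : Type*}
  [NormedAddCommGroup H] [InnerProductSpace ℂ H] [CompleteSpace H]
  [NormedAddCommGroup H₁] [InnerProductSpace ℂ H₁]
  [NormedAddCommGroup H₂] [InnerProductSpace ℂ H₂]
  [NormedAddCommGroup H₃] [InnerProductSpace ℂ H₃]

/-- The composition `g ∘ f` of partially defined operators on its natural domain
`{x ∈ dom f | f x ∈ dom g}`. -/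
def pcomp (g : H₂ →ₗ.[ℂ] H₃) (f : H₁ →ₗ.[ℂ] H₂) : H₁ →ₗ.[ℂ] H₃ where
  domain := (g.domain.comap f.toFun).map f.domain.subtype
  toFun :=
    { toFun := fun x => g ⟨f ⟨x.1, by
          obtain ⟨y, _, hy⟩ := x.2
          exact hy ▸ y.2⟩, by
          obtain ⟨x, y, hy, rfl⟩ := x
          exact hy⟩
      map_add' := by
        rintro ⟨_, x, hx, rfl⟩ ⟨_, y, hy, rfl⟩
        rw [← g.map_add]
        congr 1
        exact Subtype.ext (f.map_add x y)
      map_smul' := by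
        rintro c ⟨_, x, hx, rfl⟩
        rw [RingHom.id_apply, ← g.map_smul]
        congr 1
        exact Subtype.ext (f.map_smul c x) }

/-- The kernel of a partially defined operator, as a subspace of the ambient space. -/
def pker (f : H₁ →ₗ.[ℂ] H₂) : Submodule ℂ H₁ := (LinearMap.ker f.toFun).map f.domain.subtype

/-- The image of a partially defined operator. -/
def pim (f : H₁ →ₗ.[ℂ] H₂) : Submodule ℂ H₂ := LinearMap.range f.toFun

/-- `z` is in the resolvent set of the unbounded operator `A`: the operator `A - z` is a bijection
from `dom A` onto `H` with bounded inverse `R`. -/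
def IsResolventPoint (A : H →ₗ.[ℂ] H) (z : ℂ) : Prop :=
  ∃ R : H →L[ℂ] H,
    (∀ u : H, ∃ h : R u ∈ A.domain, A ⟨R u, h⟩ - z • R u = u) ∧
    (∀ u : A.domain, R (A u - z • (u : H)) = u)

/-- The spectrum of an unbounded operator. -/
def spec (A : H →ₗ.[ℂ] H) : Set ℂ := {z | ¬ IsResolventPoint A z}

/-- `E` is the spectral family (resolution of the identity) of the operator `A`, that is
`A = ∫ t dE_t`. The `E t` are orthogonal projections, increasing and strongly right continuous
in `t`, with strong limits `0` and `1` at `-∞` and `+∞`; and, `μ_u` denoting the Borel measure on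
the line with distribution function `t ↦ ⟨u, E_t u⟩ = ‖E_t u‖²`, the domain of `A` is
`{u | ∫ t² dμ_u < ∞}` and `⟨u, A u⟩ = ∫ t dμ_u` there. -/
structure IsSpectralFamily (A : H →ₗ.[ℂ] H) (E : ℝ → H →L[ℂ] H) : Prop where
  isStarProjection : ∀ t, IsStarProjection (E t)
  mul_of_le : ∀ s t, s ≤ t → E s * E t = E s
  right_continuous : ∀ t u, Tendsto (fun s => E s u) (𝓝[>] t) (𝓝 (E t u))
  tendsto_atBot : ∀ u, Tendsto (fun t => E t u) atBot (𝓝 0)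
  tendsto_atTop : ∀ u, Tendsto (fun t => E t u) atTop (𝓝 u)
  integral_eq : ∀ u : H, ∃ μ : Measure ℝ,
    (∀ t, μ (Set.Iic t) = ENNReal.ofReal (‖E t u‖ ^ 2)) ∧
    (u ∈ A.domain ↔ ∫⁻ t, ENNReal.ofReal (t ^ 2) ∂μ < ∞) ∧
    ∀ h : u ∈ A.domain, inner ℂ u (A ⟨u, h⟩) = ((∫ t, t ∂μ : ℝ) : ℂ)

open Classical in
/-- The spectral family of `A`, if `A` has one (it is then unique); otherwise the zero family. -/
def spectralFamily (A : H →ₗ.[ℂ] H) : ℝ → H →L[ℂ] H :=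
  if h : ∃ E, IsSpectralFamily A E then h.choose else 0

end Operators

/-! ## Differential forms on Euclidean space, the universal cover of a flat torus -/

/-- Euclidean space `ℝⁿ`, the universal cover of an `n`-dimensional flat torus. -/
abbrev V (n : ℕ) : Type := EuclideanSpace ℝ (Fin n)

/-- Complex-valued differential `j`-forms on `ℝⁿ`. -/
abbrev Form (n j : ℕ) : Type := V n → V n [⋀^Fin j]→L[ℝ] ℂ

/-- Strictly increasing multi-indices `I = (i₁ < … < i_j)`; the forms `dx_I` are the standard
orthonormal basis of `Λʲ(ℝⁿ)*`. -/
abbrev MultiIndex (n j : ℕ) : Type := Fin j ↪o Fin n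

instance (n j : ℕ) : Fintype (MultiIndex n j) := Fintype.ofFinite _

/-- The Hilbert space of complex `L²` differential `j`-forms on `ℝⁿ` with the flat
metric; a form `∑ u_I dx_I` is given by its family of coefficients `(u_I)`. -/
abbrev L2Form (n j : ℕ) : Type := Lp (EuclideanSpace ℂ (MultiIndex n j)) 2 (volume : Measure (V n))

/-- The coefficients `ω_I(x) = ω(x)(e_{i₁}, …, e_{i_j})` of a differential form in the orthonormal
basis `dx_I`. -/
def coeff {n j : ℕ} (ω : Form n j) (x : V n) : EuclideanSpace ℂ (MultiIndex n j) :=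
  WithLp.toLp 2 fun I => ω x fun k => EuclideanSpace.single (I k) (1 : ℝ)

/-- Real 1-forms on `ℝⁿ`. -/
abbrev OneForm (n : ℕ) : Type := V n → V n →L[ℝ] ℝ

/-- The twisted exterior derivative `d_θ ω = dω + θ ∧ ω` of differential forms. Here
`(θ ∧ ω)(v₀, …, v_j) = ∑ (-1)ᵏ θ(v_k) ω(v₀, …, v̂_k, …, v_j)`. -/
def dTheta {n j : ℕ} (θ : OneForm n) (ω : Form n j) : Form n (j + 1) := fun x =>
  extDeriv ω x + ContinuousAlternatingMap.alternatizeUncurryFin ((θ x).smulRight (ω x))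

theorem coeff_add {n j : ℕ} (ω η : Form n j) : coeff (ω + η) = coeff ω + coeff η := rfl

theorem coeff_smul {n j : ℕ} (c : ℂ) (ω : Form n j) : coeff (c • ω) = c • coeff ω := rfl

theorem dTheta_zero {n j : ℕ} (θ : OneForm n) : dTheta θ (0 : Form n j) = 0 := by
  funext x
  ext v
  simp [dTheta, extDeriv, ContinuousAlternatingMap.alternatizeUncurryFin_apply]

theorem dTheta_add {n j : ℕ} (θ : OneForm n) {ω η : Form n j} (hω : ContDiff ℝ (⊤ : ℕ∞) ω)
    (hη : ContDiff ℝ (⊤ : ℕ∞) η) : dTheta θ (ω + η) = dTheta θ ω + dTheta θ η := by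
  funext x
  have h1 : DifferentiableAt ℝ ω x := (hω.differentiable (by simp)) x
  have h2 : DifferentiableAt ℝ η x := (hη.differentiable (by simp)) x
  simp only [dTheta, Pi.add_apply, extDeriv_add h1 h2]
  ext v
  simp [ContinuousAlternatingMap.alternatizeUncurryFin_apply, Finset.sum_add_distrib]
  ring

theorem dTheta_smul {n j : ℕ} (θ : OneForm n) (c : ℂ) {ω : Form n j} (hω : ContDiff ℝ (⊤ : ℕ∞) ω) :
    dTheta θ (c • ω) = c • dTheta θ ω := by
  funext x
  have h1 : DifferentiableAt ℝ ω x := (hω.differentiable (by simp)) x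
  have h2 : fderiv ℝ (c • ω) x = c • fderiv ℝ ω x := fderiv_const_smul h1 c
  ext v
  simp only [dTheta, extDeriv, h2, Pi.smul_apply, ContinuousAlternatingMap.add_apply,
    ContinuousAlternatingMap.smul_apply, ContinuousAlternatingMap.alternatizeUncurryFin_apply,
    smul_apply, ContinuousLinearMap.smulRight_apply, smul_add, Finset.smul_sum]
  congr 1 <;> refine Finset.sum_congr rfl fun i _ => ?_
  · rw [smul_comm]
  · simp only [smul_comm c]

/-- The graph of `d_θ` on smooth compactly supported `j`-forms, in the `L²` spaces. -/
def graphDTheta {n : ℕ} (θ : OneForm n) (j : ℕ) :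
    Submodule ℂ (L2Form n j × L2Form n (j + 1)) where
  carrier := {p | ∃ ω : Form n j, ContDiff ℝ (⊤ : ℕ∞) ω ∧ HasCompactSupport ω ∧
    p.1 =ᵐ[volume] coeff ω ∧ p.2 =ᵐ[volume] coeff (dTheta θ ω)}
  zero_mem' := by
    refine ⟨0, contDiff_const, HasCompactSupport.zero, ?_, ?_⟩
    · exact Lp.coeFn_zero _ _ _
    · rw [dTheta_zero]
      exact Lp.coeFn_zero _ _ _
  add_mem' := by
    rintro p q ⟨ω, hω, hωc, h1, h2⟩ ⟨η, hη, hηc, h3, h4⟩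
    refine ⟨ω + η, hω.add hη, hωc.add hηc, ?_, ?_⟩
    · rw [coeff_add]
      exact (Lp.coeFn_add _ _).trans (h1.add h3)
    · rw [dTheta_add θ hω hη, coeff_add]
      exact (Lp.coeFn_add _ _).trans (h2.add h4)
  smul_mem' := by
    rintro c p ⟨ω, hω, hωc, h1, h2⟩
    refine ⟨c • ω, contDiff_const.smul hω, hωc.smul_left (f := fun _ => c), ?_, ?_⟩
    · rw [coeff_smul]
      exact (Lp.coeFn_smul _ _).trans (h1.const_smul c)
    · rw [dTheta_smul θ c hω, coeff_smul]
      exact (Lp.coeFn_smul _ _).trans (h2.const_smul c)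

/-- The twisted differential `∇_θ = d + e(θ)` on `L²` forms: the closure of `d_θ` on smooth
compactly supported forms. -/
def nabla {n : ℕ} (θ : OneForm n) (j : ℕ) : L2Form n j →ₗ.[ℂ] L2Form n (j + 1) :=
  (graphDTheta θ j).toLinearPMap.closure

/-- The twisted Laplacian `Δ_{θ,j} = ∇_θ^* ∇_θ + ∇_θ ∇_θ^*` on `L²` forms of degree `j`, with
Hilbert space adjoints and the natural domain. -/
def laplacian {n : ℕ} (θ : OneForm n) : (j : ℕ) → L2Form n j →ₗ.[ℂ] L2Form n j
  | 0 => pcomp (nabla θ 0).adjoint (nabla θ 0)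
  | j + 1 => pcomp (nabla θ (j + 1)).adjoint (nabla θ (j + 1)) +
      pcomp (nabla θ j) (nabla θ j).adjoint

/-- The closure of the image of the differential arriving in degree `j` (zero in degree `0`). -/
def closedImage {n : ℕ} (θ : OneForm n) : (j : ℕ) → Submodule ℂ (L2Form n j)
  | 0 => ⊥
  | j + 1 => (pim (nabla θ j)).topologicalClosure

/-- The reduced twisted `L²` cohomology `Ker ∇_θ / cl(Im ∇_θ)` in degree `j`, as a Hilbert space:
the quotient is realised by the orthogonal complement of `cl(Im ∇_θ)` in `Ker ∇_θ`. -/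
def reducedCohomology {n : ℕ} (θ : OneForm n) (j : ℕ) : Submodule ℂ (L2Form n j) :=
  pker (nabla θ j) ⊓ (closedImage θ j)ᗮ

/-! ## The flat torus `ℝⁿ / Λ`, its closed 1-forms and the von Neumann trace

The lattice `Λ` is the `ℤ`-span of a basis `b` of `ℝⁿ`. Forms and functions on the torus are
`Λ`-periodic forms and functions on `ℝⁿ`; the fundamental group is `Λ`, acting by translations. -/

/-- `f` is invariant under translations by the lattice spanned by `b`. -/
def IsPeriodic {n : ℕ} {α : Type*} (b : Module.Basis (Fin n) ℝ (V n)) (f : V n → α) : Prop :=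
  ∀ v ∈ Submodule.span ℤ (Set.range b), ∀ x, f (x + v) = f x

/-- `θ` is (the lift to `ℝⁿ` of) a smooth closed 1-form on the flat torus `ℝⁿ / Λ`. -/
structure IsClosedOneForm {n : ℕ} (b : Module.Basis (Fin n) ℝ (V n)) (θ : OneForm n) : Prop where
  smooth : ContDiff ℝ (⊤ : ℕ∞) θ
  periodic : IsPeriodic b θ
  closed : ∀ x u v, fderiv ℝ θ x u v = fderiv ℝ θ x v u

/-- `[θ] = 0` in the de Rham cohomology `H¹(ℝⁿ / Λ, ℝ)`. -/
def IsExact {n : ℕ} (b : Module.Basis (Fin n) ℝ (V n)) (θ : OneForm n) : Prop :=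
  ∃ f : V n → ℝ, ContDiff ℝ (⊤ : ℕ∞) f ∧ IsPeriodic b f ∧ ∀ x, θ x = fderiv ℝ f x

/-- `θ` is coclosed for the flat metric: `∑ᵢ ∂ᵢ θᵢ = 0`. A closed and coclosed form is harmonic. -/
def IsCoclosed {n : ℕ} (θ : OneForm n) : Prop :=
  ∀ x, ∑ i, fderiv ℝ θ x (EuclideanSpace.single i (1 : ℝ)) (EuclideanSpace.single i (1 : ℝ)) = 0

/-- The von Neumann trace `Tr_τ T` of a positive operator `T` on `L²` forms on `ℝⁿ` commuting with
translations by `Λ`, where `τ` is the normalised trace on the von Neumann algebra of `Λ`.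
Under `L²(ℝⁿ, Λʲ) ≅ ℓ²(Λ) ⊗ L²(F, Λʲ)`, with `F` a fundamental domain of `Λ`, one has
`Tr_τ = τ ⊗ Tr`, so that `Tr_τ T` is the trace of the compression of `T` to forms supported in
`F`: the supremum of `∑ ⟨e, T e⟩` over finite orthonormal families of such forms. -/
def vnTrace {n j : ℕ} (b : Module.Basis (Fin n) ℝ (V n)) (T : L2Form n j →L[ℂ] L2Form n j) :
    ℝ≥0∞ :=
  ⨆ (s : Finset (L2Form n j)) (_ : Orthonormal ℂ (fun e : s => (e : L2Form n j)))
    (_ : ∀ e ∈ s, ∀ᵐ x, x ∉ ZSpan.fundamentalDomain b → e x = 0),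
    ∑ e ∈ s, ENNReal.ofReal (inner ℂ e (T e)).re

/-- The von Neumann dimension `dim_τ K` of (the closure of) a `Λ`-invariant subspace of `L²` forms:
the von Neumann trace of the orthogonal projection. -/
def vnDim {n j : ℕ} (b : Module.Basis (Fin n) ℝ (V n)) (K : Submodule ℂ (L2Form n j)) : ℝ≥0∞ :=
  vnTrace b K.topologicalClosure.starProjection

/-- The twisted `L²` Betti number `b^j_(2)` of the torus `ℝⁿ / Λ` with closed 1-form `θ`. -/
def twistedBetti {n : ℕ} (b : Module.Basis (Fin n) ℝ (V n)) (θ : OneForm n) (j : ℕ) : ℝ≥0∞ :=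
  vnDim b (reducedCohomology θ j)

/-- The twisted spectral distribution function `N_j(t, θ) = Tr_τ E_t`, where `E` is the spectral
family of `Δ_{θ,j}`. -/
def spectralDistribution {n : ℕ} (b : Module.Basis (Fin n) ℝ (V n)) (θ : OneForm n) (j : ℕ)
    (t : ℝ) : ℝ≥0∞ :=
  vnTrace b (spectralFamily (laplacian θ j) t)

/-- The twisted Novikov-Shubin invariant
`α_j = sup {β ∈ ℝ | N_j(t, θ) - b^j_(2) = O(t^β) as t → 0+}`, an extended real. -/
def novikovShubin {n : ℕ} (b : Module.Basis (Fin n) ℝ (V n)) (θ : OneForm n) (j : ℕ) : EReal :=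
  sSup {x : EReal | ∃ β : ℝ, x = (β : EReal) ∧ ∃ C : ℝ≥0, ∀ᶠ t : ℝ in 𝓝[>] 0,
    spectralDistribution b θ j t - twistedBetti b θ j ≤ C * ENNReal.ofReal (t ^ β)}

end TwistedL2

end

/-! On a torus every closed 1-form is `θ = a + dφ` with `a` constant and `φ` periodic
(`IsClosedOneForm.exists_isDecomposition`), and `θ` is exact when `a` can be taken to be zero. If
`θ` is also coclosed, then `φ` is harmonic, so `dφ = 0` and `θ = a` (`IsDecomposition.eq_const`).

For constant `a` the Fourier transform turns `∇_a` into exterior multiplication by the covector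
`2πiξ + a`. The Clifford relation between exterior multiplication and contraction then turns the
Laplacian into multiplication by the scalar `4π²|ξ|² + |a|²` in every degree
(`graph_laplacian_const`, `energy_eq`). As `n ≥ 1`, its range is `[|a|², ∞)`, which is the spectrum;
it vanishes at most at one point, so there are no harmonic forms. Its spectral projections are
cutoffs to frequency balls, and their von Neumann trace is comparable to the volume of the ball: of
order `t ^ (n/2)` near zero for `a = 0`, and zero below `|a|²` for `a ≠ 0`.

For general `θ`, multiplication by `e^φ` is a bounded isomorphism of the complex of `θ` onto that of
`a`. It is not unitary, so it does not conjugate the Laplacians. It does provide a bounded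
equivariant map `J`, bounded below, that increases the quadratic form at most by a constant factor
(`Intertwines.exists_comparison`). Hence the spectral projection of one Laplacian at `t` is
injected, with bounds, into that of the other at `κt`. The trace property of the von Neumann trace
then compares the spectral distribution functions up to constants (`vnTrace_le_of_bounded_below`),
which preserves the Novikov-Shubin invariant. The same `J` carries the vanishing of harmonic forms
from `a` to `θ`.

The operator theory underneath: the Laplacian of a Hilbert complex has a resolvent `(1 + A)⁻¹`,
found by projecting onto a graph; the functional calculus of this bounded operator yields the
spectral family; and spectral projections at positive `t` are unique (`IsCut.unique`), which
identifies the family chosen in the definitions. -/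

set_option linter.unusedSectionVars false

namespace TwistedL2

/-! ### Partially defined operators through their graphs -/

section Graphs

variable {H K L : Type*}
  [NormedAddCommGroup H] [InnerProductSpace ℂ H] [CompleteSpace H]
  [NormedAddCommGroup K] [InnerProductSpace ℂ K] [CompleteSpace K]
  [NormedAddCommGroup L] [InnerProductSpace ℂ L] [CompleteSpace L]

theorem graph_functional {f : H →ₗ.[ℂ] K} {x : H} {y y' : K} (h : (x, y) ∈ f.graph)
    (h' : (x, y') ∈ f.graph) : y = y' := f.mem_graph_snd_inj h h' rfl

theorem graph_add {f : H →ₗ.[ℂ] K} {x x' : H} {y y' : K} (h : (x, y) ∈ f.graph)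
    (h' : (x', y') ∈ f.graph) : (x + x', y + y') ∈ f.graph := f.graph.add_mem h h'

theorem graph_sub {f : H →ₗ.[ℂ] K} {x x' : H} {y y' : K} (h : (x, y) ∈ f.graph)
    (h' : (x', y') ∈ f.graph) : (x - x', y - y') ∈ f.graph := f.graph.sub_mem h h'

theorem graph_smul {f : H →ₗ.[ℂ] K} (c : ℂ) {x : H} {y : K} (h : (x, y) ∈ f.graph) :
    (c • x, c • y) ∈ f.graph := f.graph.smul_mem c h

theorem mem_domain_of_graph {f : H →ₗ.[ℂ] K} {x : H} {y : K} (h : (x, y) ∈ f.graph) :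
    x ∈ f.domain := LinearPMap.mem_domain_iff.2 ⟨y, h⟩

theorem mem_graph_pcomp {g : K →ₗ.[ℂ] L} {f : H →ₗ.[ℂ] K} {x : H} {z : L} :
    (x, z) ∈ (pcomp g f).graph ↔ ∃ y, (x, y) ∈ f.graph ∧ (y, z) ∈ g.graph := by
  simp only [LinearPMap.mem_graph_iff]
  constructor
  · rintro ⟨⟨_, ⟨x, hx⟩, hy, rfl⟩, rfl, rfl⟩
    exact ⟨_, ⟨⟨x, hx⟩, rfl, rfl⟩, ⟨_, hy⟩, rfl, rfl⟩
  · rintro ⟨_, ⟨x, rfl, rfl⟩, ⟨y, hy, rfl⟩⟩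
    refine ⟨⟨x, x, ?_, rfl⟩, rfl, ?_⟩
    · change f x ∈ g.domain
      exact hy ▸ y.2
    · change g _ = g _
      congr 1
      exact Subtype.ext hy.symm

theorem mem_graph_add {f g : H →ₗ.[ℂ] K} {x : H} {z : K} :
    (x, z) ∈ (f + g).graph ↔ ∃ y₁ y₂, (x, y₁) ∈ f.graph ∧ (x, y₂) ∈ g.graph ∧ z = y₁ + y₂ := by
  simp only [LinearPMap.mem_graph_iff]
  constructor
  · rintro ⟨⟨x, hx⟩, rfl, rfl⟩
    exact ⟨_, _, ⟨⟨x, hx.1⟩, rfl, rfl⟩, ⟨⟨x, hx.2⟩, rfl, rfl⟩, LinearPMap.add_apply _ _ _⟩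
  · rintro ⟨_, _, ⟨⟨x, hx⟩, rfl, rfl⟩, ⟨⟨x', hx'⟩, h, rfl⟩, rfl⟩
    dsimp only at h
    subst h
    exact ⟨⟨x', hx, hx'⟩, rfl, LinearPMap.add_apply _ _ _⟩

theorem mem_graph_adjoint {T : H →ₗ.[ℂ] K} (hT : Dense (T.domain : Set H)) {y : K} {w : H} :
    (y, w) ∈ T.adjoint.graph ↔ ∀ x z, (x, z) ∈ T.graph → inner ℂ z y = inner ℂ x w := by
  rw [LinearPMap.adjoint_graph_eq_graph_adjoint hT, Submodule.mem_adjoint_iff]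
  simp only [sub_eq_zero]

theorem isClosed_graph_adjoint {T : H →ₗ.[ℂ] K} (hT : Dense (T.domain : Set H)) :
    IsClosed (T.adjoint.graph : Set (K × H)) := LinearPMap.adjoint_isClosed hT

/-- A closed densely defined operator is its own double adjoint. -/
theorem mem_graph_of_forall_adjoint {T : H →ₗ.[ℂ] K} (hT : Dense (T.domain : Set H))
    (hc : IsClosed (T.graph : Set (H × K))) {x : H} {z : K}
    (h : ∀ y w, (y, w) ∈ T.adjoint.graph → inner ℂ z y = inner ℂ x w) : (x, z) ∈ T.graph := by
  let G : Submodule ℂ (WithLp 2 (H × K)) :=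
    T.graph.comap (WithLp.linearEquiv 2 ℂ (H × K)).toLinearMap
  have hG : IsClosed (G : Set (WithLp 2 (H × K))) :=
    hc.preimage (WithLp.prod_continuous_ofLp 2 H K)
  have : CompleteSpace G := hG.completeSpace_coe
  have key : WithLp.toLp 2 (x, z) ∈ Gᗮᗮ := by
    rw [Submodule.mem_orthogonal]
    -- Orthogonality of `(p₁, p₂)` to the graph of `T` says exactly that `T^* p₂ = -p₁`; the claim
    -- is then `Gᗮᗮ = G`.
    intro p hp
    have h1 : (p.ofLp.2, -p.ofLp.1) ∈ T.adjoint.graph := by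
      rw [mem_graph_adjoint hT]
      intro a c hac
      have := (Submodule.mem_orthogonal G p).1 hp (WithLp.toLp 2 (a, c)) hac
      rw [WithLp.prod_inner_apply] at this
      simp only [inner_neg_right] at this ⊢
      exact eq_neg_of_add_eq_zero_right this
    have h2 := h _ _ h1
    rw [WithLp.prod_inner_apply]
    simp only [inner_neg_right] at h2 ⊢
    rw [← inner_conj_symm p.ofLp.1 x, ← inner_conj_symm p.ofLp.2 z, h2]
    simp
  rw [Submodule.orthogonal_orthogonal] at key
  exact key

end Graphs

/-! ### Self-adjointness of the Laplacian of a Hilbert complex -/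

section Laplacian

variable {H K L : Type*}
  [NormedAddCommGroup H] [InnerProductSpace ℂ H] [CompleteSpace H]
  [NormedAddCommGroup K] [InnerProductSpace ℂ K] [CompleteSpace K]
  [NormedAddCommGroup L] [InnerProductSpace ℂ L] [CompleteSpace L]

/-- `L --S--> H --T--> K` is a complex of closed densely defined operators. -/
structure IsHilbertComplex (S : L →ₗ.[ℂ] H) (T : H →ₗ.[ℂ] K) : Prop where
  denseS : Dense (S.domain : Set L)
  closedS : IsClosed (S.graph : Set (L × H))
  denseT : Dense (T.domain : Set H)
  closedT : IsClosed (T.graph : Set (H × K))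
  comp_eq_zero : ∀ x y, (x, y) ∈ S.graph → (y, 0) ∈ T.graph

/-- The Laplacian `T^* T + S S^*`. -/
noncomputable def hodge (S : L →ₗ.[ℂ] H) (T : H →ₗ.[ℂ] K) : H →ₗ.[ℂ] H :=
  pcomp T.adjoint T + pcomp S S.adjoint

/-- The operator `A` is self-adjoint and nonnegative, and `R = (1 + A)⁻¹`. -/
structure IsNonnegResolvent (A : H →ₗ.[ℂ] H) (R : H →L[ℂ] H) : Prop where
  mem_graph : ∀ u w, (u, w) ∈ A.graph ↔ R (u + w) = u
  isSelfAdjoint : IsSelfAdjoint R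
  norm_sq_le : ∀ x, ‖R x‖ ^ 2 ≤ (inner ℂ x (R x)).re

theorem mem_graph_hodge {S : L →ₗ.[ℂ] H} {T : H →ₗ.[ℂ] K} {u w : H} :
    (u, w) ∈ (hodge S T).graph ↔ ∃ y w₁ v w₂, (u, y) ∈ T.graph ∧ (y, w₁) ∈ T.adjoint.graph ∧
      (u, v) ∈ S.adjoint.graph ∧ (v, w₂) ∈ S.graph ∧ w = w₁ + w₂ := by
  simp only [hodge, mem_graph_add, mem_graph_pcomp]
  constructor
  · rintro ⟨w₁, w₂, ⟨y, h1, h2⟩, ⟨v, h3, h4⟩, rfl⟩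
    exact ⟨y, w₁, v, w₂, h1, h2, h3, h4, rfl⟩
  · rintro ⟨y, w₁, v, w₂, h1, h2, h3, h4, rfl⟩
    exact ⟨w₁, w₂, ⟨y, h1, h2⟩, ⟨v, h3, h4⟩, rfl⟩

/-- The kernel of `T`, a closed subspace. -/
def gker (T : H →ₗ.[ℂ] K) : Submodule ℂ H := T.graph.comap (LinearMap.inl ℂ H K)

theorem mem_gker {T : H →ₗ.[ℂ] K} {x : H} : x ∈ gker T ↔ (x, (0 : K)) ∈ T.graph := Iff.rfl

theorem isClosed_gker {T : H →ₗ.[ℂ] K} (hc : IsClosed (T.graph : Set (H × K))) :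
    IsClosed (gker T : Set H) :=
  hc.preimage (continuous_id.prodMk continuous_const)

namespace IsHilbertComplex

variable {S : L →ₗ.[ℂ] H} {T : H →ₗ.[ℂ] K}

theorem hasOrthogonalProjection (h : IsHilbertComplex S T) :
    (gker T).HasOrthogonalProjection :=
  @Submodule.HasOrthogonalProjection.ofCompleteSpace _ _ _ _ _ _
    (isClosed_gker h.closedT).completeSpace_coe

/-- The range of `S` lies in the kernel of `T`, so whatever is orthogonal to that kernel is
orthogonal to the range of `S`, hence killed by `S^*`. -/
theorem mem_adjoint_of_orthogonal (h : IsHilbertComplex S T) {x : H} (hx : x ∈ (gker T)ᗮ) :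
    (x, 0) ∈ S.adjoint.graph := by
  rw [mem_graph_adjoint h.denseS]
  intro a b hab
  rw [inner_zero_right]
  exact (Submodule.mem_orthogonal _ _).1 hx b (h.comp_eq_zero _ _ hab)

/-- The graph of `u ↦ (T u, S^* u)`. -/
def formGraph (S : L →ₗ.[ℂ] H) (T : H →ₗ.[ℂ] K) : Submodule ℂ (WithLp 2 (H × WithLp 2 (K × L))) where
  carrier := {p | (p.fst, p.snd.fst) ∈ T.graph ∧ (p.fst, p.snd.snd) ∈ S.adjoint.graph}
  zero_mem' := ⟨T.graph.zero_mem, S.adjoint.graph.zero_mem⟩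
  add_mem' := fun ha hb => ⟨graph_add ha.1 hb.1, graph_add ha.2 hb.2⟩
  smul_mem' := fun c _ ha => ⟨graph_smul c ha.1, graph_smul c ha.2⟩

theorem isClosed_formGraph (h : IsHilbertComplex S T) :
    IsClosed (formGraph S T : Set (WithLp 2 (H × WithLp 2 (K × L)))) := by
  have c1 : Continuous fun p : WithLp 2 (H × WithLp 2 (K × L)) => (p.fst, p.snd.fst) := by fun_prop
  have c2 : Continuous fun p : WithLp 2 (H × WithLp 2 (K × L)) => (p.fst, p.snd.snd) := by fun_prop
  exact (h.closedT.preimage c1).inter ((isClosed_graph_adjoint h.denseS).preimage c2)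

theorem inner_triple (p q : WithLp 2 (H × WithLp 2 (K × L))) : inner ℂ p q =
    inner ℂ p.fst q.fst + (inner ℂ p.snd.fst q.snd.fst + inner ℂ p.snd.snd q.snd.snd) := by
  rw [WithLp.prod_inner_apply, WithLp.prod_inner_apply]
  rfl

/-- The variational solution of `(1 + T^*T + SS^*) u = f` is the first component of the orthogonal
projection of `(f, 0, 0)` onto the closed graph of `u ↦ (Tu, S^*u)`. A weak solution only controls
the sum of the two terms; that each of them exists separately comes from splitting test vectors
along `ker T`, where one of the two terms always drops out. -/
theorem exists_isNonnegResolvent (h : IsHilbertComplex S T) :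
    ∃ R, IsNonnegResolvent (hodge S T) R := by
  have : CompleteSpace (formGraph S T) := h.isClosed_formGraph.completeSpace_coe
  have hP := h.hasOrthogonalProjection
  let ι : H →L[ℂ] WithLp 2 (H × WithLp 2 (K × L)) :=
    (WithLp.prodContinuousLinearEquiv 2 ℂ H (WithLp 2 (K × L))).symm.toContinuousLinearMap ∘L
      ContinuousLinearMap.inl ℂ H _
  let P : WithLp 2 (H × WithLp 2 (K × L)) →L[ℂ] WithLp 2 (H × WithLp 2 (K × L)) := (formGraph S T).starProjection
  let fs : WithLp 2 (H × WithLp 2 (K × L)) →L[ℂ] H := ContinuousLinearMap.fst ℂ H _ ∘L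
    (WithLp.prodContinuousLinearEquiv 2 ℂ H (WithLp 2 (K × L))).toContinuousLinearMap
  let R : H →L[ℂ] H := fs ∘L P ∘L ι
  have hι : ∀ x, ι x = WithLp.toLp 2 (x, 0) := fun x => rfl
  have hfs : ∀ p, fs p = p.fst := fun p => rfl
  have inner_ι : ∀ x (p : WithLp 2 (H × WithLp 2 (K × L))), inner ℂ (ι x) p = inner ℂ x (fs p) := by
    intro x p
    simp [hι, hfs]
  have hR : ∀ x, R x = fs (P (ι x)) := fun x => rfl
  have inner_R : ∀ x y, inner ℂ x (R y) = inner ℂ (P (ι x)) (P (ι y)) := by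
    intro x y
    rw [hR, ← inner_ι, Submodule.inner_starProjection_left_eq_right,
      Submodule.starProjection_eq_self_iff.2 (Submodule.starProjection_apply_mem _ _)]
  refine ⟨R, ?_, ?_, ?_⟩
  · intro u w
    constructor
    · intro hu
      obtain ⟨y, w₁, v, w₂, h1, h2, h3, h4, rfl⟩ := mem_graph_hodge.1 hu
      -- The difference of `(u + w, 0, 0)` and `(u, Tu, S^*u)` is `(w, -Tu, -S^*u)`, which is
      -- orthogonal to the graph by the definition of the adjoints.
      have : P (ι (u + (w₁ + w₂))) = WithLp.toLp 2 (u, WithLp.toLp 2 (y, v)) := by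
        refine Submodule.eq_starProjection_of_mem_of_inner_eq_zero ⟨h1, h3⟩ ?_
        rintro p ⟨hp1, hp2⟩
        rw [hι, inner_triple]
        simp only [WithLp.sub_fst, WithLp.sub_snd, WithLp.toLp_fst, WithLp.toLp_snd, zero_sub,
          add_sub_cancel_left, inner_add_left, WithLp.neg_fst, WithLp.neg_snd, inner_neg_left]
        have e1 := (mem_graph_adjoint h.denseT).1 h2 _ _ hp1
        have e2 := (mem_graph_adjoint h.denseS).1 hp2 _ _ h4
        have e1' := congrArg (starRingEnd ℂ) e1
        rw [inner_conj_symm, inner_conj_symm] at e1'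
        rw [e1', e2]
        ring
      rw [hR, this, hfs]
      rfl
    · intro hu
      have hmem : P (ι (u + w)) ∈ formGraph S T := Submodule.starProjection_apply_mem _ _
      set q := P (ι (u + w)) with hq
      have hq1 : q.fst = u := by rw [← hfs, hq, ← hR, hu]
      -- The weak equation `⟨w, p⟩ = ⟨Tu, Tp⟩ + ⟨S^*u, S^*p⟩`.
      have orth : ∀ p ∈ formGraph S T,
          inner ℂ w p.fst = inner ℂ q.snd.fst p.snd.fst + inner ℂ q.snd.snd p.snd.snd := by
        intro p hp
        have := Submodule.starProjection_inner_eq_zero (K := formGraph S T) (ι (u + w)) p hp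
        change inner ℂ (ι (u + w) - q) p = 0 at this
        rw [inner_sub_left, inner_ι, hfs, inner_triple, hq1, inner_add_left] at this
        linear_combination this
      let π := (gker T).starProjection
      have hπ : ∀ x, (π x, 0) ∈ T.graph := fun x =>
        mem_gker.1 (Submodule.starProjection_apply_mem _ x)
      have hπ' : ∀ x, (x - π x, 0) ∈ S.adjoint.graph := fun x =>
        h.mem_adjoint_of_orthogonal (Submodule.sub_starProjection_mem_orthogonal x)
      have hsymm : ∀ x y, inner ℂ (π x) y = inner ℂ x (π y) := fun x y =>
        Submodule.inner_starProjection_left_eq_right _ x y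
      obtain ⟨m1, m2⟩ := hmem
      rw [hq1] at m1 m2
      rw [mem_graph_hodge]
      -- The part of `w` orthogonal to `ker T` must be `T^*Tu`, the part in `ker T` must be `SS^*u`.
      -- Testing against `x - π x`, where `S^*` vanishes, gives the former; testing against `π x`,
      -- where `T` vanishes, gives the latter.
      refine ⟨q.snd.fst, w - π w, q.snd.snd, π w, m1, ?_, m2, ?_, by abel⟩
      · rw [mem_graph_adjoint h.denseT]
        intro x z hxz
        have hx : (x - π x, z) ∈ T.graph := by simpa using graph_sub hxz (hπ x)
        have := orth (WithLp.toLp 2 (x - π x, WithLp.toLp 2 (z, 0))) ⟨hx, hπ' x⟩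
        simp only [WithLp.toLp_fst, WithLp.toLp_snd, inner_zero_right, add_zero] at this
        have e := congrArg (starRingEnd ℂ) this
        rw [inner_conj_symm, inner_conj_symm] at e
        rw [← e, inner_sub_left, inner_sub_right, hsymm]
      · refine mem_graph_of_forall_adjoint h.denseS h.closedS ?_
        intro x z hxz
        have hx : (π x, z) ∈ S.adjoint.graph := by simpa using graph_sub hxz (hπ' x)
        have := orth (WithLp.toLp 2 (π x, WithLp.toLp 2 (0, z))) ⟨hπ x, hx⟩
        simp only [WithLp.toLp_fst, WithLp.toLp_snd, inner_zero_right, zero_add] at this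
        rw [hsymm, this]
  · rw [ContinuousLinearMap.isSelfAdjoint_iff_isSymmetric]
    intro x y
    change inner ℂ (R x) y = inner ℂ x (R y)
    rw [← inner_conj_symm, inner_R, inner_R, inner_conj_symm]
  · intro x
    rw [inner_R, hR, hfs]
    have : ((inner ℂ (P (ι x)) (P (ι x))).re : ℝ) = ‖P (ι x)‖ ^ 2 := by
      rw [inner_self_eq_norm_sq_to_K]
      norm_cast
    rw [this]
    gcongr
    exact WithLp.norm_fst_le _ (P (ι x))

end IsHilbertComplex

end Laplacian

end TwistedL2

namespace TwistedL2

/-! ### Spectral projections characterised by form bounds, and their uniqueness -/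

section Cuts

theorem norm_sub_smul_sq {H : Type*} [NormedAddCommGroup H] [InnerProductSpace ℂ H] (a b : H)
    (s : ℝ) : ‖a - (s : ℂ) • b‖ ^ 2 = ‖a‖ ^ 2 - 2 * s * (inner ℂ a b).re + s ^ 2 * ‖b‖ ^ 2 := by
  have := norm_sub_sq (𝕜 := ℂ) a ((s : ℂ) • b)
  rw [this, inner_smul_right, norm_smul, Complex.norm_real, mul_pow, Real.norm_eq_abs, sq_abs]
  simp only [RCLike.re_eq_complex_re, Complex.re_ofReal_mul]
  ring

theorem re_inner_self {H : Type*} [NormedAddCommGroup H] [InnerProductSpace ℂ H] (a : H) :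
    (inner ℂ a a).re = ‖a‖ ^ 2 := by
  rw [inner_self_eq_norm_sq_to_K]; norm_cast

variable {H : Type*} [NormedAddCommGroup H] [InnerProductSpace ℂ H] [CompleteSpace H]
  {A : H →ₗ.[ℂ] H} {R : H →L[ℂ] H}

namespace IsNonnegResolvent

theorem symm (hA : IsNonnegResolvent A R) {u w u' w' : H} (h : (u, w) ∈ A.graph)
    (h' : (u', w') ∈ A.graph) : inner ℂ u w' = inner ℂ w u' := by
  have e := (hA.mem_graph _ _).1 h
  have e' := (hA.mem_graph _ _).1 h'
  have hs := (ContinuousLinearMap.isSelfAdjoint_iff_isSymmetric.1 hA.isSelfAdjoint) (u + w) (u' + w')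
  simp only [ContinuousLinearMap.coe_coe, e, e', inner_add_left, inner_add_right] at hs
  exact add_left_cancel hs

theorem mem (hA : IsNonnegResolvent A R) (f : H) : (R f, f - R f) ∈ A.graph :=
  (hA.mem_graph _ _).2 (by simp)

theorem nonneg (hA : IsNonnegResolvent A R) {u w : H} (h : (u, w) ∈ A.graph) :
    0 ≤ (inner ℂ u w).re := by
  have e := (hA.mem_graph _ _).1 h
  have := hA.norm_sq_le (u + w)
  rw [e, inner_add_left, Complex.add_re, inner_self_eq_norm_sq_to_K] at this
  have h2 : (inner ℂ w u).re = (inner ℂ u w).re := by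
    rw [← inner_conj_symm, Complex.conj_re]
  rw [← h2]
  have h3 : (((‖u‖ : ℂ) ^ 2 : ℂ)).re = ‖u‖ ^ 2 := by norm_cast
  simp only [Complex.coe_algebraMap] at this
  rw [h3] at this
  linarith

theorem eq_zero_of_apply (hA : IsNonnegResolvent A R) {f : H} (h : R f = 0) : f = 0 := by
  have := hA.mem f
  rw [h, sub_zero] at this
  exact graph_functional this A.graph.zero_mem

theorem inner_apply (hA : IsNonnegResolvent A R) (x y : H) : inner ℂ (R x) y = inner ℂ x (R y) :=
  (ContinuousLinearMap.isSelfAdjoint_iff_isSymmetric.1 hA.isSelfAdjoint) x y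

end IsNonnegResolvent

theorem _root_.IsStarProjection.inner_apply {P : H →L[ℂ] H} (hP : IsStarProjection P) (x y : H) :
    inner ℂ (P x) y = inner ℂ x (P y) :=
  (ContinuousLinearMap.isSelfAdjoint_iff_isSymmetric.1 hP.isSelfAdjoint) x y

theorem _root_.IsStarProjection.apply_apply {P : H →L[ℂ] H} (hP : IsStarProjection P) (x : H) :
    P (P x) = P x := DFunLike.congr_fun hP.isIdempotentElem.eq x

/-- `P` is a spectral projection of `A` to the interval `(-∞, t]`: it reduces `A`, with `A ≤ t` on
its range and `A > t` on its kernel. -/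
structure IsCut (A : H →ₗ.[ℂ] H) (t : ℝ) (P : H →L[ℂ] H) : Prop where
  proj : IsStarProjection P
  maps : ∀ u w, (u, w) ∈ A.graph → (P u, P w) ∈ A.graph
  mem : ∀ u, P u ∈ A.domain
  le : ∀ u w, (u, w) ∈ A.graph → P u = u → (inner ℂ u w).re ≤ t * ‖u‖ ^ 2
  gt : ∀ u w, (u, w) ∈ A.graph → P u = 0 → u ≠ 0 → t * ‖u‖ ^ 2 < (inner ℂ u w).re

namespace IsCut

variable {t : ℝ} {P P' : H →L[ℂ] H}

theorem exists_apply (hP : IsCut A t P) {x : H} (hx : P x = x) :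
    ∃ y, (x, y) ∈ A.graph ∧ P y = y := by
  obtain ⟨y, hy⟩ := LinearPMap.mem_domain_iff.1 (hx ▸ hP.mem x)
  have := hP.maps _ _ hy
  rw [hx] at this
  exact ⟨y, hy, graph_functional this hy⟩

/-- With `y = Ax` and `z = Ay`, positivity of `A` at `x - t⁻¹y` gives `2t⁻¹‖y‖² ≤ ⟨x, y⟩ + t⁻²⟨y,
z⟩`. The form bound on the range of `P` limits the right side by `t‖x‖² + t⁻¹‖y‖²`. -/
theorem norm_le (hA : IsNonnegResolvent A R) (ht : 0 < t) (hP : IsCut A t P) {x y : H}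
    (hx : P x = x) (h : (x, y) ∈ A.graph) : ‖y‖ ≤ t * ‖x‖ := by
  obtain ⟨y', h', hy⟩ := hP.exists_apply hx
  obtain rfl := graph_functional h h'
  obtain ⟨z, hz, -⟩ := hP.exists_apply hy
  have h1 := hA.nonneg (graph_sub h (graph_smul ((t⁻¹ : ℝ) : ℂ) hz))
  have h2 := hP.le _ _ h hx
  have h3 := hP.le _ _ hz hy
  have h4 := hA.symm h hz
  have h5 : (inner ℂ y y).re = ‖y‖ ^ 2 := by
    rw [inner_self_eq_norm_sq_to_K]; norm_cast
  simp only [inner_sub_left, inner_sub_right, inner_smul_left, inner_smul_right, h4,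
    Complex.conj_ofReal, Complex.sub_re, Complex.re_ofReal_mul, h5] at h1
  have h6 : t⁻¹ * (t⁻¹ * (inner ℂ y z).re) ≤ t⁻¹ * ‖y‖ ^ 2 := by
    have : t⁻¹ * (inner ℂ y z).re ≤ ‖y‖ ^ 2 := by
      calc t⁻¹ * (inner ℂ y z).re ≤ t⁻¹ * (t * ‖y‖ ^ 2) := by gcongr
        _ = ‖y‖ ^ 2 := by field_simp
    gcongr
  have h7 : t⁻¹ * ‖y‖ ^ 2 ≤ t * ‖x‖ ^ 2 := by linarith
  have h8 : ‖y‖ ^ 2 ≤ (t * ‖x‖) ^ 2 := by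
    calc ‖y‖ ^ 2 = t * (t⁻¹ * ‖y‖ ^ 2) := by field_simp
      _ ≤ t * (t * ‖x‖ ^ 2) := by gcongr
      _ = _ := by ring
  exact abs_le_of_sq_le_sq' h8 (by positivity) |>.2

/-- Iterating `A` on a vector of the range of `P` produces growth at most `t ^ k`. If the component
`W 0` off the range of `P'` were nonzero, its first step would grow by a factor `r > t`. Symmetry of
`A` makes the norms log-convex, `‖W (k+1)‖² ≤ ‖W k‖ ‖W (k+2)‖`, so the factor `r` persists and `r ^
k` eventually beats `t ^ k`. -/
theorem apply_eq_self (hA : IsNonnegResolvent A R) (ht : 0 < t) (hP : IsCut A t P)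
    (hP' : IsCut A t P') {x : H} (hx : P x = x) : P' x = x := by
  by_contra hne
  choose f hf1 hf2 using fun x : {x // P x = x} => hP.exists_apply x.2
  let F : {x // P x = x} → {x // P x = x} := fun x => ⟨f x, hf2 x⟩
  let X : ℕ → {x // P x = x} := fun k => F^[k] ⟨x, hx⟩
  have hX : ∀ k, ((X k : H), (X (k + 1) : H)) ∈ A.graph := by
    intro k
    have : X (k + 1) = F (X k) := Function.iterate_succ_apply' F k _
    rw [this]
    exact hf1 _
  have hXn : ∀ k, ‖(X k : H)‖ ≤ t ^ k * ‖x‖ := by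
    intro k
    induction k with
    | zero => simp [X]
    | succ k ih =>
      calc _ ≤ t * ‖(X k : H)‖ := norm_le hA ht hP (X k).2 (hX k)
        _ ≤ t * (t ^ k * ‖x‖) := by gcongr
        _ = _ := by ring
  let W : ℕ → H := fun k => X k - P' (X k)
  have hW : ∀ k, (W k, W (k + 1)) ∈ A.graph := fun k =>
    graph_sub (hX k) (hP'.maps _ _ (hX k))
  have hWP : ∀ k, P' (W k) = 0 := fun k => by simp [W, hP'.proj.apply_apply]
  have hWn : ∀ k, ‖W k‖ ≤ t ^ k * ‖x‖ := by
    intro k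
    refine le_trans ?_ (hXn k)
    have h1 : inner ℂ (W k) (P' (X k : H)) = 0 := by
      rw [← hP'.proj.inner_apply, hWP, inner_zero_left]
    have h2 : ‖W k + P' (X k)‖ ^ 2 = ‖W k‖ ^ 2 + ‖P' (X k : H)‖ ^ 2 := by
      simpa only [sq] using norm_add_sq_eq_norm_sq_add_norm_sq_of_inner_eq_zero _ _ h1
    have h3 : W k + P' (X k) = X k := by simp [W]
    rw [h3] at h2
    exact (sq_le_sq₀ (norm_nonneg _) (norm_nonneg _)).1
      (by rw [h2]; exact le_add_of_nonneg_right (sq_nonneg _))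
  have hW0 : W 0 ≠ 0 := by
    intro h
    apply hne
    exact (sub_eq_zero.1 h).symm
  have hpos : 0 < ‖W 0‖ := norm_pos_iff.2 hW0
  set r := ‖W 1‖ / ‖W 0‖ with hr
  have hr1 : t < r := by
    rw [hr, lt_div_iff₀ hpos]
    have h1 := hP'.gt _ _ (hW 0) (hWP 0) hW0
    have h2 : (inner ℂ (W 0) (W (0 + 1))).re ≤ ‖W 0‖ * ‖W 1‖ :=
      (Complex.re_le_norm _).trans (norm_inner_le_norm _ _)
    have h3 : ‖W 0‖ * (t * ‖W 0‖) < ‖W 0‖ * ‖W 1‖ := by nlinarith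
    exact lt_of_mul_lt_mul_left h3 hpos.le
  have hr0 : 0 < r := ht.trans hr1
  have hconv : ∀ k, ‖W (k + 1)‖ ^ 2 ≤ ‖W k‖ * ‖W (k + 2)‖ := by
    intro k
    have h1 := hA.symm (hW k) (hW (k + 1))
    have h2 : ((‖W (k + 1)‖ ^ 2 : ℝ) : ℂ) = inner ℂ (W k) (W (k + 2)) := by
      rw [h1, inner_self_eq_norm_sq_to_K]; norm_cast
    calc ‖W (k + 1)‖ ^ 2 = ‖((‖W (k + 1)‖ ^ 2 : ℝ) : ℂ)‖ := by
          rw [Complex.norm_real, Real.norm_of_nonneg (by positivity)]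
      _ ≤ _ := by rw [h2]; exact norm_inner_le_norm _ _
  have hgrow : ∀ k, 0 < ‖W k‖ ∧ r * ‖W k‖ ≤ ‖W (k + 1)‖ := by
    intro k
    induction k with
    | zero => exact ⟨hpos, by rw [hr, div_mul_cancel₀ _ hpos.ne']⟩
    | succ k ih =>
      have h1 : 0 < ‖W (k + 1)‖ := lt_of_lt_of_le (mul_pos hr0 ih.1) ih.2
      refine ⟨h1, ?_⟩
      have h2 : ‖W k‖ * (r * ‖W (k + 1)‖) ≤ ‖W k‖ * ‖W (k + 2)‖ := by
        calc _ = (r * ‖W k‖) * ‖W (k + 1)‖ := by ring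
          _ ≤ ‖W (k + 1)‖ * ‖W (k + 1)‖ := by gcongr; exact ih.2
          _ = ‖W (k + 1)‖ ^ 2 := by ring
          _ ≤ _ := hconv k
      exact le_of_mul_le_mul_left h2 ih.1
  have hlow : ∀ k, r ^ k * ‖W 0‖ ≤ ‖W k‖ := by
    intro k
    induction k with
    | zero => simp
    | succ k ih =>
      calc _ = r * (r ^ k * ‖W 0‖) := by ring
        _ ≤ r * ‖W k‖ := by gcongr
        _ ≤ _ := (hgrow k).2
  have hbd : ∀ k, (r / t) ^ k ≤ ‖x‖ / ‖W 0‖ := by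
    intro k
    rw [le_div_iff₀ hpos, div_pow, div_mul_eq_mul_div, div_le_iff₀ (by positivity)]
    calc _ ≤ ‖W k‖ := hlow k
      _ ≤ _ := hWn k
      _ = _ := by ring
  obtain ⟨k, hk⟩ := ((tendsto_pow_atTop_atTop_of_one_lt ((one_lt_div ht).2 hr1)).eventually_gt_atTop
    (‖x‖ / ‖W 0‖)).exists
  exact absurd (hbd k) (not_le.2 hk)

/-- Spectral projections are unique. -/
theorem unique (hA : IsNonnegResolvent A R) (ht : 0 < t) (hP : IsCut A t P)
    (hP' : IsCut A t P') : P = P' := by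
  have h1 : ∀ x, P' (P x) = P x := fun x => apply_eq_self hA ht hP hP' (hP.proj.apply_apply x)
  have h2 : ∀ x, P (P' x) = P' x := fun x => apply_eq_self hA ht hP' hP (hP'.proj.apply_apply x)
  ext x
  refine ext_inner_left ℂ fun y => ?_
  rw [← h1 x, ← hP'.proj.inner_apply, ← hP.proj.inner_apply, h2, hP'.proj.inner_apply]

/-- Spectral projections commute with the unitaries that preserve the operator. -/
theorem comm (hA : IsNonnegResolvent A R) (ht : 0 < t) (hP : IsCut A t P) (U : H ≃ₗᵢ[ℂ] H)
    (hU : ∀ u w, (u, w) ∈ A.graph → (U u, U w) ∈ A.graph)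
    (hU' : ∀ u w, (u, w) ∈ A.graph → (U.symm u, U.symm w) ∈ A.graph) (x : H) :
    P (U x) = U (P x) := by
  let Q : H →L[ℂ] H := (U.toContinuousLinearEquiv : H →L[ℂ] H) ∘L P ∘L
    (U.symm.toContinuousLinearEquiv : H →L[ℂ] H)
  have hQ : ∀ x, Q x = U (P (U.symm x)) := fun x => rfl
  have hin : ∀ x y, inner ℂ (U x) y = inner ℂ x (U.symm y) := fun x y => by
    rw [← U.inner_map_map x, U.apply_symm_apply]
  have hin' : ∀ x y, inner ℂ (U.symm x) (U.symm y) = inner ℂ x y := fun x y =>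
    U.symm.inner_map_map x y
  have hQc : IsCut A t Q := by
    refine ⟨⟨?_, ?_⟩, ?_, ?_, ?_, ?_⟩
    · ext x
      change Q (Q x) = Q x
      simp [hQ, hP.proj.apply_apply]
    · rw [ContinuousLinearMap.isSelfAdjoint_iff_isSymmetric]
      intro x y
      change inner ℂ (Q x) y = inner ℂ x (Q y)
      rw [hQ, hQ, hin, hP.proj.inner_apply, ← hin' x, U.symm_apply_apply]
    · intro u w h
      exact hU _ _ (hP.maps _ _ (hU' _ _ h))
    · intro u
      obtain ⟨y, hy⟩ := LinearPMap.mem_domain_iff.1 (hP.mem (U.symm u))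
      exact mem_domain_of_graph (hU _ _ hy)
    · intro u w h hu
      rw [← hin', ← U.symm.norm_map u]
      refine hP.le _ _ (hU' _ _ h) ?_
      apply U.injective
      rw [U.apply_symm_apply]
      exact hu
    · intro u w h hu h0
      rw [← hin', ← U.symm.norm_map u]
      refine hP.gt _ _ (hU' _ _ h) ?_ ?_
      · exact U.injective (by rw [map_zero]; exact hu)
      · intro h'
        exact h0 (U.symm.injective (by rw [h', map_zero]))
  have := DFunLike.congr_fun (unique hA ht hP hQc) (U x)
  rw [this, hQ, U.symm_apply_apply]

end IsCut

section Form

variable {K L : Type*}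
  [NormedAddCommGroup K] [InnerProductSpace ℂ K] [CompleteSpace K]
  [NormedAddCommGroup L] [InnerProductSpace ℂ L] [CompleteSpace L]
  {S : L →ₗ.[ℂ] H} {T : H →ₗ.[ℂ] K}

/-- The weak form of the Laplace equation `(T^* T + S S^*) u = w`. -/
theorem IsHilbertComplex.exists_form (hC : IsHilbertComplex S T) {u w : H}
    (h : (u, w) ∈ (hodge S T).graph) : ∃ y z, (u, y) ∈ T.graph ∧ (u, z) ∈ S.adjoint.graph ∧
      ∀ v y' z', (v, y') ∈ T.graph → (v, z') ∈ S.adjoint.graph →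
        inner ℂ v w = inner ℂ y' y + inner ℂ z' z := by
  obtain ⟨y, w₁, z, w₂, h1, h2, h3, h4, rfl⟩ := mem_graph_hodge.1 h
  refine ⟨y, z, h1, h3, fun v y' z' h5 h6 => ?_⟩
  have e1 := (mem_graph_adjoint hC.denseT).1 h2 _ _ h5
  have e2 := (mem_graph_adjoint hC.denseS).1 h6 _ _ h4
  have e2' := congrArg (starRingEnd ℂ) e2
  rw [inner_conj_symm, inner_conj_symm] at e2'
  rw [inner_add_right, e1, e2']

/-- The form of the Laplacian is bounded below by `t` off the spectral projection at `t`. -/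
theorem IsCut.form_le (hC : IsHilbertComplex S T) {t : ℝ} {P : H →L[ℂ] H}
    (ht : 0 < t) (hA : IsNonnegResolvent (hodge S T) R)
    (hP : IsCut (hodge S T) t P) {v : H} {y : K} {z : L} (hy : (v, y) ∈ T.graph)
    (hz : (v, z) ∈ S.adjoint.graph) : t * ‖v - P v‖ ^ 2 ≤ ‖y‖ ^ 2 + ‖z‖ ^ 2 := by
  obtain ⟨a, ha, hPa⟩ := hP.exists_apply (hP.proj.apply_apply v)
  obtain ⟨y₁, z₁, hy₁, hz₁, hf⟩ := hC.exists_form ha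
  set w := v - P v with hw
  have hPw : P w = 0 := by rw [hw, map_sub, hP.proj.apply_apply, sub_self]
  have hyw := graph_sub hy hy₁
  have hzw := graph_sub hz hz₁
  rw [← hw] at hyw hzw
  set Y := y - y₁ with hY
  set Z := z - z₁ with hZ
  -- The cross term of the form between `w = v - Pv` and `Pv` is `⟨w, A(Pv)⟩`, zero because `A(Pv)`
  -- lies in the range of `P`. So passing from `v` to `w` does not increase the form.
  have hcross : inner ℂ Y y₁ + inner ℂ Z z₁ = 0 := by
    rw [← hf w Y Z hyw hzw, ← hPa, ← hP.proj.inner_apply, hPw, inner_zero_left]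
  have hE : ‖Y‖ ^ 2 + ‖Z‖ ^ 2 ≤ ‖y‖ ^ 2 + ‖z‖ ^ 2 := by
    have e1 := norm_sub_smul_sq Y y₁ (-1)
    have e2 := norm_sub_smul_sq Z z₁ (-1)
    have e3 : Y - ((-1 : ℝ) : ℂ) • y₁ = y := by rw [hY]; push_cast; module
    have e4 : Z - ((-1 : ℝ) : ℂ) • z₁ = z := by rw [hZ]; push_cast; module
    rw [e3] at e1
    rw [e4] at e2
    have e5 := congrArg Complex.re hcross
    rw [Complex.add_re, Complex.zero_re] at e5
    nlinarith [sq_nonneg ‖y₁‖, sq_nonneg ‖z₁‖]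
  refine le_trans ?_ hE
  by_cases hw0 : w = 0
  · rw [hw0, norm_zero, zero_pow two_ne_zero, mul_zero]; positivity
  -- `w` lies only in the form domain, so the strict bound of the cut is applied to `x = (1 + A)⁻¹
  -- w`, which lies in the operator domain and in `ker P`. On vectors of energy exactly `t` one has
  -- `w = (1 + t) x`; expanding the squares of the corresponding differences for `w`, `Y` and `Z`
  -- transfers the bound from `x` to `w`.
  set x := R w with hx
  have hxg : (x, w - x) ∈ (hodge S T).graph := hA.mem w
  have hx0 : x ≠ 0 := fun h => hw0 (hA.eq_zero_of_apply h)
  have hPx : P x = 0 := by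
    have h1 := hP.maps _ _ hxg
    rw [map_sub, hPw, zero_sub] at h1
    have h2 := (hA.mem_graph _ _).1 h1
    rw [add_neg_cancel, map_zero] at h2
    exact h2.symm
  obtain ⟨y₂, z₂, hy₂, hz₂, hf₂⟩ := hC.exists_form hxg
  have e1 := congrArg Complex.re (hf₂ w Y Z hyw hzw)
  have e2 := congrArg Complex.re (hf₂ x y₂ z₂ hy₂ hz₂)
  have e3 := hP.gt _ _ hxg hPx hx0
  simp only [inner_sub_right, Complex.add_re, Complex.sub_re, re_inner_self] at e1 e2 e3
  have e4 : (inner ℂ w x).re = (inner ℂ x w).re := by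
    rw [← inner_conj_symm, Complex.conj_re]
  have f1 := norm_sub_smul_sq w x (1 + t)
  have f2 := norm_sub_smul_sq Y y₂ (1 + t)
  have f3 := norm_sub_smul_sq Z z₂ (1 + t)
  have g1 := sq_nonneg ‖w - ((1 + t : ℝ) : ℂ) • x‖
  have g2 := sq_nonneg ‖Y - ((1 + t : ℝ) : ℂ) • y₂‖
  have g3 := sq_nonneg ‖Z - ((1 + t : ℝ) : ℂ) • z₂‖
  rw [f1] at g1
  rw [f2] at g2
  rw [f3] at g3
  set ip := (inner ℂ x w).re
  have k1 : (1 + t) * ((1 + t) * ‖x‖ ^ 2) ≤ (1 + t) * ip := by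
    gcongr
    linarith
  have k2 : (1 + t) * ((1 + t) * ip) ≤ (1 + t) * ‖w‖ ^ 2 := by
    gcongr
    rw [e4] at g1
    nlinarith
  rw [e4] at e1 g1
  nlinarith

end Form

end Cuts

end TwistedL2

namespace TwistedL2

/-! ### Members of a spectral family are cuts -/

section SpectralFamily

variable {H : Type*} [NormedAddCommGroup H] [InnerProductSpace ℂ H] [CompleteSpace H]
  {A : H →ₗ.[ℂ] H} {R : H →L[ℂ] H} {E : ℝ → H →L[ℂ] H}

namespace IsSpectralFamily

/-- The spectral measure of a vector. -/
noncomputable def meas (hE : IsSpectralFamily A E) (u : H) : Measure ℝ := (hE.integral_eq u).choose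

variable (hE : IsSpectralFamily A E)
include hE

theorem meas_Iic (u : H) (t : ℝ) : hE.meas u (Set.Iic t) = ENNReal.ofReal (‖E t u‖ ^ 2) :=
  (hE.integral_eq u).choose_spec.1 t

theorem mem_domain_iff (u : H) :
    u ∈ A.domain ↔ ∫⁻ t, ENNReal.ofReal (t ^ 2) ∂(hE.meas u) < ∞ :=
  (hE.integral_eq u).choose_spec.2.1

theorem inner_eq {u w : H} (h : (u, w) ∈ A.graph) :
    inner ℂ u w = ((∫ t, t ∂(hE.meas u) : ℝ) : ℂ) := by
  obtain ⟨⟨u, hu⟩, rfl, rfl⟩ := A.mem_graph_iff.1 h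
  exact (hE.integral_eq u).choose_spec.2.2 hu

theorem mul_of_ge {s t : ℝ} (h : s ≤ t) (x : H) : E t (E s x) = E s x := by
  refine ext_inner_left ℂ fun y => ?_
  have h1 : ∀ y, E s (E t y) = E s y := DFunLike.congr_fun (hE.mul_of_le s t h)
  rw [← (hE.isStarProjection t).inner_apply, ← (hE.isStarProjection s).inner_apply, h1,
    (hE.isStarProjection s).inner_apply]

theorem mul_apply {s t : ℝ} (h : s ≤ t) (x : H) : E s (E t x) = E s x :=
  DFunLike.congr_fun (hE.mul_of_le s t h) x

theorem meas_univ (u : H) : hE.meas u Set.univ = ENNReal.ofReal (‖u‖ ^ 2) := by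
  have h1 : Tendsto (fun t : ℝ => hE.meas u (Set.Iic t)) atTop (𝓝 (hE.meas u Set.univ)) :=
    tendsto_measure_Iic_atTop _
  have h2 : Tendsto (fun t : ℝ => hE.meas u (Set.Iic t)) atTop (𝓝 (ENNReal.ofReal (‖u‖ ^ 2))) := by
    simp only [hE.meas_Iic]
    exact ENNReal.tendsto_ofReal (((hE.tendsto_atTop u).norm).pow 2)
  exact tendsto_nhds_unique h1 h2

theorem isFiniteMeasure (u : H) : IsFiniteMeasure (hE.meas u) :=
  ⟨by rw [hE.meas_univ]; exact ENNReal.ofReal_lt_top⟩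

theorem meas_eq_of_forall (u : H) {ν : Measure ℝ}
    (h : ∀ t, ν (Set.Iic t) = ENNReal.ofReal (‖E t u‖ ^ 2)) : hE.meas u = ν := by
  have := hE.isFiniteMeasure u
  exact Measure.ext_of_Iic _ _ fun t => by rw [hE.meas_Iic, h]

theorem measureReal_univ (u : H) : (hE.meas u).real Set.univ = ‖u‖ ^ 2 := by
  rw [Measure.real, hE.meas_univ, ENNReal.toReal_ofReal (by positivity)]

/-- The spectral measure of `x + c y` for `x` in the range and `y` in the kernel of `E s`. -/
theorem meas_add {s : ℝ} {x y : H} (hx : E s x = x) (hy : E s y = 0) :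
    hE.meas (x + y) = hE.meas x + hE.meas y := by
  apply hE.meas_eq_of_forall
  intro t
  rw [Measure.add_apply, hE.meas_Iic, hE.meas_Iic, ← ENNReal.ofReal_add (by positivity)
    (by positivity)]
  congr 1
  rcases le_total t s with h | h
  · have : E t y = 0 := by rw [← hE.mul_apply h, hy, map_zero]
    rw [map_add, this]
    simp
  · have hx' : E t x = x := by rw [← hx, hE.mul_of_ge h]
    have : inner ℂ (E t x) (E t y) = 0 := by
      rw [hx', ← hx, (hE.isStarProjection s).inner_apply, hE.mul_apply h, hy, inner_zero_right]
    rw [map_add]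
    simpa only [sq] using (norm_add_sq_eq_norm_sq_add_norm_sq_of_inner_eq_zero _ _ this).symm

theorem integrable_id {u : H} (hu : u ∈ A.domain) : Integrable (fun t : ℝ => t) (hE.meas u) := by
  have := hE.isFiniteMeasure u
  have h2 : MemLp (fun t : ℝ => t) 2 (hE.meas u) := by
    refine ⟨measurable_id.aestronglyMeasurable, ?_⟩
    rw [eLpNorm_lt_top_iff_lintegral_rpow_enorm_lt_top two_ne_zero ENNReal.ofNat_ne_top]
    have := (hE.mem_domain_iff u).1 hu
    convert this using 3 with t
    rw [Real.enorm_eq_ofReal_abs, ENNReal.ofReal_rpow_of_nonneg (abs_nonneg _) (by norm_num)]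
    simp
  exact h2.integrable (by norm_num)

theorem apply_mem_domain_left {s : ℝ} {u : H} (hu : u ∈ A.domain) : E s u ∈ A.domain := by
  have hx : E s (E s u) = E s u := (hE.isStarProjection s).apply_apply u
  have hy : E s (u - E s u) = 0 := by rw [map_sub, hx, sub_self]
  have := hE.meas_add hx hy
  rw [add_sub_cancel] at this
  rw [hE.mem_domain_iff] at hu ⊢
  rw [this, lintegral_add_measure] at hu
  exact lt_of_le_of_lt le_self_add hu

/-- Spectral measures add for vectors on opposite sides of `E s`, so the first moments add too, and
the cross terms of the form must cancel. -/
theorem re_inner_left {s : ℝ} {x y wx wy : H} (hx : E s x = x) (hy : E s y = 0)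
    (hxw : (x, wx) ∈ A.graph) (hyw : (y, wy) ∈ A.graph) : inner ℂ x wy + inner ℂ y wx = 0 := by
  have h1 := hE.inner_eq (graph_add hxw hyw)
  rw [hE.meas_add hx hy, integral_add_measure (hE.integrable_id (mem_domain_of_graph hxw))
    (hE.integrable_id (mem_domain_of_graph hyw))] at h1
  simp only [inner_add_left, inner_add_right, Complex.ofReal_add, ← hE.inner_eq hxw,
    ← hE.inner_eq hyw] at h1
  linear_combination h1

/-- Replacing `y` by `iy` turns the vanishing sum of the cross terms into a vanishing difference. -/
theorem inner_eq_zero {s : ℝ} {x y wx wy : H} (hx : E s x = x) (hy : E s y = 0)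
    (hxw : (x, wx) ∈ A.graph) (hyw : (y, wy) ∈ A.graph) :
    inner ℂ x wy = 0 ∧ inner ℂ y wx = 0 := by
  have h1 := hE.re_inner_left hx hy hxw hyw
  have h2 := hE.re_inner_left hx (by rw [map_smul, hy, smul_zero]) hxw (graph_smul Complex.I hyw)
  rw [inner_smul_left, inner_smul_right, Complex.conj_I] at h2
  have h3 : inner ℂ x wy = inner ℂ y wx := by
    have : Complex.I * (inner ℂ x wy - inner ℂ y wx) = 0 := by linear_combination h2
    exact sub_eq_zero.1 ((mul_eq_zero.1 this).resolve_left Complex.I_ne_zero)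
  rw [h3] at h1 ⊢
  have : inner ℂ y wx = 0 := by linear_combination h1 / 2
  exact ⟨this, this⟩

/-- A spectral family prescribes only the domain and the quadratic form of `A`; that `E s` commutes
with `A` has to be derived. Both defects, `E s` of `A(u - E s u)` and `1 - E s` of `A(E s u)`, are
orthogonal to the range of `R` because cross terms vanish, and `R` is self-adjoint and injective. -/
theorem maps (hA : IsNonnegResolvent A R) (s : ℝ) {u w : H} (h : (u, w) ∈ A.graph) :
    (E s u, E s w) ∈ A.graph := by
  have hid : ∀ v, E s (E s v) = E s v := (hE.isStarProjection s).apply_apply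
  have hker : ∀ v, E s (v - E s v) = 0 := fun v => by rw [map_sub, hid, sub_self]
  obtain ⟨wx, hx⟩ := LinearPMap.mem_domain_iff.1 (hE.apply_mem_domain_left (s := s)
    (mem_domain_of_graph h))
  have hy := graph_sub h hx
  have hdom : ∀ z, ∃ a, (E s (R z), a) ∈ A.graph := fun z => LinearPMap.mem_domain_iff.1
    (hE.apply_mem_domain_left (mem_domain_of_graph (hA.mem z)))
  have h1 : E s (w - wx) = 0 := by
    apply hA.eq_zero_of_apply
    refine ext_inner_left ℂ fun z => ?_
    obtain ⟨a, ha⟩ := hdom z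
    rw [← hA.inner_apply, ← (hE.isStarProjection s).inner_apply, inner_zero_right]
    exact (hE.inner_eq_zero (hid _) (hker u) ha hy).1
  have h2 : wx - E s wx = 0 := by
    apply hA.eq_zero_of_apply
    refine ext_inner_left ℂ fun z => ?_
    obtain ⟨a, ha⟩ := hdom z
    rw [← hA.inner_apply, inner_sub_right, ← (hE.isStarProjection s).inner_apply, inner_zero_right,
      ← inner_sub_left]
    exact (hE.inner_eq_zero (hid _) (hker (R z)) hx (graph_sub (hA.mem z) ha)).2
  rw [map_sub] at h1
  rwa [sub_eq_zero.1 h1, ← sub_eq_zero.1 h2]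

theorem meas_Ioi_eq_zero {t : ℝ} {u : H} (hu : E t u = u) : hE.meas u (Set.Ioi t) = 0 := by
  have := hE.isFiniteMeasure u
  rw [← Set.compl_Iic, measure_compl measurableSet_Iic (measure_ne_top _ _), hE.meas_univ,
    hE.meas_Iic, hu, tsub_self]

theorem inner_le {t : ℝ} {u w : H} (hu : E t u = u) (h : (u, w) ∈ A.graph) :
    (inner ℂ u w).re ≤ t * ‖u‖ ^ 2 := by
  have := hE.isFiniteMeasure u
  rw [hE.inner_eq h, Complex.ofReal_re]
  have h1 : ∀ᵐ s ∂(hE.meas u), s ≤ t := by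
    rw [ae_iff]
    simp only [not_le]
    exact hE.meas_Ioi_eq_zero hu
  calc ∫ s, s ∂(hE.meas u) ≤ ∫ s, t ∂(hE.meas u) :=
        integral_mono_ae (hE.integrable_id (mem_domain_of_graph h)) (integrable_const _) h1
    _ = t * ‖u‖ ^ 2 := by rw [integral_const, hE.measureReal_univ, smul_eq_mul, mul_comm]

theorem lt_inner {t : ℝ} {u w : H} (hu : E t u = 0) (h : (u, w) ∈ A.graph) (h0 : u ≠ 0) :
    t * ‖u‖ ^ 2 < (inner ℂ u w).re := by
  have := hE.isFiniteMeasure u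
  rw [hE.inner_eq h, Complex.ofReal_re]
  have h1 : ∀ᵐ s ∂(hE.meas u), t < s := by
    rw [ae_iff]
    simp only [not_lt]
    change hE.meas u (Set.Iic t) = 0
    rw [hE.meas_Iic, hu]
    simp
  have hi := hE.integrable_id (mem_domain_of_graph h)
  have h2 : 0 < ∫ s, (s - t) ∂(hE.meas u) := by
    rw [integral_pos_iff_support_of_nonneg_ae]
    · have : hE.meas u (Function.support fun s : ℝ => s - t)ᶜ = 0 := by
        rw [measure_eq_zero_iff_ae_notMem]
        filter_upwards [h1] with s hs
        simp [sub_ne_zero, hs.ne']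
      have h3 : hE.meas u (Function.support fun s : ℝ => s - t) = hE.meas u Set.univ :=
        measure_eq_measure_of_null_sdiff (Set.subset_univ _) (by rwa [← Set.compl_eq_univ_sdiff])
      rw [h3, hE.meas_univ, ENNReal.ofReal_pos]
      have := norm_pos_iff.2 h0
      positivity
    · filter_upwards [h1] with s hs
      exact (sub_pos.2 hs).le
    · exact hi.sub (integrable_const _)
  rw [integral_sub hi (integrable_const _), integral_const, hE.measureReal_univ, smul_eq_mul] at h2
  linarith

theorem mem_domain_of_bounded {r t : ℝ} {u : H} (hr : E r u = 0) (ht : E t u = u) :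
    u ∈ A.domain := by
  have := hE.isFiniteMeasure u
  rw [hE.mem_domain_iff]
  have h1 : ∀ᵐ s ∂(hE.meas u), s ≤ t := by
    rw [ae_iff]
    simp only [not_le]
    exact hE.meas_Ioi_eq_zero ht
  have h2 : ∀ᵐ s ∂(hE.meas u), r < s := by
    rw [ae_iff]
    simp only [not_lt]
    change hE.meas u (Set.Iic r) = 0
    rw [hE.meas_Iic, hr]
    simp
  calc ∫⁻ s, ENNReal.ofReal (s ^ 2) ∂(hE.meas u)
      ≤ ∫⁻ s, ENNReal.ofReal (r ^ 2 + t ^ 2) ∂(hE.meas u) := by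
        refine lintegral_mono_ae ?_
        filter_upwards [h1, h2] with s hs1 hs2
        refine ENNReal.ofReal_le_ofReal ?_
        rcases le_total 0 s with h | h <;> nlinarith
    _ < ∞ := by
        rw [lintegral_const]
        exact ENNReal.mul_lt_top ENNReal.ofReal_lt_top (measure_lt_top _ _)

/-- A nonzero vector in the range of `E t - E r` with `r < t < 0` would give `A` a negative value.
So `E` is constant below `t`, and its limit at `-∞` is zero. -/
theorem eq_zero_of_neg (hA : IsNonnegResolvent A R) {t : ℝ} (ht : t < 0) (x : H) : E t x = 0 := by
  have key : ∀ r < t, E r x = E t x := by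
    intro r hr
    have hu1 : E r (E t x - E r x) = 0 := by
      rw [map_sub, hE.mul_apply hr.le, (hE.isStarProjection r).apply_apply, sub_self]
    have hu2 : E t (E t x - E r x) = E t x - E r x := by
      rw [map_sub, hE.mul_of_ge hr.le, (hE.isStarProjection t).apply_apply]
    obtain ⟨w, hw⟩ := LinearPMap.mem_domain_iff.1 (hE.mem_domain_of_bounded hu1 hu2)
    have h1 := hE.inner_le hu2 hw
    have h2 := hA.nonneg hw
    by_contra hne
    have h3 : 0 < ‖E t x - E r x‖ := norm_pos_iff.2 (sub_ne_zero.2 (Ne.symm hne))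
    nlinarith [pow_pos h3 2]
  have h1 : Tendsto (fun r => E r x) atBot (𝓝 (E t x)) :=
    tendsto_const_nhds.congr' (by
      filter_upwards [eventually_lt_atBot t] with r hr using (key r hr).symm)
  exact tendsto_nhds_unique h1 (hE.tendsto_atBot x)

/-- With `IsCut.unique` this makes the family independent of choices at every `t > 0`. -/
theorem isCut (hA : IsNonnegResolvent A R) (t : ℝ) : IsCut A t (E t) where
  proj := hE.isStarProjection t
  maps := fun _ _ h => hE.maps hA t h
  mem := fun u => by
    -- The spectral measure of `E t u` has no mass below `min t (-1)`, a point that is both negative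
    -- and at most `t`; hence it has bounded support and finite second moment.
    have h1 : E (min t (-1)) u = 0 :=
      hE.eq_zero_of_neg hA (lt_of_le_of_lt (min_le_right _ _) (by norm_num)) u
    exact hE.mem_domain_of_bounded (r := min t (-1)) (t := t)
      (by rw [hE.mul_apply (min_le_left _ _), h1]) ((hE.isStarProjection t).apply_apply u)
  le := fun _ _ h hu => hE.inner_le hu h
  gt := fun _ _ h hu h0 => hE.lt_inner hu h h0

end IsSpectralFamily

end SpectralFamily

end TwistedL2

namespace TwistedL2

/-! ### Spectral measures and kernel projections of a bounded self-adjoint operator -/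

section SpectralMeasure

variable {H : Type*} [NormedAddCommGroup H] [InnerProductSpace ℂ H] [CompleteSpace H]
  {B : H →L[ℂ] H}

open CompactlySupported CompactlySupportedContinuousMap in
/-- The spectral measure of a bounded self-adjoint operator at a vector. -/
theorem exists_spectralMeasure (hB : IsSelfAdjoint B) (u : H) : ∃ ν : Measure ℝ,
    IsFiniteMeasure ν ∧ ν (spectrum ℝ B)ᶜ = 0 ∧
    ∀ f : ℝ → ℝ, Continuous f → ∫ r, f r ∂ν = (inner ℂ u (cfc f B u)).re := by
  -- Riesz-Markov applied to the positive functional `f ↦ ⟨u, f(B)u⟩` on the compact spectrum, then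
  -- pushed forward to the line.
  let Λ₀ : C_c(spectrum ℝ B, ℝ) →ₗ[ℝ] ℝ :=
    { toFun := fun f => (inner ℂ u (cfcHom hB (f : C(spectrum ℝ B, ℝ)) u)).re
      map_add' := fun f g => by
        have : ((f + g : C_c(spectrum ℝ B, ℝ)) : C(spectrum ℝ B, ℝ)) =
          (f : C(spectrum ℝ B, ℝ)) + (g : C(spectrum ℝ B, ℝ)) := rfl
        rw [this, map_add, _root_.add_apply, inner_add_right, Complex.add_re]
      map_smul' := fun c f => by
        have : ((c • f : C_c(spectrum ℝ B, ℝ)) : C(spectrum ℝ B, ℝ)) =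
          c • (f : C(spectrum ℝ B, ℝ)) := rfl
        rw [this, map_smul, _root_.smul_apply, RingHom.id_apply,
          ← Complex.coe_smul, inner_smul_right, Complex.re_ofReal_mul, smul_eq_mul] }
  let Λ : C_c(spectrum ℝ B, ℝ) →ₚ[ℝ] ℝ := PositiveLinearMap.mk₀ Λ₀ (by
    intro f hf
    have h1 : 0 ≤ cfcHom hB (f : C(spectrum ℝ B, ℝ)) := (cfcHom_nonneg_iff hB).2 hf
    exact ((ContinuousLinearMap.nonneg_iff_isPositive _).1 h1).re_inner_nonneg_right u)
  let ν₀ := RealRMK.rieszMeasure Λ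
  have hfin : IsFiniteMeasure ν₀ := by
    refine ⟨?_⟩
    have : IsFiniteMeasureOnCompacts ν₀ := by infer_instance
    exact isCompact_univ.measure_lt_top
  refine ⟨ν₀.map Subtype.val, inferInstance, ?_, ?_⟩
  · rw [Measure.map_apply measurable_subtype_coe (spectrum.isClosed B).measurableSet.compl]
    convert measure_empty (μ := ν₀)
    ext x
    simp
  · intro f hf
    rw [integral_map measurable_subtype_coe.aemeasurable hf.aestronglyMeasurable]
    have := RealRMK.integral_rieszMeasure Λ
      (continuousMapEquiv ⟨fun x : spectrum ℝ B => f x, by fun_prop⟩)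
    refine Eq.trans this ?_
    rw [cfc_apply f B hB hf.continuousOn]
    rfl

/-- A choice of spectral measure. -/
noncomputable def specMeas (hB : IsSelfAdjoint B) (u : H) : Measure ℝ :=
  (exists_spectralMeasure hB u).choose

instance (hB : IsSelfAdjoint B) (u : H) : IsFiniteMeasure (specMeas hB u) :=
  (exists_spectralMeasure hB u).choose_spec.1

theorem ae_mem_spectrum (hB : IsSelfAdjoint B) (u : H) : ∀ᵐ r ∂(specMeas hB u), r ∈ spectrum ℝ B :=
  (exists_spectralMeasure hB u).choose_spec.2.1

theorem integral_specMeas (hB : IsSelfAdjoint B) (u : H) {f : ℝ → ℝ} (hf : Continuous f) :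
    ∫ r, f r ∂(specMeas hB u) = (inner ℂ u (cfc f B u)).re :=
  (exists_spectralMeasure hB u).choose_spec.2.2 f hf

theorem inner_cfc (f : ℝ → ℝ) (x y : H) : inner ℂ (cfc f B x) y = inner ℂ x (cfc f B y) := by
  have : IsSelfAdjoint (cfc f B) := IsSelfAdjoint.cfc
  exact (ContinuousLinearMap.isSelfAdjoint_iff_isSymmetric.1 this) x y

theorem cfc_mul_apply {f g : ℝ → ℝ} (hf : Continuous f) (hg : Continuous g) (x : H) :
    cfc (fun r => f r * g r) B x = cfc f B (cfc g B x) := by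
  rw [cfc_mul f g B hf.continuousOn hg.continuousOn]
  rfl

theorem cfc_sub_apply {f g : ℝ → ℝ} (hf : Continuous f) (hg : Continuous g) (x : H) :
    cfc (fun r => f r - g r) B x = cfc f B x - cfc g B x := by
  rw [cfc_sub f g B hf.continuousOn hg.continuousOn]
  rfl

theorem norm_cfc_sq (hB : IsSelfAdjoint B) (u : H) {f : ℝ → ℝ} (hf : Continuous f) :
    ‖cfc f B u‖ ^ 2 = ∫ r, f r ^ 2 ∂(specMeas hB u) := by
  rw [integral_specMeas hB u (f := fun r => f r ^ 2) (hf.pow 2), ← re_inner_self, inner_cfc, ← cfc_mul_apply hf hf]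
  simp only [sq]

theorem cfc_one_apply (hB : IsSelfAdjoint B) (u : H) : cfc (fun _ : ℝ => (1 : ℝ)) B u = u := by
  rw [cfc_const_one ℝ B]; rfl

theorem cfc_id_apply (hB : IsSelfAdjoint B) (u : H) : cfc (fun r : ℝ => r) B u = B u := by
  rw [cfc_id' ℝ B]

theorem measureReal_univ_specMeas (hB : IsSelfAdjoint B) (u : H) :
    (specMeas hB u).real Set.univ = ‖u‖ ^ 2 := by
  have := integral_specMeas hB u (f := fun _ => 1) continuous_const
  rw [cfc_one_apply hB, re_inner_self, integral_const, smul_eq_mul, mul_one] at this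
  exact this

theorem integrable_of_bounded_on {ν : Measure ℝ} [IsFiniteMeasure ν] {K : Set ℝ}
    (hK : IsCompact K) (hν : ∀ᵐ r ∂ν, r ∈ K) {f : ℝ → ℝ} (hf : Continuous f) : Integrable f ν := by
  obtain ⟨C, hC⟩ := hK.exists_bound_of_continuousOn hf.continuousOn
  exact Integrable.of_bound hf.aestronglyMeasurable C (hν.mono hC)

theorem integrable_specMeas (hB : IsSelfAdjoint B) (u : H) {f : ℝ → ℝ} (hf : Continuous f) :
    Integrable f (specMeas hB u) :=
  integrable_of_bounded_on (spectrum.isCompact B) (ae_mem_spectrum hB u) hf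

theorem norm_cfc_le (hB : IsSelfAdjoint B) (u : H) {f g : ℝ → ℝ} (hf : Continuous f)
    (hg : Continuous g) (h : ∀ r, |f r| ≤ |g r|) : ‖cfc f B u‖ ≤ ‖cfc g B u‖ := by
  refine (sq_le_sq₀ (norm_nonneg _) (norm_nonneg _)).1 ?_
  rw [norm_cfc_sq hB u hf, norm_cfc_sq hB u hg]
  exact integral_mono (integrable_specMeas hB u (hf.pow 2)) (integrable_specMeas hB u (hg.pow 2))
    fun r => sq_le_sq.2 (h r)

/-- The projection onto the kernel of `g(B)`. -/
noncomputable def kerProj (B : H →L[ℂ] H) (g : ℝ → ℝ) : H →L[ℂ] H :=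
  haveI : CompleteSpace (cfc g B).toLinearMap.ker := (cfc g B).isClosed_ker.completeSpace_coe
  (cfc g B).toLinearMap.ker.starProjection

theorem isStarProjection_kerProj (g : ℝ → ℝ) : IsStarProjection (kerProj B g) := by
  have : CompleteSpace (cfc g B).toLinearMap.ker := (cfc g B).isClosed_ker.completeSpace_coe
  exact isStarProjection_starProjection

theorem kerProj_comp_of_le (hB : IsSelfAdjoint B) {f g : ℝ → ℝ} (hf : Continuous f)
    (hg : Continuous g) (h : ∀ r, |f r| ≤ |g r|) : kerProj B g * kerProj B f = kerProj B g := by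
  have : CompleteSpace (cfc g B).toLinearMap.ker := (cfc g B).isClosed_ker.completeSpace_coe
  have : CompleteSpace (cfc f B).toLinearMap.ker := (cfc f B).isClosed_ker.completeSpace_coe
  refine Submodule.starProjection_comp_starProjection_of_le fun x hx => ?_
  rw [LinearMap.mem_ker] at hx ⊢
  have := norm_cfc_le hB x hf hg h
  rw [show cfc g B x = 0 from hx, norm_zero] at this
  exact norm_le_zero_iff.1 this

/-- The cutoffs are contractions that fix `ker g(B)`, and on `g(B)w` they have norm at most `‖w‖ /
(k + 1)`. Since the range of `g(B)` is dense in the orthogonal complement of the kernel, they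
converge strongly to the projection. -/
theorem cfc_cutoff_tendsto (hB : IsSelfAdjoint B) {g : ℝ → ℝ} (hg : Continuous g)
    (hg0 : ∀ r, 0 ≤ g r) (u : H) :
    Tendsto (fun k : ℕ => cfc (fun r => max 0 (1 - (k + 1) * g r)) B u) atTop
      (𝓝 (kerProj B g u)) := by
  have : CompleteSpace (cfc g B).toLinearMap.ker := (cfc g B).isClosed_ker.completeSpace_coe
  have hf : ∀ k : ℕ, Continuous fun r => max 0 (1 - ((k : ℝ) + 1) * g r) := fun k => by fun_prop
  set f : ℕ → ℝ → ℝ := fun k r => max 0 (1 - ((k : ℝ) + 1) * g r) with hfdef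
  have hf1 : ∀ k r, 0 ≤ f k r ∧ f k r ≤ 1 := fun k r => by
    refine ⟨le_max_left _ _, max_le zero_le_one ?_⟩
    have := hg0 r
    have : 0 ≤ ((k : ℝ) + 1) * g r := by positivity
    linarith
  set p := kerProj B g with hp
  have hpk : cfc g B (p u) = 0 :=
    Submodule.starProjection_apply_mem (cfc g B).toLinearMap.ker u
  have hfix : ∀ k, cfc (f k) B (p u) = p u := by
    intro k
    have h1 : ‖cfc (fun r => 1 - f k r) B (p u)‖ ≤ ‖cfc (fun r => ((k : ℝ) + 1) * g r) B (p u)‖ := by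
      refine norm_cfc_le hB _ (continuous_const.sub (hf k)) (by fun_prop) fun r => ?_
      have h0 := hg0 r
      have h0' : 0 ≤ ((k : ℝ) + 1) * g r := by positivity
      rw [abs_of_nonneg (by linarith [(hf1 k r).2]), abs_of_nonneg h0']
      have : 1 - ((k : ℝ) + 1) * g r ≤ f k r := le_max_right _ _
      linarith
    rw [cfc_mul_apply continuous_const hg, hpk, map_zero, norm_zero, norm_le_zero_iff,
      cfc_sub_apply continuous_const (hf k), cfc_one_apply hB, sub_eq_zero] at h1
    exact h1.symm
  have hmem : u - p u ∈ (cfc g B).toLinearMap.kerᗮ := Submodule.sub_starProjection_mem_orthogonal u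
  have hadj : ContinuousLinearMap.adjoint (cfc g B) = cfc g B :=
    (IsSelfAdjoint.cfc (f := g) (a := B) : IsSelfAdjoint (cfc g B))
  rw [ContinuousLinearMap.orthogonal_ker, hadj] at hmem
  have hcontr : ∀ k v, ‖cfc (f k) B v‖ ≤ ‖v‖ := fun k v => by
    have := norm_cfc_le hB v (hf k) (g := fun _ => 1) continuous_const fun r => by
      rw [abs_of_nonneg (hf1 k r).1, abs_one]; exact (hf1 k r).2
    rwa [cfc_one_apply hB] at this
  have hrange : ∀ k w, ‖cfc (f k) B (cfc g B w)‖ ≤ ((k : ℝ) + 1)⁻¹ * ‖w‖ := fun k w => by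
    have hk : (0 : ℝ) < (k : ℝ) + 1 := by positivity
    have := norm_cfc_le hB w (f := fun r => f k r * g r) ((hf k).mul hg)
      (g := fun _ => ((k : ℝ) + 1)⁻¹) continuous_const
      fun r => by
        rw [abs_of_nonneg (inv_nonneg.2 hk.le), abs_of_nonneg (mul_nonneg (hf1 k r).1 (hg0 r)),
          inv_eq_one_div, le_div_iff₀ hk]
        have h0 := hg0 r
        rcases le_total (1 - ((k : ℝ) + 1) * g r) 0 with h | h
        · rw [hfdef]; simp only; rw [max_eq_left h]; norm_num
        · have := (hf1 k r).2
          nlinarith [mul_nonneg h0 (sub_nonneg.2 this)]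
    rw [cfc_mul_apply (hf k) hg] at this
    refine this.trans_eq ?_
    rw [cfc_const _ B, Algebra.algebraMap_eq_smul_one, smul_apply, norm_smul,
      Real.norm_of_nonneg (inv_nonneg.2 hk.le)]
    rfl
  rw [Metric.tendsto_atTop]
  intro ε hε
  rw [← SetLike.mem_coe, Submodule.topologicalClosure_coe, Metric.mem_closure_iff] at hmem
  obtain ⟨_, ⟨w, rfl⟩, hw⟩ := hmem (ε / 2) (by positivity)
  have hlim : Tendsto (fun k : ℕ => ((k : ℝ) + 1)⁻¹ * ‖w‖) atTop (𝓝 0) := by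
    have := (tendsto_inv_atTop_zero.comp (tendsto_natCast_atTop_atTop (R := ℝ)|>.atTop_add
      (tendsto_const_nhds (x := (1 : ℝ))))).mul_const ‖w‖
    rwa [zero_mul] at this
  obtain ⟨N, hN⟩ := (hlim.eventually_lt_const (half_pos hε)).exists_forall_of_atTop
  refine ⟨N, fun k hk => ?_⟩
  rw [dist_eq_norm] at hw ⊢
  have e : cfc (f k) B u - p u = cfc (f k) B (u - p u - cfc g B w) + cfc (f k) B (cfc g B w) := by
    rw [← map_add, sub_add_cancel, map_sub, hfix]
  change ‖cfc (f k) B u - p u‖ < ε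
  rw [e]
  calc _ ≤ ‖cfc (f k) B (u - p u - cfc g B w)‖ + ‖cfc (f k) B (cfc g B w)‖ := norm_add_le _ _
    _ ≤ ‖u - p u - cfc g B w‖ + ((k : ℝ) + 1)⁻¹ * ‖w‖ := add_le_add (hcontr _ _) (hrange _ _)
    _ < ε / 2 + ε / 2 := add_lt_add hw (hN k hk)
    _ = ε := add_halves ε

/-- The cutoffs decrease to the indicator function of `{g = 0}`. Dominated convergence computes the
limit of their integrals as the measure of that set, strong convergence as `⟨u, kerProj u⟩`. -/
theorem specMeas_zeroSet (hB : IsSelfAdjoint B) {g : ℝ → ℝ} (hg : Continuous g)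
    (hg0 : ∀ r, 0 ≤ g r) (u : H) :
    specMeas hB u {r | g r = 0} = ENNReal.ofReal (‖kerProj B g u‖ ^ 2) := by
  have h1 : Tendsto (fun k : ℕ => ∫ r, max 0 (1 - (k + 1) * g r) ∂(specMeas hB u)) atTop
      (𝓝 (∫ r, Set.indicator {r | g r = 0} (fun _ => (1 : ℝ)) r ∂(specMeas hB u))) := by
    refine tendsto_integral_of_dominated_convergence (fun _ => 1)
      (fun k => Continuous.aestronglyMeasurable (by fun_prop)) (integrable_const _) ?_ ?_
    · intro k
      refine Eventually.of_forall fun r => ?_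
      have := hg0 r
      have : 0 ≤ ((k : ℝ) + 1) * g r := by positivity
      rw [Real.norm_of_nonneg (le_max_left _ _)]
      exact max_le zero_le_one (by linarith)
    · refine Eventually.of_forall fun r => ?_
      by_cases hr : g r = 0
      · simp [hr]
      · have hpos : 0 < g r := lt_of_le_of_ne (hg0 r) (Ne.symm hr)
        have hni : r ∉ {r | g r = 0} := hr
        rw [Set.indicator_of_notMem hni]
        refine tendsto_const_nhds.congr' ?_
        obtain ⟨N, hN⟩ := exists_nat_gt (g r)⁻¹
        filter_upwards [eventually_ge_atTop N] with k hk
        rw [max_eq_left]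
        have h2 : (g r)⁻¹ ≤ (k : ℝ) + 1 := by
          have : (N : ℝ) ≤ k := by exact_mod_cast hk
          linarith
        have := mul_le_mul_of_nonneg_right h2 hpos.le
        rw [inv_mul_cancel₀ hpos.ne'] at this
        linarith
  have h2 : Tendsto (fun k : ℕ => ∫ r, max 0 (1 - (k + 1) * g r) ∂(specMeas hB u)) atTop
      (𝓝 (inner ℂ u (kerProj B g u)).re) := by
    have : ∀ k : ℕ, ∫ r, max 0 (1 - ((k : ℝ) + 1) * g r) ∂(specMeas hB u) =
        (inner ℂ u (cfc (fun r => max 0 (1 - ((k : ℝ) + 1) * g r)) B u)).re :=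
      fun k => integral_specMeas hB u (by fun_prop)
    simp only [this]
    exact (Complex.continuous_re.tendsto _).comp
      ((tendsto_const_nhds (x := u)).inner (cfc_cutoff_tendsto hB hg hg0 u))
  have h3 := tendsto_nhds_unique h1 h2
  have hm : MeasurableSet {r | g r = 0} := (isClosed_eq hg continuous_const).measurableSet
  have hP := isStarProjection_kerProj (B := B) g
  rw [integral_indicator hm, setIntegral_const, smul_eq_mul, mul_one, ← hP.apply_apply,
    ← hP.inner_apply, re_inner_self] at h3
  rw [← h3, Measure.real, ENNReal.ofReal_toReal (measure_ne_top _ _)]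

end SpectralMeasure

end TwistedL2

namespace TwistedL2

/-! ### The spectral theorem for a nonnegative operator, from its resolvent -/

section Existence

variable {H : Type*} [NormedAddCommGroup H] [InnerProductSpace ℂ H] [CompleteSpace H]
  {A : H →ₗ.[ℂ] H} {R : H →L[ℂ] H}

theorem _root_.IsStarProjection.norm_sub_apply_sq {P : H →L[ℂ] H} (hP : IsStarProjection P)
    (u : H) : ‖u - P u‖ ^ 2 = ‖u‖ ^ 2 - ‖P u‖ ^ 2 := by
  have h1 := norm_sub_smul_sq u (P u) 1
  have h2 : (inner ℂ u (P u)).re = ‖P u‖ ^ 2 := by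
    rw [← hP.apply_apply, ← hP.inner_apply, re_inner_self, hP.apply_apply]
  rw [h2, Complex.ofReal_one, one_smul] at h1
  linarith

theorem tendsto_of_norm_sq {α : Type*} {l : Filter α} {f : α → H} {a : H}
    (h : Tendsto (fun x => ‖f x - a‖ ^ 2) l (𝓝 0)) : Tendsto f l (𝓝 a) := by
  rw [tendsto_iff_norm_sub_tendsto_zero]
  have := h.sqrt
  simpa using this

/-- The spectral projections of `A`, constructed from the resolvent `R = (1 + A)⁻¹`. -/
noncomputable def resolventFamily (R : H →L[ℂ] H) (t : ℝ) : H →L[ℂ] H :=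
  if t < 0 then 0 else kerProj R fun r => max ((1 + t)⁻¹ - r) 0

namespace IsNonnegResolvent

variable (hA : IsNonnegResolvent A R)
include hA

theorem norm_apply_le (x : H) : ‖R x‖ ≤ ‖x‖ := by
  by_contra h
  push Not at h
  have h1 := hA.norm_sq_le x
  have h2 : (inner ℂ x (R x)).re ≤ ‖x‖ * ‖R x‖ :=
    (Complex.re_le_norm _).trans (norm_inner_le_norm _ _)
  nlinarith [norm_nonneg x]

theorem spectrum_subset : spectrum ℝ R ⊆ Set.Icc 0 1 := by
  intro r hr
  have h0 : 0 ≤ R := by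
    rw [ContinuousLinearMap.nonneg_iff_isPositive, ContinuousLinearMap.isPositive_def]
    refine ⟨ContinuousLinearMap.isSelfAdjoint_iff_isSymmetric.1 hA.isSelfAdjoint, fun x => ?_⟩
    rw [ContinuousLinearMap.reApplyInnerSelf_apply, hA.inner_apply]
    exact (sq_nonneg _).trans (hA.norm_sq_le x)
  refine ⟨spectrum_nonneg_of_nonneg h0 hr, ?_⟩
  have h1 := spectrum.norm_le_norm_mul_of_mem hr
  have h2 : ‖R‖ ≤ 1 := ContinuousLinearMap.opNorm_le_bound _ zero_le_one fun x => by
    rw [one_mul]; exact hA.norm_apply_le x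
  have h3 : ‖(1 : H →L[ℂ] H)‖ ≤ 1 := ContinuousLinearMap.norm_id_le
  calc r ≤ ‖r‖ := Real.le_norm_self r
    _ ≤ ‖R‖ * ‖(1 : H →L[ℂ] H)‖ := h1
    _ ≤ 1 * 1 := by gcongr
    _ = 1 := one_mul 1

/-- There is no mass at `0` because `R` is injective. Thus `r ↦ r⁻¹ - 1`, which takes the spectral
parameter of `R` to that of `A`, is meaningful almost everywhere. -/
theorem ae_Ioc (u : H) : ∀ᵐ r ∂(specMeas hA.isSelfAdjoint u), 0 < r ∧ r ≤ 1 := by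
  have h0 : specMeas hA.isSelfAdjoint u {r | |r| = 0} = 0 := by
    rw [specMeas_zeroSet hA.isSelfAdjoint continuous_abs abs_nonneg]
    have : kerProj R (fun r => |r|) u = 0 := by
      have h1 : cfc (fun r : ℝ => |r|) R (kerProj R (fun r => |r|) u) = 0 :=
        have : CompleteSpace (cfc (fun r : ℝ => |r|) R).toLinearMap.ker :=
          (cfc (fun r : ℝ => |r|) R).isClosed_ker.completeSpace_coe
        Submodule.starProjection_apply_mem (cfc (fun r : ℝ => |r|) R).toLinearMap.ker u
      apply hA.eq_zero_of_apply
      have h2 := norm_cfc_le hA.isSelfAdjoint (kerProj R (fun r => |r|) u) (f := fun r => r)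
        (g := fun r => |r|) continuous_id continuous_abs (by simp)
      rw [h1, norm_zero, cfc_id_apply hA.isSelfAdjoint] at h2
      exact norm_le_zero_iff.1 h2
    rw [this]; simp
  have h1 : ∀ᵐ r ∂(specMeas hA.isSelfAdjoint u), r ≠ 0 := by
    rw [ae_iff]
    simpa using h0
  filter_upwards [h1, ae_mem_spectrum hA.isSelfAdjoint u] with r hr hr'
  have := hA.spectrum_subset hr'
  exact ⟨lt_of_le_of_ne this.1 hr.symm, this.2⟩

/-- The spectral measure of `A`. -/
noncomputable def mu (u : H) : Measure ℝ :=
  (specMeas hA.isSelfAdjoint u).map fun r => r⁻¹ - 1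

theorem measurable_inv_sub : Measurable fun r : ℝ => r⁻¹ - 1 := by fun_prop

theorem isFiniteMeasure_mu (u : H) : IsFiniteMeasure (hA.mu u) := by
  unfold mu; infer_instance

/-- For `t ≥ 0`, `r⁻¹ - 1 ≤ t` means `(1 + t)⁻¹ ≤ r`, which is the zero set of the ramp defining
`resolventFamily`. -/
theorem mu_Iic (u : H) (t : ℝ) :
    hA.mu u (Set.Iic t) = ENNReal.ofReal (‖resolventFamily R t u‖ ^ 2) := by
  rw [mu, Measure.map_apply hA.measurable_inv_sub measurableSet_Iic]
  by_cases ht : t < 0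
  · rw [resolventFamily, if_pos ht, zero_apply, norm_zero, zero_pow two_ne_zero, ENNReal.ofReal_zero,
      measure_eq_zero_iff_ae_notMem]
    filter_upwards [hA.ae_Ioc u] with r hr
    have := (one_le_inv₀ hr.1).2 hr.2
    simp only [Set.mem_preimage, Set.mem_Iic, not_le]
    linarith
  · rw [resolventFamily, if_neg ht, ← specMeas_zeroSet hA.isSelfAdjoint (by fun_prop)
      (fun r => le_max_right _ _)]
    push Not at ht
    apply measure_congr
    filter_upwards [hA.ae_Ioc u] with r hr
    apply propext
    change r⁻¹ - 1 ≤ t ↔ max ((1 + t)⁻¹ - r) 0 = 0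
    rw [max_eq_right_iff, sub_nonpos, inv_le_comm₀ (by linarith) hr.1, sub_le_iff_le_add, add_comm]

theorem mu_univ (u : H) : hA.mu u Set.univ = ENNReal.ofReal (‖u‖ ^ 2) := by
  rw [mu, Measure.map_apply hA.measurable_inv_sub MeasurableSet.univ, Set.preimage_univ,
    ← measureReal_univ_specMeas hA.isSelfAdjoint u, Measure.real,
    ENNReal.ofReal_toReal (measure_ne_top _ _)]

theorem isStarProjection_resolventFamily (t : ℝ) : IsStarProjection (resolventFamily R t) := by
  unfold resolventFamily
  split_ifs
  · exact IsStarProjection.zero _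
  · exact isStarProjection_kerProj _

theorem resolventFamily_mul {s t : ℝ} (h : s ≤ t) :
    resolventFamily R s * resolventFamily R t = resolventFamily R s := by
  unfold resolventFamily
  by_cases hs : s < 0
  · rw [if_pos hs, zero_mul]
  · rw [if_neg hs, if_neg (by linarith)]
    push Not at hs
    refine kerProj_comp_of_le hA.isSelfAdjoint (by fun_prop) (by fun_prop) fun r => ?_
    rw [abs_of_nonneg (le_max_right _ _), abs_of_nonneg (le_max_right _ _)]
    have : (1 + t)⁻¹ ≤ (1 + s)⁻¹ := inv_anti₀ (by linarith) (by linarith)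
    exact max_le_max (by linarith) le_rfl

theorem norm_resolventFamily_sq (u : H) (t : ℝ) :
    ‖resolventFamily R t u‖ ^ 2 = (hA.mu u (Set.Iic t)).toReal := by
  rw [hA.mu_Iic, ENNReal.toReal_ofReal (by positivity)]

theorem norm_sub_resolventFamily_sq (u : H) {s t : ℝ} (h : s ≤ t) :
    ‖resolventFamily R t u - resolventFamily R s u‖ ^ 2 =
      ‖resolventFamily R t u‖ ^ 2 - ‖resolventFamily R s u‖ ^ 2 := by
  have h1 := (hA.isStarProjection_resolventFamily s).norm_sub_apply_sq (resolventFamily R t u)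
  have h2 : resolventFamily R s (resolventFamily R t u) = resolventFamily R s u :=
    DFunLike.congr_fun (hA.resolventFamily_mul h) u
  rwa [h2] at h1

theorem resolventFamily_right_continuous (t : ℝ) (u : H) :
    Tendsto (fun s => resolventFamily R s u) (𝓝[>] t) (𝓝 (resolventFamily R t u)) := by
  have := hA.isFiniteMeasure_mu u
  apply tendsto_of_norm_sq
  have h1 : Tendsto (fun s => (hA.mu u (Set.Iic s)).toReal) (𝓝[>] t)
      (𝓝 (hA.mu u (Set.Iic t)).toReal) := by
    have h2 := tendsto_measure_biInter_gt (μ := hA.mu u) (s := fun s => Set.Iic s) (a := t)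
      (fun _ _ => measurableSet_Iic.nullMeasurableSet) (fun i j _ hij => Set.Iic_subset_Iic.2 hij)
      ⟨t + 1, by simp, measure_ne_top _ _⟩
    have h3 : ⋂ r, ⋂ (_ : r > t), Set.Iic r = Set.Iic t := by
      ext x
      simp only [Set.mem_iInter, Set.mem_Iic]
      exact ⟨fun h => le_of_forall_gt_imp_ge_of_dense h, fun h r hr => h.trans hr.le⟩
    rw [h3] at h2
    exact (ENNReal.tendsto_toReal (measure_ne_top _ _)).comp h2
  have h4 := h1.sub_const (hA.mu u (Set.Iic t)).toReal
  rw [sub_self] at h4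
  refine h4.congr' ?_
  filter_upwards [self_mem_nhdsWithin] with s hs
  rw [hA.norm_sub_resolventFamily_sq u (le_of_lt hs), ← hA.norm_resolventFamily_sq,
    ← hA.norm_resolventFamily_sq]

theorem resolventFamily_tendsto_atTop (u : H) :
    Tendsto (fun t => resolventFamily R t u) atTop (𝓝 u) := by
  have := hA.isFiniteMeasure_mu u
  apply tendsto_of_norm_sq
  have h1 : Tendsto (fun t : ℝ => hA.mu u (Set.Iic t)) atTop (𝓝 (hA.mu u Set.univ)) :=
    tendsto_measure_Iic_atTop _
  have h2 := ((ENNReal.tendsto_toReal (measure_ne_top _ _)).comp h1).const_sub (‖u‖ ^ 2)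
  rw [hA.mu_univ, ENNReal.toReal_ofReal (by positivity), sub_self] at h2
  refine h2.congr fun t => ?_
  rw [norm_sub_rev, (hA.isStarProjection_resolventFamily t).norm_sub_apply_sq,
    hA.norm_resolventFamily_sq]
  rfl

/-- The spectral measures of `R w` and `w`. -/
theorem specMeas_apply (w : H) : specMeas hA.isSelfAdjoint (R w) =
    (specMeas hA.isSelfAdjoint w).withDensity fun r => ENNReal.ofReal (r ^ 2) := by
  have hi : Integrable (fun r : ℝ => r ^ 2) (specMeas hA.isSelfAdjoint w) :=
    integrable_specMeas hA.isSelfAdjoint w (by fun_prop)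
  have : IsFiniteMeasure ((specMeas hA.isSelfAdjoint w).withDensity
      fun r => ENNReal.ofReal (r ^ 2)) := isFiniteMeasure_withDensity_ofReal hi.2
  apply ext_of_forall_integral_eq_of_IsFiniteMeasure
  intro f
  rw [integral_specMeas _ _ f.continuous, integral_withDensity_eq_integral_toReal_smul
    (by fun_prop) (by simp)]
  have e : ∀ r : ℝ, (ENNReal.ofReal (r ^ 2)).toReal • f r = r * (f r * r) := fun r => by
    rw [ENNReal.toReal_ofReal (by positivity), smul_eq_mul]; ring
  simp only [e]
  rw [integral_specMeas hA.isSelfAdjoint w (f := fun r => r * (f r * r)) (by fun_prop),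
    cfc_mul_apply (f := fun r => r) (g := fun r => f r * r) (by fun_prop) (by fun_prop),
    cfc_mul_apply (g := fun r => r) f.continuous (by fun_prop)]
  have h1 : ∀ v, cfc (fun r : ℝ => r) R v = R v := fun v => cfc_id_apply hA.isSelfAdjoint v
  rw [h1, h1, hA.inner_apply]

theorem lintegral_mu (u : H) : ∫⁻ t, ENNReal.ofReal (t ^ 2) ∂(hA.mu u) =
    ∫⁻ r, ENNReal.ofReal ((r⁻¹ - 1) ^ 2) ∂(specMeas hA.isSelfAdjoint u) := by
  rw [mu, lintegral_map (by fun_prop) hA.measurable_inv_sub]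

/-- Writing `u = R f` gives its measure the density `r²` with respect to that of `f`, and `r² (r⁻¹ -
1)² = (1 - r)²` is bounded. -/
theorem lintegral_lt_top {u : H} (hu : u ∈ A.domain) :
    ∫⁻ t, ENNReal.ofReal (t ^ 2) ∂(hA.mu u) < ∞ := by
  obtain ⟨w, hw⟩ := LinearPMap.mem_domain_iff.1 hu
  have hw := (hA.mem_graph _ _).1 hw
  rw [hA.lintegral_mu, ← hw, hA.specMeas_apply, lintegral_withDensity_eq_lintegral_mul _
    (by fun_prop) (by fun_prop)]
  calc _ ≤ ∫⁻ _, 1 ∂(specMeas hA.isSelfAdjoint (u + w)) := by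
        refine lintegral_mono_ae ?_
        filter_upwards [hA.ae_Ioc (u + w)] with r hr
        rw [Pi.mul_apply, ← ENNReal.ofReal_mul (by positivity), ENNReal.ofReal_le_one,
          show r ^ 2 * (r⁻¹ - 1) ^ 2 = (1 - r) ^ 2 by
            have := hr.1.ne'
            field_simp]
        nlinarith [hr.1, hr.2]
    _ < ∞ := by rw [lintegral_const, one_mul]; exact measure_lt_top _ _

theorem inner_eq_integral {u w : H} (h : (u, w) ∈ A.graph) :
    inner ℂ u w = ((∫ t, t ∂(hA.mu u) : ℝ) : ℂ) := by
  have hw := (hA.mem_graph _ _).1 h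
  set f := u + w with hf
  have e1 : ∫ t, t ∂(hA.mu u) = (inner ℂ f (R f)).re - ‖R f‖ ^ 2 := by
    rw [mu, integral_map hA.measurable_inv_sub.aemeasurable (by fun_prop), ← hw,
      hA.specMeas_apply, integral_withDensity_eq_integral_toReal_smul (by fun_prop) (by simp)]
    have e : ∀ r : ℝ, (ENNReal.ofReal (r ^ 2)).toReal • (r⁻¹ - 1) = r - r * r := fun r => by
      rw [ENNReal.toReal_ofReal (by positivity), smul_eq_mul]
      by_cases hr : r = 0
      · simp [hr]
      · field_simp
    simp only [e]
    rw [integral_specMeas hA.isSelfAdjoint f (f := fun r => r - r * r) (by fun_prop),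
      cfc_sub_apply (f := fun r => r) (g := fun r => r * r) (by fun_prop) (by fun_prop),
      cfc_mul_apply (f := fun r => r) (g := fun r => r) (by fun_prop) (by fun_prop)]
    have h1 : ∀ v, cfc (fun r : ℝ => r) R v = R v := fun v => cfc_id_apply hA.isSelfAdjoint v
    rw [h1, h1, inner_sub_right, Complex.sub_re, ← hA.inner_apply f (R f), re_inner_self]
  have e2 : (inner ℂ u w).re = (inner ℂ f (R f)).re - ‖R f‖ ^ 2 := by
    have : w = f - R f := by rw [hw, hf]; abel
    rw [this, ← hw, inner_sub_right, Complex.sub_re, re_inner_self, hA.inner_apply]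
  have e3 : (inner ℂ u w).im = 0 := by
    have := hA.symm h h
    rw [← inner_conj_symm w u] at this
    exact Complex.conj_eq_iff_im.1 this.symm
  apply Complex.ext
  · rw [Complex.ofReal_re, e1, e2]
  · rw [Complex.ofReal_im, e3]

/-- The second moment is finite exactly when `r⁻¹` is square integrable for the measure of `u`. Then
the continuous truncations `g k` of `r⁻¹` make `g k (R) u` a Cauchy sequence. Its limit `v`
satisfies `R v = u`, and the range of `R` is contained in the domain of `A`. -/
theorem mem_domain_of_lintegral {u : H} (h : ∫⁻ t, ENNReal.ofReal (t ^ 2) ∂(hA.mu u) < ∞) :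
    u ∈ A.domain := by
  rw [hA.lintegral_mu] at h
  set ν := specMeas hA.isSelfAdjoint u with hν
  have hint : Integrable (fun r : ℝ => (r⁻¹ - 1) ^ 2) ν := by
    refine ⟨Measurable.aestronglyMeasurable (by fun_prop), ?_⟩
    rw [hasFiniteIntegral_iff_ofReal (Eventually.of_forall fun r => sq_nonneg _)]
    exact h
  have hint2 : Integrable (fun r : ℝ => r⁻¹ ^ 2) ν := by
    refine ((hint.const_mul 2).add (integrable_const (2 : ℝ))).mono'
      (Measurable.aestronglyMeasurable (by fun_prop)) (Eventually.of_forall fun r => ?_)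
    rw [Real.norm_of_nonneg (by positivity)]
    simp only [Pi.add_apply]
    nlinarith [sq_nonneg (r⁻¹ - 2)]
  let g : ℕ → ℝ → ℝ := fun k r => (max r ((k : ℝ) + 1)⁻¹)⁻¹
  have hpos : ∀ (k : ℕ) (r : ℝ), 0 < max r ((k : ℝ) + 1)⁻¹ := fun k r =>
    lt_max_of_lt_right (by positivity)
  have hg : ∀ k, Continuous (g k) := fun k =>
    Continuous.inv₀ (by fun_prop) fun r => (hpos k r).ne'
  have hgle : ∀ k r, 0 < r → 0 ≤ g k r ∧ g k r ≤ r⁻¹ := fun k r hr =>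
    ⟨inv_nonneg.2 (hpos k r).le, inv_anti₀ hr (le_max_left _ _)⟩
  have hglim : ∀ r, 0 < r → ∀ᶠ k : ℕ in atTop, g k r = r⁻¹ := fun r hr => by
    obtain ⟨N, hN⟩ := exists_nat_gt r⁻¹
    filter_upwards [eventually_ge_atTop N] with k hk
    have : (N : ℝ) ≤ k := by exact_mod_cast hk
    have : ((k : ℝ) + 1)⁻¹ ≤ r := by
      rw [inv_le_comm₀ (by positivity) hr]; linarith
    simp only [g, max_eq_left this]
  let F : ℕ → ℝ := fun k => ∫ r, (g k r - r⁻¹) ^ 2 ∂ν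
  have hFi : ∀ k, Integrable (fun r => (g k r - r⁻¹) ^ 2) ν := fun k => by
    refine hint2.mono' (((hg k).measurable.sub measurable_inv).pow_const 2).aestronglyMeasurable ?_
    filter_upwards [hA.ae_Ioc u] with r hr
    have := hgle k r hr.1
    rw [Real.norm_of_nonneg (by positivity)]
    nlinarith
  have hF : Tendsto F atTop (𝓝 0) := by
    have := tendsto_integral_of_dominated_convergence (μ := ν)
      (F := fun k r => (g k r - r⁻¹) ^ 2) (f := fun _ => 0) (fun r => r⁻¹ ^ 2)
      (fun k => (hFi k).aestronglyMeasurable) hint2 (fun k => by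
        filter_upwards [hA.ae_Ioc u] with r hr
        have := hgle k r hr.1
        rw [Real.norm_of_nonneg (by positivity)]
        nlinarith) (by
        filter_upwards [hA.ae_Ioc u] with r hr
        refine tendsto_const_nhds.congr' ?_
        filter_upwards [hglim r hr.1] with k hk
        rw [hk, sub_self]; ring)
    rwa [integral_zero] at this
  let w : ℕ → H := fun k => cfc (g k) R u
  have hw : ∀ k l, ‖w k - w l‖ ^ 2 ≤ 2 * F k + 2 * F l := by
    intro k l
    have e : w k - w l = cfc (fun r => g k r - g l r) R u := (cfc_sub_apply (hg k) (hg l) u).symm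
    rw [e, norm_cfc_sq hA.isSelfAdjoint u (f := fun r => g k r - g l r) ((hg k).sub (hg l)), ← integral_const_mul,
      ← integral_const_mul, ← integral_add ((hFi k).const_mul 2) ((hFi l).const_mul 2)]
    refine integral_mono (integrable_specMeas _ _ (((hg k).sub (hg l)).pow 2))
      (((hFi k).const_mul 2).add ((hFi l).const_mul 2)) fun r => ?_
    beta_reduce
    nlinarith [sq_nonneg (g k r - r⁻¹ + (g l r - r⁻¹))]
  have hcau : CauchySeq w := by
    rw [Metric.cauchySeq_iff]
    intro ε hε
    obtain ⟨N, hN⟩ := (hF.eventually_lt_const (show (0 : ℝ) < ε ^ 2 / 4 by positivity)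
      ).exists_forall_of_atTop
    refine ⟨N, fun k hk l hl => ?_⟩
    rw [dist_eq_norm]
    refine lt_of_pow_lt_pow_left₀ 2 hε.le ?_
    linarith [hw k l, hN k hk, hN l hl]
  obtain ⟨v, hv⟩ := cauchySeq_tendsto_of_complete hcau
  have hlim2 : Tendsto (fun k => R (w k)) atTop (𝓝 u) := by
    apply tendsto_of_norm_sq
    have e : ∀ k, ‖R (w k) - u‖ ^ 2 = ∫ r, (r * g k r - 1) ^ 2 ∂ν := fun k => by
      have : R (w k) - u = cfc (fun r => r * g k r - 1) R u := by
        rw [cfc_sub_apply (f := fun r => r * g k r) (continuous_id.mul (hg k)) continuous_const,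
          cfc_mul_apply (f := fun r => r) continuous_id (hg k), cfc_one_apply hA.isSelfAdjoint]
        congr 1
        exact (cfc_id_apply hA.isSelfAdjoint _).symm
      rw [this, norm_cfc_sq hA.isSelfAdjoint u (f := fun r => r * g k r - 1)
        ((continuous_id.mul (hg k)).sub continuous_const)]
    simp only [e]
    have := tendsto_integral_of_dominated_convergence (μ := ν)
      (F := fun k r => (r * g k r - 1) ^ 2) (f := fun _ => 0) (fun r => 1)
      (fun k => (((continuous_id.mul (hg k)).sub continuous_const).pow 2).aestronglyMeasurable)
      (integrable_const _) (fun k => by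
        filter_upwards [hA.ae_Ioc u] with r hr
        have h1 := hgle k r hr.1
        have h2 : 0 ≤ r * g k r := mul_nonneg hr.1.le h1.1
        have h3 : r * g k r ≤ 1 := by
          calc _ ≤ r * r⁻¹ := mul_le_mul_of_nonneg_left h1.2 hr.1.le
            _ = 1 := mul_inv_cancel₀ hr.1.ne'
        rw [Real.norm_of_nonneg (by positivity)]
        nlinarith) (by
        filter_upwards [hA.ae_Ioc u] with r hr
        refine tendsto_const_nhds.congr' ?_
        filter_upwards [hglim r hr.1] with k hk
        rw [hk, mul_inv_cancel₀ hr.1.ne', sub_self]; ring)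
    rwa [integral_zero] at this
  have : R v = u := tendsto_nhds_unique ((R.continuous.tendsto v).comp hv) hlim2
  rw [← this]
  exact mem_domain_of_graph (hA.mem v)

/-- The spectral theorem for nonnegative self-adjoint operators. -/
theorem isSpectralFamily : IsSpectralFamily A (resolventFamily R) where
  isStarProjection := hA.isStarProjection_resolventFamily
  mul_of_le := fun _ _ h => hA.resolventFamily_mul h
  right_continuous := hA.resolventFamily_right_continuous
  tendsto_atBot := fun u => tendsto_const_nhds.congr' (by
    filter_upwards [eventually_lt_atBot 0] with t ht
    simp [resolventFamily, ht])
  tendsto_atTop := hA.resolventFamily_tendsto_atTop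
  integral_eq := fun u => ⟨hA.mu u, hA.mu_Iic u,
    ⟨hA.lintegral_lt_top, hA.mem_domain_of_lintegral⟩,
    fun h => hA.inner_eq_integral (A.mem_graph ⟨u, h⟩)⟩

theorem isSpectralFamily_spectralFamily : IsSpectralFamily A (spectralFamily A) := by
  have h : ∃ E, IsSpectralFamily A E := ⟨_, hA.isSpectralFamily⟩
  rw [spectralFamily, dif_pos h]
  exact h.choose_spec

theorem isCut_spectralFamily (t : ℝ) : IsCut A t (spectralFamily A t) :=
  hA.isSpectralFamily_spectralFamily.isCut hA t

end IsNonnegResolvent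

end Existence

end TwistedL2

namespace TwistedL2

/-! ### Comparing Laplacians of isomorphic complexes -/

section Comparison

variable {H K L : Type*}
  [NormedAddCommGroup H] [InnerProductSpace ℂ H] [CompleteSpace H]
  [NormedAddCommGroup K] [InnerProductSpace ℂ K] [CompleteSpace K]
  [NormedAddCommGroup L] [InnerProductSpace ℂ L] [CompleteSpace L]
  {S S₀ : L →ₗ.[ℂ] H} {T T₀ : H →ₗ.[ℂ] K}

/-- Bounded self-adjoint isomorphisms intertwining the complexes `(S, T)` and `(S₀, T₀)`. -/
structure Intertwines (S : L →ₗ.[ℂ] H) (T : H →ₗ.[ℂ] K) (S₀ : L →ₗ.[ℂ] H) (T₀ : H →ₗ.[ℂ] K)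
    (M M' : H →L[ℂ] H) (MK : K →L[ℂ] K) (ML : L →L[ℂ] L) : Prop where
  apply_apply : ∀ x, M (M' x) = x
  apply_apply' : ∀ x, M' (M x) = x
  symm : ∀ x y, inner ℂ (M x) y = inner ℂ x (M y)
  symm' : ∀ x y, inner ℂ (M' x) y = inner ℂ x (M' y)
  symmL : ∀ x y, inner ℂ (ML x) y = inner ℂ x (ML y)
  mapT : ∀ u y, (u, y) ∈ T.graph → (M u, MK y) ∈ T₀.graph
  kerT : ∀ u, (u, (0 : K)) ∈ T₀.graph → (M' u, (0 : K)) ∈ T.graph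
  mapS : ∀ x y, (x, y) ∈ S₀.graph → (ML x, M' y) ∈ S.graph

theorem starProjection_comm (G : Submodule ℂ H) [G.HasOrthogonalProjection] (U : H ≃ₗᵢ[ℂ] H)
    (h : ∀ x ∈ G, U x ∈ G) (h' : ∀ x ∈ G, U.symm x ∈ G) (x : H) :
    G.starProjection (U x) = U (G.starProjection x) := by
  refine Submodule.eq_starProjection_of_mem_of_inner_eq_zero
    (h _ (Submodule.starProjection_apply_mem _ _)) fun w hw => ?_
  rw [← map_sub, ← U.apply_symm_apply w, U.inner_map_map]
  exact Submodule.starProjection_inner_eq_zero _ _ (h' _ hw)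

/-- A bounded map `J` comparing the quadratic forms of the Laplacians of intertwined complexes. -/
structure IsComparison (S : L →ₗ.[ℂ] H) (T : H →ₗ.[ℂ] K) (S₀ : L →ₗ.[ℂ] H) (T₀ : H →ₗ.[ℂ] K)
    (J : H →L[ℂ] H) (c C : ℝ) : Prop where
  c_pos : 0 < c
  C_pos : 0 < C
  le_norm : ∀ u, c * ‖u‖ ≤ ‖J u‖
  form : ∀ u y z, (u, y) ∈ T.graph → (u, z) ∈ S.adjoint.graph → ∃ y₀ z₀, (J u, y₀) ∈ T₀.graph ∧
    (J u, z₀) ∈ S₀.adjoint.graph ∧ ‖y₀‖ ^ 2 + ‖z₀‖ ^ 2 ≤ C * (‖y‖ ^ 2 + ‖z‖ ^ 2)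

/-- `M` carries `T` to `T₀` but says nothing about `S^*`; by duality its inverse `M'` carries `S^*`
to `S₀^*`. So `J` uses `M` on the complement of `ker T`, where the energy is `‖Tu‖²`, and `M'` on
`ker T`, where it is `‖S^*u‖²`. The projections `1 - ρ` and `ρ` after them keep the two images
orthogonal and do not alter the energies, because `T₀` vanishes on the range of `ρ` and `S₀^*` on
that of `1 - ρ`. -/
theorem Intertwines.exists_comparison {M M' : H →L[ℂ] H} {MK : K →L[ℂ] K} {ML : L →L[ℂ] L}
    (h : Intertwines S T S₀ T₀ M M' MK ML) (hC : IsHilbertComplex S T)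
    (hC₀ : IsHilbertComplex S₀ T₀) : ∃ (J : H →L[ℂ] H) (c C : ℝ), IsComparison S T S₀ T₀ J c C ∧
      ∀ U : H ≃ₗᵢ[ℂ] H, (∀ x ∈ gker T, U x ∈ gker T) → (∀ x ∈ gker T, U.symm x ∈ gker T) →
        (∀ x ∈ gker T₀, U x ∈ gker T₀) → (∀ x ∈ gker T₀, U.symm x ∈ gker T₀) →
        (∀ x, M (U x) = U (M x)) → (∀ x, M' (U x) = U (M' x)) → ∀ x, J (U x) = U (J x) := by
  have hP := hC.hasOrthogonalProjection
  have hP₀ := hC₀.hasOrthogonalProjection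
  let π := (gker T).starProjection
  let ρ := (gker T₀).starProjection
  let J : H →L[ℂ] H := (1 - ρ) ∘L M ∘L (1 - π) + ρ ∘L M' ∘L π
  have hJ : ∀ u, J u = (M (u - π u) - ρ (M (u - π u))) + ρ (M' (π u)) := fun u => rfl
  have hπ : ∀ x, (π x, (0 : K)) ∈ T.graph := fun x =>
    mem_gker.1 (Submodule.starProjection_apply_mem _ x)
  have hπ' : ∀ x, (x - π x, (0 : L)) ∈ S.adjoint.graph := fun x =>
    hC.mem_adjoint_of_orthogonal (Submodule.sub_starProjection_mem_orthogonal x)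
  have hρ : ∀ x, (ρ x, (0 : K)) ∈ T₀.graph := fun x =>
    mem_gker.1 (Submodule.starProjection_apply_mem _ x)
  have hρ' : ∀ x, (x - ρ x, (0 : L)) ∈ S₀.adjoint.graph := fun x =>
    hC₀.mem_adjoint_of_orthogonal (Submodule.sub_starProjection_mem_orthogonal x)
  -- The adjoint of the intertwining relation for `S₀` and `S`.
  have hmapS : ∀ u z, (u, z) ∈ S.adjoint.graph → (M' u, ML z) ∈ S₀.adjoint.graph := by
    intro u z huz
    rw [mem_graph_adjoint hC₀.denseS]
    intro x y hxy
    rw [← h.symm', (mem_graph_adjoint hC.denseS).1 huz _ _ (h.mapS _ _ hxy), h.symmL]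
  have hkerM : ∀ u, (u, (0 : K)) ∈ T.graph → (M u, (0 : K)) ∈ T₀.graph := fun u hu => by
    simpa using h.mapT u 0 hu
  have horth : ∀ x k, (k, (0 : K)) ∈ T.graph → inner ℂ (x - π x) k = 0 := fun x k hk =>
    Submodule.starProjection_inner_eq_zero _ _ (mem_gker.2 hk)
  have horth₀ : ∀ x k, (k, (0 : K)) ∈ T₀.graph → inner ℂ (x - ρ x) k = 0 := fun x k hk =>
    Submodule.starProjection_inner_eq_zero _ _ (mem_gker.2 hk)
  let m := ‖M‖ + ‖M'‖ + 1
  have hm : 0 < m := by positivity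
  have hMm : ∀ x, ‖M x‖ ≤ m * ‖x‖ := fun x => (M.le_opNorm x).trans (by
    gcongr; simp only [m]; linarith [norm_nonneg M'])
  have hMm' : ∀ x, ‖M' x‖ ≤ m * ‖x‖ := fun x => (M'.le_opNorm x).trans (by
    gcongr; simp only [m]; linarith [norm_nonneg M])
  refine ⟨J, m⁻¹, ‖MK‖ ^ 2 + ‖ML‖ ^ 2 + 1, ⟨by positivity, by positivity, ?_, ?_⟩, ?_⟩
  · intro u
    set u₁ := u - π u with hu₁
    set u₂ := π u with hu₂
    set v₁ := M u₁ - ρ (M u₁) with hv₁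
    set v₂ := ρ (M' u₂) with hv₂
    -- Cutting off `ρ (M u₁)` loses no control of `u₁`: `M'` sends it into `ker T`, to which `u₁` is
    -- orthogonal, so `‖u₁‖² = ⟨u₁, M' v₁⟩`. The bound on `u₂` is the mirror image.
    have b1 : ‖u₁‖ ≤ m * ‖v₁‖ := by
      have e : inner ℂ u₁ u₁ = inner ℂ u₁ (M' v₁) := by
        have h1 : M' v₁ = u₁ - M' (ρ (M u₁)) := by rw [hv₁, map_sub, h.apply_apply']
        have h2 : inner ℂ u₁ (M' (ρ (M u₁))) = 0 := horth u _ (h.kerT _ (hρ (M u₁)))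
        rw [h1, inner_sub_right u₁ u₁ (M' (ρ (M u₁))), h2, sub_zero]
      have e2 : ‖u₁‖ * ‖u₁‖ ≤ ‖u₁‖ * (m * ‖v₁‖) := by
        calc ‖u₁‖ * ‖u₁‖ = (inner ℂ u₁ u₁).re := by rw [re_inner_self, sq]
          _ = (inner ℂ u₁ (M' v₁)).re := by rw [e]
          _ ≤ ‖u₁‖ * ‖M' v₁‖ := (Complex.re_le_norm _).trans (norm_inner_le_norm _ _)
          _ ≤ _ := by gcongr; exact hMm' _
      rcases (norm_nonneg u₁).eq_or_lt with h0 | h0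
      · rw [← h0]; positivity
      · exact le_of_mul_le_mul_left e2 h0
    have b2 : ‖u₂‖ ≤ m * ‖v₂‖ := by
      have e : inner ℂ u₂ u₂ = inner ℂ (M v₂) u₂ := by
        have h1 : M v₂ = u₂ - M (M' u₂ - v₂) := by rw [map_sub, h.apply_apply]; abel
        rw [h1, inner_sub_left, h.symm, horth₀ _ _ (hkerM _ (hπ u)), sub_zero]
      have e2 : ‖u₂‖ * ‖u₂‖ ≤ (m * ‖v₂‖) * ‖u₂‖ := by
        calc ‖u₂‖ * ‖u₂‖ = (inner ℂ u₂ u₂).re := by rw [re_inner_self, sq]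
          _ = (inner ℂ (M v₂) u₂).re := by rw [e]
          _ ≤ ‖M v₂‖ * ‖u₂‖ := (Complex.re_le_norm _).trans (norm_inner_le_norm _ _)
          _ ≤ _ := by gcongr; exact hMm _
      rcases (norm_nonneg u₂).eq_or_lt with h0 | h0
      · rw [← h0]; positivity
      · exact le_of_mul_le_mul_right e2 h0
    have p1 : ‖u‖ * ‖u‖ = ‖u₁‖ * ‖u₁‖ + ‖u₂‖ * ‖u₂‖ := by
      rw [← norm_add_sq_eq_norm_sq_add_norm_sq_of_inner_eq_zero _ _ (horth u _ (hπ u)),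
        sub_add_cancel]
    have p2 : ‖J u‖ * ‖J u‖ = ‖v₁‖ * ‖v₁‖ + ‖v₂‖ * ‖v₂‖ := by
      rw [← norm_add_sq_eq_norm_sq_add_norm_sq_of_inner_eq_zero _ _ (horth₀ _ _ (hρ _))]
      rfl
    rw [inv_mul_le_iff₀ hm]
    have q1 := mul_self_le_mul_self (norm_nonneg _) b1
    have q2 := mul_self_le_mul_self (norm_nonneg _) b2
    have q3 : (m * ‖J u‖) ^ 2 = m * ‖v₁‖ * (m * ‖v₁‖) + m * ‖v₂‖ * (m * ‖v₂‖) := by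
      calc _ = m ^ 2 * (‖J u‖ * ‖J u‖) := by ring
        _ = _ := by rw [p2]; ring
    exact abs_le_of_sq_le_sq' (by rw [q3, sq, p1]; exact add_le_add q1 q2) (by positivity) |>.2
  · intro u y z hy hz
    have hy1 : (u - π u, y) ∈ T.graph := by simpa using graph_sub hy (hπ u)
    have hz2 : (π u, z) ∈ S.adjoint.graph := by simpa using graph_sub hz (hπ' u)
    refine ⟨MK y, ML z, ?_, ?_, ?_⟩
    · have := graph_add (graph_sub (h.mapT _ _ hy1) (hρ (M (u - π u)))) (hρ (M' (π u)))
      rw [hJ]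
      simpa using this
    · have h1 := graph_sub (hmapS _ _ hz2) (hρ' (M' (π u)))
      have := graph_add (hρ' (M (u - π u))) h1
      rw [hJ]
      simpa using this
    · have h1 : ‖MK y‖ ^ 2 ≤ ‖MK‖ ^ 2 * ‖y‖ ^ 2 := by
        rw [← mul_pow]; gcongr; exact MK.le_opNorm y
      have h2 : ‖ML z‖ ^ 2 ≤ ‖ML‖ ^ 2 * ‖z‖ ^ 2 := by
        rw [← mul_pow]; gcongr; exact ML.le_opNorm z
      nlinarith [mul_nonneg (sq_nonneg ‖MK‖) (sq_nonneg ‖z‖),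
        mul_nonneg (sq_nonneg ‖ML‖) (sq_nonneg ‖y‖), sq_nonneg ‖y‖, sq_nonneg ‖z‖]
  · intro U k1 k2 k3 k4 hM hM' x
    have e1 : ∀ x, π (U x) = U (π x) := starProjection_comm _ U k1 k2
    have e2 : ∀ x, ρ (U x) = U (ρ x) := starProjection_comm _ U k3 k4
    simp only [hJ, e1, hM', e2, hM, ← map_sub, ← map_add]

/-- The spectral projection of the second Laplacian is bounded below on the `J`-image of the
range of the spectral projection of the first one. -/
theorem IsComparison.le_norm_cut {J : H →L[ℂ] H} {c C : ℝ} (h : IsComparison S T S₀ T₀ J c C)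
    (hC : IsHilbertComplex S T) (hC₀ : IsHilbertComplex S₀ T₀)
    {R₀ : H →L[ℂ] H} (hA₀ : IsNonnegResolvent (hodge S₀ T₀) R₀)
    {t : ℝ} (ht : 0 < t) {P Q : H →L[ℂ] H} (hP : IsCut (hodge S T) t P)
    (hQ : IsCut (hodge S₀ T₀) (4 * C / c ^ 2 * t) Q) {u : H} (hu : P u = u) :
    c / 2 * ‖u‖ ≤ ‖Q (J u)‖ := by
  have hc := h.c_pos
  have hCp := h.C_pos
  obtain ⟨w, hw, -⟩ := hP.exists_apply hu
  obtain ⟨y, z, hy, hz, hf⟩ := hC.exists_form hw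
  have e1 := congrArg Complex.re (hf u y z hy hz)
  rw [Complex.add_re, re_inner_self, re_inner_self] at e1
  have e2 := hP.le _ _ hw hu
  obtain ⟨y₀, z₀, hy₀, hz₀, h3⟩ := h.form u y z hy hz
  have e4 := hQ.form_le hC₀ (by positivity) hA₀ hy₀ hz₀
  have e5 := h.le_norm u
  have e6 : ‖y₀‖ ^ 2 + ‖z₀‖ ^ 2 ≤ C * (t * ‖u‖ ^ 2) := h3.trans (by gcongr; linarith)
  -- The energy of `J u` is at most `C t ‖u‖²`, so cutting at `4Ct/c²` leaves a remainder of norm at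
  -- most `(c/2)‖u‖`, half of the lower bound for `‖J u‖`.
  have e7 : (C * t) * (2 * ‖J u - Q (J u)‖) ^ 2 ≤ (C * t) * (c * ‖u‖) ^ 2 := by
    have := mul_le_mul_of_nonneg_left (e4.trans e6) (sq_nonneg c)
    calc _ = c ^ 2 * (4 * C / c ^ 2 * t * ‖J u - Q (J u)‖ ^ 2) := by field_simp; ring
      _ ≤ _ := this
      _ = _ := by ring
  have e8 := le_of_mul_le_mul_left e7 (by positivity)
  have e9 := abs_le_of_sq_le_sq' e8 (by positivity) |>.2
  have e10 : ‖J u‖ ≤ ‖J u - Q (J u)‖ + ‖Q (J u)‖ := by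
    simpa using norm_add_le (J u - Q (J u)) (Q (J u))
  linarith

end Comparison

end TwistedL2

namespace TwistedL2

/-! ### Translations and restrictions of forms -/

section Translations

variable {n j : ℕ}

/-- Translation of `L²` forms by a vector. -/
noncomputable def translate (v : V n) : L2Form n j ≃ₗᵢ[ℂ] L2Form n j :=
  LinearIsometryEquiv.ofSurjective
    (Lp.compMeasurePreservingₗᵢ ℂ (fun x : V n => x + v) (measurePreserving_add_right volume v))
    fun f => ⟨Lp.compMeasurePreserving (fun x : V n => x + -v)
      (measurePreserving_add_right volume (-v)) f, by
      apply Lp.ext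
      refine (Lp.coeFn_compMeasurePreserving _ (measurePreserving_add_right volume v)).trans ?_
      have h := (measurePreserving_add_right (volume : Measure (V n)) v).quasiMeasurePreserving.ae_eq
        (Lp.coeFn_compMeasurePreserving f (measurePreserving_add_right volume (-v)))
      refine h.trans (Eventually.of_forall fun x => ?_)
      simp⟩

theorem translate_coe (v : V n) (f : L2Form n j) : translate v f =ᵐ[volume] fun x => f (x + v) :=
  Lp.coeFn_compMeasurePreserving f (measurePreserving_add_right volume v)

theorem translate_translate (v w : V n) (f : L2Form n j) :
    translate v (translate w f) = translate (v + w) f := by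
  apply Lp.ext
  refine (translate_coe v _).trans (EventuallyEq.trans ?_ (translate_coe (v + w) f).symm)
  refine ((measurePreserving_add_right (volume : Measure (V n)) v).quasiMeasurePreserving.ae_eq
    (translate_coe w f)).trans (Eventually.of_forall fun x => ?_)
  simp [add_assoc]

theorem translate_zero (f : L2Form n j) : translate 0 f = f := by
  apply Lp.ext
  refine (translate_coe 0 f).trans (Eventually.of_forall fun x => ?_)
  simp

theorem translate_symm (v : V n) (f : L2Form n j) : (translate v).symm f = translate (-v) f := by
  rw [LinearIsometryEquiv.symm_apply_eq, translate_translate, add_neg_cancel, translate_zero]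

theorem ofReal_norm_sq {α E : Type*} [MeasurableSpace α] {μ : Measure α} [NormedAddCommGroup E]
    (f : Lp E 2 μ) : ENNReal.ofReal (‖f‖ ^ 2) = ∫⁻ x, ‖f x‖ₑ ^ 2 ∂μ := by
  rw [Lp.norm_def, ← ENNReal.toReal_pow, ENNReal.ofReal_toReal
    (ENNReal.pow_ne_top (Lp.eLpNorm_ne_top f)),
    eLpNorm_eq_lintegral_rpow_enorm_toReal two_ne_zero ENNReal.ofNat_ne_top]
  simp only [ENNReal.toReal_ofNat, ENNReal.rpow_ofNat]
  rw [← ENNReal.rpow_natCast, ← ENNReal.rpow_mul]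
  norm_num

/-- The space of `L²` forms supported in a measurable set. -/
def suppIn (F : Set (V n)) : Submodule ℂ (L2Form n j) where
  carrier := {f | ∀ᵐ x, x ∉ F → f x = 0}
  zero_mem' := by
    filter_upwards [Lp.coeFn_zero (EuclideanSpace ℂ (MultiIndex n j)) 2 volume] with x hx _
    rw [hx]; rfl
  add_mem' := by
    intro f g hf hg
    filter_upwards [hf, hg, Lp.coeFn_add f g] with x h1 h2 h3 hx
    rw [h3, Pi.add_apply, h1 hx, h2 hx, add_zero]
  smul_mem' := by
    intro c f hf
    filter_upwards [hf, Lp.coeFn_smul c f] with x h1 h2 hx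
    rw [h2, Pi.smul_apply, h1 hx, smul_zero]

theorem mem_suppIn {F : Set (V n)} {f : L2Form n j} :
    f ∈ suppIn F ↔ ∀ᵐ x, x ∉ F → f x = 0 := Iff.rfl

/-- The restriction of an `L²` form to a measurable set. -/
noncomputable def restrictTo {F : Set (V n)} (hF : MeasurableSet F) (f : L2Form n j) : L2Form n j :=
  ((Lp.memLp f).indicator hF).toLp _

theorem restrictTo_coe {F : Set (V n)} (hF : MeasurableSet F) (f : L2Form n j) :
    restrictTo hF f =ᵐ[volume] F.indicator f := MemLp.coeFn_toLp _

theorem restrictTo_mem {F : Set (V n)} (hF : MeasurableSet F) (f : L2Form n j) :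
    restrictTo hF f ∈ suppIn F := by
  filter_upwards [restrictTo_coe hF f] with x hx hxF
  rw [hx, Set.indicator_of_notMem hxF]

theorem ofReal_norm_restrictTo {F : Set (V n)} (hF : MeasurableSet F) (f : L2Form n j) :
    ENNReal.ofReal (‖restrictTo hF f‖ ^ 2) = ∫⁻ x in F, ‖f x‖ₑ ^ 2 := by
  rw [ofReal_norm_sq, ← lintegral_indicator hF]
  apply lintegral_congr_ae
  filter_upwards [restrictTo_coe hF f] with x hx
  rw [hx]
  by_cases h : x ∈ F <;> simp [h]

theorem inner_restrictTo {F : Set (V n)} (hF : MeasurableSet F) {e : L2Form n j}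
    (he : e ∈ suppIn F) (f : L2Form n j) : inner ℂ e (restrictTo hF f) = inner ℂ e f := by
  rw [L2.inner_def, L2.inner_def]
  apply integral_congr_ae
  filter_upwards [restrictTo_coe hF f, he] with x hx hx2
  rw [hx]
  by_cases h : x ∈ F
  · simp [h]
  · simp [h, hx2 h]

/-- The space is the orthogonal complement of the forms supported off `F`. -/
theorem isClosed_suppIn {F : Set (V n)} (hF : MeasurableSet F) :
    IsClosed ((suppIn F : Submodule ℂ (L2Form n j)) : Set (L2Form n j)) := by
  have : ((suppIn F : Submodule ℂ (L2Form n j)) : Set (L2Form n j)) = ((suppIn Fᶜ : Submodule ℂ (L2Form n j))ᗮ : Set _) := by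
    ext f
    simp only [SetLike.mem_coe, Submodule.mem_orthogonal]
    constructor
    · intro hf g hg
      rw [L2.inner_def]
      refine (integral_congr_ae ?_).trans (integral_zero _ _)
      filter_upwards [hf, hg] with x h1 h2
      by_cases h : x ∈ F
      · rw [h2 (by simpa using h), inner_zero_left]
      · rw [h1 h, inner_zero_right]
    · intro h
      have h1 := h _ (restrictTo_mem hF.compl f)
      have h2 : inner ℂ (restrictTo hF.compl f) (restrictTo hF.compl f) = (0 : ℂ) := by
        rw [inner_restrictTo hF.compl (restrictTo_mem hF.compl f), h1]
      have h3 := restrictTo_coe hF.compl f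
      rw [inner_self_eq_zero.1 h2] at h3
      filter_upwards [h3, Lp.coeFn_zero (EuclideanSpace ℂ (MultiIndex n j)) 2 volume] with x h4 h5 hx
      rw [h5, Set.indicator_of_mem (show x ∈ Fᶜ from hx)] at h4
      exact h4.symm
  rw [this]
  exact Submodule.isClosed_orthogonal _

end Translations

/-! ### The trace property and comparison of von Neumann traces -/

section Trace

variable {n j : ℕ} (b : Module.Basis (Fin n) ℝ (V n))

/-- An operator commuting with the translations by the lattice. -/
def IsEquivariant (Y : L2Form n j →L[ℂ] L2Form n j) : Prop :=
  ∀ v ∈ Submodule.span ℤ (Set.range b), ∀ f, Y (translate v f) = translate v (Y f)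

instance : VAddInvariantMeasure (Submodule.span ℤ (Set.range b)) (V n) volume :=
  ⟨fun v s _ => by
    change volume ((fun x => (v : V n) + x) ⁻¹' s) = _
    exact measure_preimage_add volume (v : V n) s⟩

theorem ofReal_norm_sq_eq_tsum (f : L2Form n j) : ENNReal.ofReal (‖f‖ ^ 2) =
    ∑' v : Submodule.span ℤ (Set.range b),
      ENNReal.ofReal (‖restrictTo (ZSpan.fundamentalDomain_measurableSet b)
        (translate (v : V n) f)‖ ^ 2) := by
  rw [ofReal_norm_sq, (ZSpan.isAddFundamentalDomain b volume).lintegral_eq_tsum'']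
  refine tsum_congr fun v => ?_
  rw [ofReal_norm_restrictTo]
  apply lintegral_congr_ae
  filter_upwards [ae_restrict_of_ae (translate_coe (v : V n) f)] with x hx
  rw [hx, add_comm]
  rfl

theorem inner_translate_eq_zero {e e' : L2Form n j} {v w : Submodule.span ℤ (Set.range b)}
    (hvw : v ≠ w) (he : e ∈ suppIn (ZSpan.fundamentalDomain b))
    (he' : e' ∈ suppIn (ZSpan.fundamentalDomain b)) :
    inner ℂ (translate (v : V n) e) (translate (w : V n) e') = 0 := by
  rw [L2.inner_def]
  refine (integral_congr_ae ?_).trans (integral_zero _ _)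
  have hq := fun v : V n =>
    (measurePreserving_add_right (volume : Measure (V n)) v).quasiMeasurePreserving
  filter_upwards [translate_coe (v : V n) e, translate_coe (w : V n) e', (hq v).ae he,
    (hq w).ae he'] with x h1 h2 h3 h4
  rw [h1, h2]
  by_cases h : x + (v : V n) ∈ ZSpan.fundamentalDomain b
  · have h' : x + (w : V n) ∉ ZSpan.fundamentalDomain b := by
      intro h'
      apply hvw
      obtain ⟨y, -, hy⟩ := ZSpan.exist_unique_vadd_mem_fundamentalDomain b x
      have e1 : v = y := hy v (by change (v : V n) + x ∈ _; rwa [add_comm])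
      have e2 : w = y := hy w (by change (w : V n) + x ∈ _; rwa [add_comm])
      rw [e1, e2]
    rw [h4 h', inner_zero_right]
  · rw [h3 h, inner_zero_left]

/-- Lattice translates of the fundamental domain are disjoint, so an orthonormal family supported in
it remains orthonormal when all its translates are added. -/
theorem orthonormal_translate {s : Finset (L2Form n j)}
    (hs : Orthonormal ℂ (fun e : s => (e : L2Form n j)))
    (hF : ∀ e ∈ s, e ∈ suppIn (ZSpan.fundamentalDomain b)) :
    Orthonormal ℂ fun p : s × Submodule.span ℤ (Set.range b) =>
      translate (p.2 : V n) (p.1 : L2Form n j) := by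
  refine ⟨fun p => ?_, fun p q hpq => ?_⟩
  · rw [LinearIsometryEquiv.norm_map]
    exact hs.1 p.1
  · dsimp only
    by_cases h : p.2 = q.2
    · rw [h, LinearIsometryEquiv.inner_map_map]
      exact hs.2 fun h' => hpq (Prod.ext h' h)
    · exact inner_translate_eq_zero b h (hF _ p.1.2) (hF _ q.1.2)

/-- Bessel's inequality in `ℝ≥0∞`. -/
theorem tsum_ofReal_inner_le {E ι : Type*} [NormedAddCommGroup E] [InnerProductSpace ℂ E] {v : ι → E}
    (hv : Orthonormal ℂ v) (x : E) :
    ∑' i, ENNReal.ofReal (‖inner ℂ (v i) x‖ ^ 2) ≤ ENNReal.ofReal (‖x‖ ^ 2) := by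
  rw [← ENNReal.ofReal_tsum_of_nonneg (fun _ => by positivity) (hv.inner_products_summable x)]
  exact ENNReal.ofReal_le_ofReal (hv.tsum_inner_products_le x)

/-- The trace property `Tr Y^* Y ≤ Tr Y Y^*` of the von Neumann trace. -/
theorem sum_norm_sq_le {Y : L2Form n j →L[ℂ] L2Form n j} (hY : IsEquivariant b Y)
    {s : Finset (L2Form n j)} (hs : Orthonormal ℂ (fun e : s => (e : L2Form n j)))
    (hF : ∀ e ∈ s, e ∈ suppIn (ZSpan.fundamentalDomain b)) :
    ∑ e ∈ s, ENNReal.ofReal (‖Y e‖ ^ 2) ≤ ⨆ (s' : Finset (L2Form n j))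
      (_ : Orthonormal ℂ (fun e : s' => (e : L2Form n j)))
      (_ : ∀ e ∈ s', ∀ᵐ x, x ∉ ZSpan.fundamentalDomain b → e x = 0),
      ∑ e ∈ s', ENNReal.ofReal (‖ContinuousLinearMap.adjoint Y e‖ ^ 2) := by
  set K : Submodule ℂ (L2Form n j) := suppIn (ZSpan.fundamentalDomain b) with hK
  have hm := ZSpan.fundamentalDomain_measurableSet b
  have : CompleteSpace K := (isClosed_suppIn hm).completeSpace_coe
  -- `‖Y e‖²` is expanded over lattice translates of the fundamental domain and, on each, over a
  -- Hilbert basis `f` of forms supported there.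
  obtain ⟨w, B, hB⟩ := exists_hilbertBasis ℂ K
  let f : w → L2Form n j := fun k => (k : K)
  have hfon : Orthonormal ℂ f := by
    have := B.orthonormal
    rw [hB] at this
    exact this.comp_linearIsometry K.subtypeₗᵢ
  have hfK : ∀ k, f k ∈ K := fun k => (k : K).2
  have hpars : ∀ g : L2Form n j, ENNReal.ofReal (‖restrictTo hm g‖ ^ 2) =
      ∑' k, ENNReal.ofReal (‖inner ℂ (f k) g‖ ^ 2) := by
    intro g
    let g' : K := ⟨restrictTo hm g, restrictTo_mem hm g⟩
    have h1 := (B.hasSum_inner_mul_inner g' g').mapL Complex.reCLM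
    have h2 : ∀ k, Complex.reCLM (inner ℂ g' (B k) * inner ℂ (B k) g') = ‖inner ℂ (f k) g‖ ^ 2 := by
      intro k
      have e1 : inner ℂ (B k) g' = inner ℂ (f k) g := by
        rw [Submodule.coe_inner, hB]
        exact inner_restrictTo hm (hfK k) g
      rw [← inner_conj_symm g', e1, Complex.conj_mul']
      simp only [Complex.reCLM_apply]
      norm_cast
    have h3 : Complex.reCLM (inner ℂ g' g') = ‖restrictTo hm g‖ ^ 2 := re_inner_self g'
    simp only [h2, h3] at h1
    rw [← h1.tsum_eq, ENNReal.ofReal_tsum_of_nonneg (fun _ => by positivity) h1.summable]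
  calc ∑ e ∈ s, ENNReal.ofReal (‖Y e‖ ^ 2)
      = ∑' e : s, ENNReal.ofReal (‖Y e‖ ^ 2) := by
        rw [tsum_fintype, Finset.sum_coe_sort s fun e => ENNReal.ofReal (‖Y e‖ ^ 2)]
    _ = ∑' e : s, ∑' v : Submodule.span ℤ (Set.range b), ∑' k,
          ENNReal.ofReal (‖inner ℂ (f k) (translate (v : V n) (Y e))‖ ^ 2) := by
        refine tsum_congr fun e => ?_
        rw [ofReal_norm_sq_eq_tsum b]
        exact tsum_congr fun v => hpars _
    _ = ∑' k, ∑' p : s × Submodule.span ℤ (Set.range b),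
          ENNReal.ofReal (‖inner ℂ (f k) (translate (p.2 : V n) (Y p.1))‖ ^ 2) := by
        refine Eq.trans ?_ ENNReal.tsum_comm
        exact (ENNReal.tsum_prod (f := fun (e : s) (v : Submodule.span ℤ (Set.range b)) =>
          ∑' k, ENNReal.ofReal (‖inner ℂ (f k) (translate (v : V n) (Y e))‖ ^ 2))).symm
    _ ≤ ∑' k, ENNReal.ofReal (‖ContinuousLinearMap.adjoint Y (f k)‖ ^ 2) := by
        refine ENNReal.tsum_le_tsum fun k => ?_
        -- Equivariance moves the translation onto `e` and the adjoint moves `Y` onto `f k`; what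
        -- remains is Bessel's inequality for the translates of the family `s`.
        refine le_trans (le_of_eq (tsum_congr fun p => ?_))
          (tsum_ofReal_inner_le (orthonormal_translate b hs hF) (ContinuousLinearMap.adjoint Y (f k)))
        rw [← hY _ p.2.2, ContinuousLinearMap.adjoint_inner_right, ← inner_conj_symm, RCLike.norm_conj]
    _ ≤ _ := by
        classical
        rw [ENNReal.tsum_eq_iSup_sum]
        refine iSup_le fun t => ?_
        have hinj : Function.Injective f := hfon.linearIndependent.injective
        refine le_iSup_of_le (t.image f) ?_
        refine le_iSup_of_le ?_ (le_iSup_of_le ?_ (le_of_eq ?_))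
        · have : ∀ e : (t.image f : Finset _), ∃ k, f k = e := fun e => by
            obtain ⟨k, -, hk⟩ := Finset.mem_image.1 e.2
            exact ⟨k, hk⟩
          choose g hg using this
          have h1 : (fun e : (t.image f : Finset _) => (e : L2Form n j)) = f ∘ g := by
            funext e; exact (hg e).symm
          rw [h1]
          refine hfon.comp g fun e e' h => Subtype.ext ?_
          rw [← hg e, ← hg e', h]
        · intro e he
          obtain ⟨k, -, rfl⟩ := Finset.mem_image.1 he
          exact hfK k
        · rw [Finset.sum_image fun _ _ _ _ h => hinj h]

/-- Comparison of von Neumann traces of projections. -/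
theorem vnTrace_le_of_bounded_below {P Q X : L2Form n j →L[ℂ] L2Form n j}
    (hP : IsStarProjection P) (hQ : IsStarProjection Q) (hPe : IsEquivariant b P)
    (hQe : IsEquivariant b Q) (hXe : IsEquivariant b X) {c : ℝ} (hc : 0 < c)
    (h : ∀ u, P u = u → c * ‖u‖ ≤ ‖Q (X u)‖) :
    vnTrace b P ≤ ENNReal.ofReal (‖X‖ ^ 2 / c ^ 2) * vnTrace b Q := by
  have hre : ∀ {P : L2Form n j →L[ℂ] L2Form n j}, IsStarProjection P → ∀ e,
      (inner ℂ e (P e)).re = ‖P e‖ ^ 2 := fun hP e => by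
    rw [← hP.apply_apply, ← hP.inner_apply, re_inner_self, hP.apply_apply]
  -- `c² Tr P ≤ Tr Y^*Y ≤ Tr YY^* ≤ ‖X‖² Tr Q`, where the first inequality is the hypothesis, the
  -- second is the trace property and the third uses `Y^* = P X^* Q`.
  let Y := Q ∘L X ∘L P
  have hYe : IsEquivariant b Y := fun v hv f => by
    change Q (X (P (translate v f))) = translate v (Q (X (P f)))
    rw [hPe v hv, hXe v hv, hQe v hv]
  have hYadj : ∀ f, ‖ContinuousLinearMap.adjoint Y f‖ ^ 2 ≤ ‖X‖ ^ 2 * (inner ℂ f (Q f)).re := by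
    intro f
    have e1 : ContinuousLinearMap.adjoint Y f = P (ContinuousLinearMap.adjoint X (Q f)) := by
      refine ext_inner_right ℂ fun x => ?_
      rw [ContinuousLinearMap.adjoint_inner_left]
      change inner ℂ f (Q (X (P x))) = _
      rw [hP.inner_apply, ContinuousLinearMap.adjoint_inner_left, hQ.inner_apply]
    have e2 : ∀ x, ‖P x‖ ≤ ‖x‖ := fun x => by
      have := hP.norm_sub_apply_sq x
      exact abs_le_of_sq_le_sq' (by nlinarith [sq_nonneg ‖x - P x‖]) (norm_nonneg _) |>.2
    rw [e1, hre hQ, ← mul_pow]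
    gcongr
    calc _ ≤ _ := e2 _
      _ ≤ ‖ContinuousLinearMap.adjoint X‖ * ‖Q f‖ := ContinuousLinearMap.le_opNorm _ _
      _ = _ := by rw [LinearIsometryEquiv.norm_map]
  refine iSup_le fun s => iSup_le fun hs => iSup_le fun hF => ?_
  have h1 : ∑ e ∈ s, ENNReal.ofReal (inner ℂ e (P e)).re ≤
      ENNReal.ofReal ((c ^ 2)⁻¹) * ∑ e ∈ s, ENNReal.ofReal (‖Y e‖ ^ 2) := by
    rw [Finset.mul_sum]
    refine Finset.sum_le_sum fun e _ => ?_
    rw [← ENNReal.ofReal_mul (by positivity), hre hP]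
    refine ENNReal.ofReal_le_ofReal ?_
    rw [inv_mul_eq_div, le_div_iff₀ (by positivity), mul_comm, ← mul_pow]
    have := h (P e) (hP.apply_apply e)
    change _ ≤ ‖Q (X (P e))‖ ^ 2
    gcongr
  refine h1.trans ?_
  have h2 := sum_norm_sq_le b hYe hs hF
  have h3 : (⨆ (s' : Finset (L2Form n j))
      (_ : Orthonormal ℂ (fun e : s' => (e : L2Form n j)))
      (_ : ∀ e ∈ s', ∀ᵐ x, x ∉ ZSpan.fundamentalDomain b → e x = 0),
      ∑ e ∈ s', ENNReal.ofReal (‖ContinuousLinearMap.adjoint Y e‖ ^ 2)) ≤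
      ENNReal.ofReal (‖X‖ ^ 2) * vnTrace b Q := by
    refine iSup_le fun s' => iSup_le fun hs' => iSup_le fun hF' => ?_
    calc _ ≤ ∑ e ∈ s', ENNReal.ofReal (‖X‖ ^ 2) * ENNReal.ofReal (inner ℂ e (Q e)).re := by
          refine Finset.sum_le_sum fun e _ => ?_
          rw [← ENNReal.ofReal_mul (by positivity)]
          exact ENNReal.ofReal_le_ofReal (hYadj e)
      _ = ENNReal.ofReal (‖X‖ ^ 2) * ∑ e ∈ s', ENNReal.ofReal (inner ℂ e (Q e)).re := by
          rw [Finset.mul_sum]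
      _ ≤ _ := by
          gcongr
          exact le_iSup_of_le s' (le_iSup_of_le hs' (le_iSup_of_le hF' le_rfl))
  calc _ ≤ ENNReal.ofReal ((c ^ 2)⁻¹) * (ENNReal.ofReal (‖X‖ ^ 2) * vnTrace b Q) := by
        gcongr
        exact h2.trans h3
    _ = _ := by
        rw [← mul_assoc, ← ENNReal.ofReal_mul (by positivity), inv_mul_eq_div]

end Trace

end TwistedL2

namespace TwistedL2

/-! ### Exterior multiplication, contraction and the Clifford relation on coefficients -/

section Exterior

variable {n j : ℕ}

/-- The coefficient space of `j`-forms. -/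
abbrev Coeff (n j : ℕ) : Type := EuclideanSpace ℂ (MultiIndex n j)

/-- The multi-index with the `k`-th entry removed. -/
def MultiIndex.remove (I : MultiIndex n (j + 1)) (k : Fin (j + 1)) : MultiIndex n j :=
  (Fin.succAboveOrderEmb k).trans I

theorem MultiIndex.remove_apply (I : MultiIndex n (j + 1)) (k : Fin (j + 1)) (l : Fin j) :
    I.remove k l = I (k.succAbove l) := rfl

theorem MultiIndex.eq_of_range_subset {I J : MultiIndex n j} (h : Set.range J ⊆ Set.range I) :
    J = I := by
  have h1 : Set.range J = Set.range I := by
    refine Set.eq_of_subset_of_ncard_le h ?_ (Set.toFinite _)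
    rw [← Nat.card_coe_set_eq, ← Nat.card_coe_set_eq, Nat.card_range_of_injective I.injective,
      Nat.card_range_of_injective J.injective]
  exact OrderEmbedding.range_inj.1 h1

/-- Standard basis covectors `dx_I`, as alternating forms on `ℂⁿ`. -/
noncomputable def dx (I : MultiIndex n j) : (Fin n → ℂ) [⋀^Fin j]→ₗ[ℂ] ℂ :=
  Matrix.detRowAlternating.compLinearMap (LinearMap.funLeft ℂ ℂ I)

theorem dx_apply (I : MultiIndex n j) (v : Fin j → Fin n → ℂ) :
    dx I v = Matrix.det (Matrix.of fun k l => v k (I l)) := rfl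

/-- Standard basis vectors of `ℂⁿ`. -/
def bvec (i : Fin n) : Fin n → ℂ := Pi.single i 1

open Classical in
theorem dx_bvec (I J : MultiIndex n j) : dx I (fun k => bvec (J k)) = if J = I then 1 else 0 := by
  rw [dx_apply]
  split_ifs with h
  · subst h
    rw [← Matrix.det_one (n := Fin j) (R := ℂ)]
    congr 1
    ext k l
    simp [bvec, Pi.single_apply, Matrix.one_apply, eq_comm]
  · have : ∃ k, J k ∉ Set.range I := by
      by_contra! h'
      exact h (MultiIndex.eq_of_range_subset (by rintro _ ⟨k, rfl⟩; exact h' k))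
    obtain ⟨k, hk⟩ := this
    refine Matrix.det_eq_zero_of_row_eq_zero k fun l => ?_
    have : I l ≠ J k := fun h => hk ⟨l, h⟩
    simp [bvec, Pi.single_apply, this]

theorem alternating_sum_apply {ι : Type*} (s : Finset ι) (f : ι → (Fin n → ℂ) [⋀^Fin j]→ₗ[ℂ] ℂ)
    (v : Fin j → Fin n → ℂ) : (∑ i ∈ s, f i) v = ∑ i ∈ s, f i v :=
  map_sum ({ toFun := fun g => g v, map_zero' := rfl, map_add' := fun _ _ => rfl } :
    ((Fin n → ℂ) [⋀^Fin j]→ₗ[ℂ] ℂ) →+ ℂ) f s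

/-- The alternating form with given coefficients. -/
noncomputable def alt (u : Coeff n j) : (Fin n → ℂ) [⋀^Fin j]→ₗ[ℂ] ℂ := ∑ I, u I • dx I

theorem alt_apply (u : Coeff n j) (v : Fin j → Fin n → ℂ) : alt u v = ∑ I, u I * dx I v := by
  simp [alt, alternating_sum_apply]

theorem alt_bvec (u : Coeff n j) (J : MultiIndex n j) : alt u (fun k => bvec (J k)) = u J := by
  classical
  simp [alt_apply, dx_bvec]

/-- An alternating form is determined on injective families of basis vectors. Sorting such a family
makes it increasing and changes both sides by the same sign. -/
theorem ext_multiIndex {ω η : (Fin n → ℂ) [⋀^Fin j]→ₗ[ℂ] ℂ}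
    (h : ∀ J : MultiIndex n j, ω (fun k => bvec (J k)) = η (fun k => bvec (J k))) : ω = η := by
  refine (Pi.basisFun ℂ (Fin n)).ext_alternating fun f hf => ?_
  have hm : StrictMono (f ∘ Tuple.sort f) :=
    (Tuple.monotone_sort f).strictMono_of_injective (hf.comp (Tuple.sort f).injective)
  have h1 := h (OrderEmbedding.ofStrictMono _ hm)
  have e : (fun k => bvec (OrderEmbedding.ofStrictMono _ hm k)) =
      (fun k => (Pi.basisFun ℂ (Fin n)) (f k)) ∘ Tuple.sort f := by
    funext k
    simp [bvec]
  rw [e, AlternatingMap.map_perm, AlternatingMap.map_perm] at h1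
  exact smul_left_cancel _ h1

/-- The linear form `v ↦ ∑ p_i v_i`. -/
noncomputable def covec (p : Fin n → ℂ) : (Fin n → ℂ) →ₗ[ℂ] ℂ := Fintype.linearCombination ℂ p

theorem covec_apply (p v : Fin n → ℂ) : covec p v = ∑ i, v i * p i := by
  simp [covec, Fintype.linearCombination_apply]

theorem covec_bvec (p : Fin n → ℂ) (i : Fin n) : covec p (bvec i) = p i := by
  simp [covec_apply, bvec, Pi.single_apply]

/-- Exterior multiplication by a covector, on coefficients. -/
noncomputable def wedge (p : Fin n → ℂ) : Coeff n j →L[ℂ] Coeff n (j + 1) :=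
  LinearMap.toContinuousLinearMap
    { toFun := fun u => WithLp.toLp 2 fun I => ∑ k : Fin (j + 1), (-1) ^ (k : ℕ) * p (I k) * u (I.remove k)
      map_add' := fun u v => by
        ext I
        simp [mul_add, Finset.sum_add_distrib]
      map_smul' := fun c u => by
        ext I
        simp only [PiLp.smul_apply, smul_eq_mul, RingHom.id_apply, Finset.mul_sum]
        exact Finset.sum_congr rfl fun k _ => by ring }

theorem wedge_apply (p : Fin n → ℂ) (u : Coeff n j) (I : MultiIndex n (j + 1)) :
    wedge p u I = ∑ k : Fin (j + 1), (-1) ^ (k : ℕ) * p (I k) * u (I.remove k) := rfl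

theorem wedge_add (p q : Fin n → ℂ) (u : Coeff n j) : wedge (p + q) u = wedge p u + wedge q u := by
  ext I
  simp [wedge_apply, mul_add, add_mul, Finset.sum_add_distrib]

theorem wedge_smul (c : ℂ) (p : Fin n → ℂ) (u : Coeff n j) : wedge (c • p) u = c • wedge p u := by
  ext I
  simp only [wedge_apply, Pi.smul_apply, smul_eq_mul, PiLp.smul_apply, Finset.mul_sum]
  exact Finset.sum_congr rfl fun k _ => by ring

/-- Links the coefficient formula to alternatization, so that exterior algebra identities can be
proved for alternating maps. -/
theorem alt_wedge (p : Fin n → ℂ) (u : Coeff n j) :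
    alt (wedge p u) = AlternatingMap.alternatizeUncurryFin ((covec p).smulRight (alt u)) := by
  refine ext_multiIndex fun J => ?_
  rw [alt_bvec, wedge_apply, AlternatingMap.alternatizeUncurryFin_apply]
  refine Finset.sum_congr rfl fun k _ => ?_
  have : alt u (k.removeNth fun k => bvec (J k)) = u (J.remove k) := alt_bvec u (J.remove k)
  rw [LinearMap.smulRight_apply, AlternatingMap.smul_apply, this, covec_bvec]
  simp [mul_assoc]

theorem alt_injective : Function.Injective (alt : Coeff n j → _) := fun u v h => by
  ext I
  rw [← alt_bvec u, h, alt_bvec]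

theorem wedge_wedge (p : Fin n → ℂ) (u : Coeff n j) : wedge p (wedge p u) = 0 := by
  have h0 : alt (0 : Coeff n (j + 1 + 1)) = 0 := by simp [alt]
  apply alt_injective
  rw [h0, alt_wedge, alt_wedge]
  have := AlternatingMap.alternatizeUncurryFin_alternatizeUncurryFinLM_comp_of_symmetric
    (f := (covec p).smulRight ((covec p).smulRight (alt u))) fun x y => by
      simp [smul_smul, mul_comm]
  rw [← this]
  congr 1
  refine LinearMap.ext fun x => ?_
  simp

/-- Contraction with a vector, on coefficients. -/
noncomputable def contract (q : Fin n → ℂ) (w : Coeff n (j + 1)) : Coeff n j :=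
  WithLp.toLp 2 fun J => (alt w).curryLeft q fun k => bvec (J k)

theorem alt_contract (q : Fin n → ℂ) (w : Coeff n (j + 1)) :
    alt (contract q w) = (alt w).curryLeft q :=
  ext_multiIndex fun J => by rw [alt_bvec]; rfl

theorem contract_wedge_zero (p q : Fin n → ℂ) (u : Coeff n 0) :
    contract q (wedge p u) = (∑ i, q i * p i) • u := by
  ext J
  change (alt (wedge p u)).curryLeft q _ = _
  rw [AlternatingMap.curryLeft_apply_apply, alt_wedge, AlternatingMap.alternatizeUncurryFin_apply,
    Fin.sum_univ_one]
  simp only [Fin.val_zero, pow_zero, one_smul, LinearMap.smulRight_apply, AlternatingMap.smul_apply,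
    covec_apply, Matrix.cons_val_zero, PiLp.smul_apply]
  congr 1
  rw [← alt_bvec u J]
  congr 1

/-- Contraction is an antiderivation: with `q` in the first slot, the zeroth term of the alternating
sum is the pairing of `p` and `q`, and the others are those of `p ∧ ι_q u`, with signs shifted by
one. -/
theorem contract_wedge_succ (p q : Fin n → ℂ) (u : Coeff n (j + 1)) :
    contract q (wedge p u) = (∑ i, q i * p i) • u - wedge p (contract q u) := by
  ext J
  change (alt (wedge p u)).curryLeft q _ = _ - wedge p (contract q u) J
  rw [← alt_bvec (wedge p (contract q u)), alt_wedge, alt_wedge, alt_contract,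
    AlternatingMap.curryLeft_apply_apply, AlternatingMap.alternatizeUncurryFin_apply,
    AlternatingMap.alternatizeUncurryFin_apply, Fin.sum_univ_succ, sub_eq_add_neg,
    ← Finset.sum_neg_distrib]
  congr 1
  · simp only [Fin.val_zero, pow_zero, one_smul, LinearMap.smulRight_apply,
      AlternatingMap.smul_apply, covec_apply, Matrix.cons_val_zero]
    congr 1
    exact alt_bvec u J
  · refine Finset.sum_congr rfl fun k _ => ?_
    have : k.succ.removeNth (Matrix.vecCons q fun k => bvec (J k)) =
        Matrix.vecCons q (k.removeNth fun k => bvec (J k)) := by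
      funext l
      refine Fin.cases ?_ (fun l => ?_) l <;> simp [Fin.removeNth]
    simp only [LinearMap.smulRight_apply, AlternatingMap.smul_apply, this, Matrix.cons_val_succ,
      AlternatingMap.curryLeft_apply_apply, Fin.val_succ, pow_succ]
    simp

/-- Moving the vector from the front to its place `k` costs the sign `(-1) ^ k`. -/
theorem alt_cons_remove (w : Coeff n (j + 1)) (I : MultiIndex n (j + 1)) (k : Fin (j + 1)) :
    alt w (Matrix.vecCons (bvec (I k)) fun l => bvec (I.remove k l)) = (-1) ^ (k : ℕ) * w I := by
  have h := AlternatingMap.neg_one_pow_smul_map_insertNth (alt w) k (bvec (I k))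
    (fun l => bvec (I.remove k l))
  rw [← h, ← alt_bvec w I]
  have : k.insertNth (bvec (I k)) (fun l => bvec (I.remove k l)) = fun k => bvec (I k) := by
    refine Fin.insertNth_eq_iff.2 ⟨rfl, ?_⟩
    funext l; rfl
  rw [this]
  simp

theorem alt_cons_mem (w : Coeff n (j + 1)) (J : MultiIndex n j) {i : Fin n} (h : i ∈ Set.range J) :
    alt w (Matrix.vecCons (bvec i) fun l => bvec (J l)) = 0 := by
  obtain ⟨l, rfl⟩ := h
  exact AlternatingMap.map_eq_zero_of_eq _ _ (i := 0) (j := l.succ) (by simp) (Fin.succ_ne_zero l).symm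

theorem exists_remove (J : MultiIndex n j) {i : Fin n} (h : i ∉ Set.range J) :
    ∃ (I : MultiIndex n (j + 1)) (k : Fin (j + 1)), I k = i ∧ I.remove k = J := by
  classical
  let s : Finset (Fin n) := insert i (Finset.univ.image J)
  have hs : s.card = j + 1 := by
    rw [Finset.card_insert_of_notMem (by simpa using h), Finset.card_image_of_injective _ J.injective]
    simp
  let I : MultiIndex n (j + 1) := s.orderEmbOfFin hs
  have hI : Set.range I = s := Finset.range_orderEmbOfFin s hs
  obtain ⟨k, hk⟩ : i ∈ Set.range I := by rw [hI]; simp [s]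
  refine ⟨I, k, hk, (MultiIndex.eq_of_range_subset ?_).symm⟩
  rintro _ ⟨l, rfl⟩
  obtain ⟨m, hm⟩ : J l ∈ Set.range I := by rw [hI]; simp [s]
  have hmk : m ≠ k := by
    rintro rfl
    exact h ⟨l, by rw [← hm, hk]⟩
  obtain ⟨l', rfl⟩ := Fin.exists_succAbove_eq hmk
  exact ⟨l', hm⟩

theorem remove_injective : Function.Injective
    fun x : MultiIndex n (j + 1) × Fin (j + 1) => (x.1 x.2, x.1.remove x.2) := by
  rintro ⟨I, k⟩ ⟨I', k'⟩ h
  obtain ⟨h1, h2⟩ := Prod.ext_iff.1 h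
  dsimp only at h1 h2
  have hI : I = I' := by
    refine MultiIndex.eq_of_range_subset ?_
    rintro _ ⟨m, rfl⟩
    by_cases hm : m = k
    · exact ⟨k', by rw [hm, h1]⟩
    · obtain ⟨l, rfl⟩ := Fin.exists_succAbove_eq hm
      exact ⟨k'.succAbove l, by rw [← MultiIndex.remove_apply, ← h2]; rfl⟩
  subst hI
  rw [I.injective h1]

/-- Both sides are sums over pairs `(i, J)`. Pairs with `i ∉ J` correspond bijectively to an
increasing index `I` with a marked entry, with matching signs; pairs with `i ∈ J` contribute zero by
alternation. -/
theorem inner_wedge (p : Fin n → ℂ) (u : Coeff n j) (w : Coeff n (j + 1)) :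
    inner ℂ w (wedge p u) = inner ℂ (contract (fun i => starRingEnd ℂ (p i)) w) u := by
  have hc : ∀ J, contract (fun i => starRingEnd ℂ (p i)) w J = ∑ i, starRingEnd ℂ (p i) *
      alt w (Matrix.vecCons (bvec i) fun l => bvec (J l)) := by
    intro J
    change (alt w).curryLeft _ _ = _
    have : (fun i => starRingEnd ℂ (p i)) = ∑ i, starRingEnd ℂ (p i) • bvec i := by
      funext l
      simp [bvec, Pi.single_apply]
    rw [this, map_sum, alternating_sum_apply]
    simp
  let F : Fin n × MultiIndex n j → ℂ := fun x => p x.1 *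
    starRingEnd ℂ (alt w (Matrix.vecCons (bvec x.1) fun l => bvec (x.2 l))) * u x.2
  have h1 : inner ℂ w (wedge p u) =
      ∑ x : MultiIndex n (j + 1) × Fin (j + 1), F (x.1 x.2, x.1.remove x.2) := by
    rw [PiLp.inner_apply, Fintype.sum_prod_type]
    refine Finset.sum_congr rfl fun I _ => ?_
    rw [wedge_apply, RCLike.inner_apply, Finset.sum_mul]
    refine Finset.sum_congr rfl fun k _ => ?_
    simp only [F, alt_cons_remove, map_mul, map_pow, map_neg, map_one]
    ring
  have h2 : inner ℂ (contract (fun i => starRingEnd ℂ (p i)) w) u = ∑ x, F x := by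
    rw [PiLp.inner_apply, Fintype.sum_prod_type_right]
    refine Finset.sum_congr rfl fun J _ => ?_
    rw [hc, RCLike.inner_apply, map_sum, Finset.mul_sum]
    refine Finset.sum_congr rfl fun i _ => ?_
    simp only [F, map_mul, RingHomCompTriple.comp_apply, RingHom.id_apply]
    ring
  rw [h1, h2]
  refine Fintype.sum_of_injective _ remove_injective _ F ?_ fun _ => rfl
  rintro ⟨i, J⟩ h
  by_cases hi : i ∈ Set.range J
  · simp [F, alt_cons_mem w J hi]
  · obtain ⟨I, k, h1, h2⟩ := exists_remove J hi
    exact (h ⟨(I, k), Prod.ext h1 h2⟩).elim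

theorem adjoint_wedge (p : Fin n → ℂ) (w : Coeff n (j + 1)) :
    ContinuousLinearMap.adjoint (wedge p) w = contract (fun i => starRingEnd ℂ (p i)) w :=
  ext_inner_right ℂ fun u => by rw [ContinuousLinearMap.adjoint_inner_left, inner_wedge]

/-- Exterior multiplication into degree `j` (zero if `j = 0`). -/
noncomputable def prevWedge (p : Fin n → ℂ) : (j : ℕ) → Coeff n (j - 1) →L[ℂ] Coeff n j
  | 0 => 0
  | _ + 1 => wedge p

theorem wedge_prevWedge (p : Fin n → ℂ) (u : Coeff n (j - 1)) : wedge p (prevWedge p j u) = 0 := by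
  cases j with
  | zero => simp [prevWedge]
  | succ j => exact wedge_wedge p u

/-- The Clifford relation. It makes the symbol of the Laplacian a scalar; in degree zero the
incoming term is absent and contraction alone gives `|p|²`. -/
theorem adjoint_wedge_wedge_add (p : Fin n → ℂ) (u : Coeff n j) :
    ContinuousLinearMap.adjoint (wedge p) (wedge p u) +
      prevWedge p j (ContinuousLinearMap.adjoint (prevWedge p j) u) =
      ((∑ i, ‖p i‖ ^ 2 : ℝ) : ℂ) • u := by
  have hp : ((∑ i, ‖p i‖ ^ 2 : ℝ) : ℂ) = ∑ i, starRingEnd ℂ (p i) * p i := by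
    push_cast
    exact Finset.sum_congr rfl fun i _ => (Complex.conj_mul' _).symm
  rw [adjoint_wedge, hp]
  cases j with
  | zero => rw [contract_wedge_zero]; simp [prevWedge]
  | succ j => rw [contract_wedge_succ]; simp [prevWedge, adjoint_wedge]

theorem norm_wedge_sq_add (p : Fin n → ℂ) (u : Coeff n j) :
    ‖wedge p u‖ ^ 2 + ‖ContinuousLinearMap.adjoint (prevWedge p j) u‖ ^ 2 =
      (∑ i, ‖p i‖ ^ 2) * ‖u‖ ^ 2 := by
  have h := congrArg (fun w => inner ℂ u w) (adjoint_wedge_wedge_add p u)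
  rw [inner_add_right, ContinuousLinearMap.adjoint_inner_right,
    ← ContinuousLinearMap.adjoint_inner_left (prevWedge p j), inner_smul_right, inner_self_eq_norm_sq_to_K,
    inner_self_eq_norm_sq_to_K, inner_self_eq_norm_sq_to_K] at h
  apply Complex.ofReal_injective
  rw [Complex.ofReal_mul, Complex.ofReal_add, Complex.ofReal_pow, Complex.ofReal_pow,
    Complex.ofReal_pow]
  exact h

/-- The form `dx_I` on `ℝⁿ`. -/
noncomputable def realDx (I : MultiIndex n j) : V n [⋀^Fin j]→L[ℝ] ℂ :=
  Complex.ofRealCLM.compContinuousAlternatingMap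
    { (Matrix.detRowAlternating (R := ℝ) (n := Fin j)).compLinearMap
        ((LinearMap.funLeft ℝ ℝ I) ∘ₗ (WithLp.linearEquiv 2 ℝ (Fin n → ℝ)).toLinearMap) with
      cont := by
        change Continuous fun v : Fin j → V n => Matrix.det (Matrix.of fun k l => v k (I l))
        refine Continuous.matrix_det ?_
        fun_prop }

theorem realDx_single (I J : MultiIndex n j) :
    realDx I (fun k => EuclideanSpace.single (J k) (1 : ℝ)) = dx I fun k => bvec (J k) := by
  change Complex.ofRealHom (Matrix.det (Matrix.of fun k l =>
    (EuclideanSpace.single (J k) (1 : ℝ) : V n) (I l))) = Matrix.det (Matrix.of fun k l => bvec (J k) (I l))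
  rw [RingHom.map_det]
  congr 1
  ext k l
  simp [bvec, Pi.single_apply]

/-- The differential form with given coefficient functions. -/
noncomputable def ofCoeff (g : V n → Coeff n j) : Form n j := fun x => ∑ I, g x I • realDx I

theorem coeff_ofCoeff (g : V n → Coeff n j) : coeff (ofCoeff g) = g := by
  classical
  funext x
  ext J
  change (∑ I, g x I • realDx I) (fun k => EuclideanSpace.single (J k) (1 : ℝ)) = _
  simp [ContinuousAlternatingMap.sum_apply, realDx_single, dx_bvec]

theorem contDiff_ofCoeff {g : V n → Coeff n j} (hg : ContDiff ℝ (⊤ : ℕ∞) g) :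
    ContDiff ℝ (⊤ : ℕ∞) (ofCoeff g) := by
  refine ContDiff.sum fun I _ => ?_
  exact ((contDiff_piLp 2).1 hg I).smul contDiff_const

theorem hasCompactSupport_ofCoeff {g : V n → Coeff n j} (hg : HasCompactSupport g) :
    HasCompactSupport (ofCoeff g) := by
  refine hg.mono fun x hx hx0 => hx ?_
  refine Finset.sum_eq_zero fun I _ => ?_
  rw [hx0]
  exact zero_smul ℂ (realDx I)

end Exterior

end TwistedL2

namespace TwistedL2

open scoped FourierTransform LineDeriv SchwartzMap

/-! ### The twisted differential in coordinates -/

section CoefficientFormula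

variable {n j : ℕ}

/-- Standard basis vectors of `ℝⁿ`. -/
noncomputable def evec (i : Fin n) : V n := EuclideanSpace.single i (1 : ℝ)

/-- The complex components of a covector. -/
noncomputable def comps (a : V n →L[ℝ] ℝ) (i : Fin n) : ℂ := (a (evec i) : ℂ)

/-- The coefficients of an alternating form, as a continuous linear map. -/
noncomputable def coeffCLM : (V n [⋀^Fin j]→L[ℝ] ℂ) →L[ℝ] Coeff n j :=
  (PiLp.continuousLinearEquiv 2 ℝ fun _ : MultiIndex n j => ℂ).symm.toContinuousLinearMap ∘L
    ContinuousLinearMap.pi fun I => ContinuousAlternatingMap.apply ℝ (V n) ℂ fun k => evec (I k)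

theorem coeff_eq (ω : Form n j) : coeff ω = fun x => coeffCLM (ω x) := rfl

theorem contDiff_coeff {ω : Form n j} (hω : ContDiff ℝ (⊤ : ℕ∞) ω) :
    ContDiff ℝ (⊤ : ℕ∞) (coeff ω) := by
  rw [coeff_eq]
  exact coeffCLM.contDiff.comp hω

theorem hasCompactSupport_coeff {ω : Form n j} (hω : HasCompactSupport ω) :
    HasCompactSupport (coeff ω) := by
  rw [coeff_eq]
  exact hω.comp_left (map_zero _)

/-- The form `dω = ∑ dxᵢ ∧ ∂ᵢω` of the exterior derivative is the one that the Fourier transform can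
act on. -/
theorem coeff_dTheta (θ : OneForm n) {ω : Form n j} (hω : Differentiable ℝ ω) (x : V n) :
    coeff (dTheta θ ω) x = ∑ i, wedge (bvec i) (fderiv ℝ (coeff ω) x (evec i)) +
      wedge (comps (θ x)) (coeff ω x) := by
  have hf : ∀ v (J : MultiIndex n j), fderiv ℝ (coeff ω) x v J =
      fderiv ℝ ω x v fun k => evec (J k) := by
    intro v J
    have : fderiv ℝ (coeff ω) x = coeffCLM ∘L fderiv ℝ ω x := by
      rw [coeff_eq]
      exact (coeffCLM.hasFDerivAt.comp x (hω x).hasFDerivAt).fderiv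
    rw [this]
    rfl
  ext I
  change (extDeriv ω x + ContinuousAlternatingMap.alternatizeUncurryFin
    ((θ x).smulRight (ω x))) (fun k => evec (I k)) = _
  rw [ContinuousAlternatingMap.add_apply, PiLp.add_apply, extDeriv,
    ContinuousAlternatingMap.alternatizeUncurryFin_apply,
    ContinuousAlternatingMap.alternatizeUncurryFin_apply]
  congr 1
  · have : (∑ i, wedge (bvec i) (fderiv ℝ (coeff ω) x (evec i))) I =
        ∑ i, wedge (bvec i) (fderiv ℝ (coeff ω) x (evec i)) I := by simp
    rw [this]
    simp only [wedge_apply]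
    rw [Finset.sum_comm]
    refine Finset.sum_congr rfl fun k _ => ?_
    -- In position `k` of the multi-index only the derivative in direction `I k` survives.
    rw [Finset.sum_eq_single (I k)]
    · rw [hf]
      simp [bvec]
      rfl
    · intro i _ hi
      simp [bvec, Ne.symm hi]
    · simp
  · rw [wedge_apply]
    refine Finset.sum_congr rfl fun k _ => ?_
    have : coeff ω x (I.remove k) = ω x (k.removeNth fun k => evec (I k)) := rfl
    rw [this, ContinuousLinearMap.smulRight_apply, ContinuousAlternatingMap.smul_apply]
    simp [comps, mul_assoc]

end CoefficientFormula

/-! ### Constant coefficients on Schwartz functions -/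

section Schwartz

variable {n j : ℕ}

theorem fourier_clm {E F : Type*} [NormedAddCommGroup E] [NormedSpace ℂ E] [CompleteSpace E]
    [NormedAddCommGroup F] [NormedSpace ℂ F] [CompleteSpace F] (L : E →L[ℂ] F) {f : V n → E}
    (hf : Integrable f) (ξ : V n) : 𝓕 (fun x => L (f x)) ξ = L (𝓕 f ξ) := by
  rw [Real.fourier_eq, Real.fourier_eq, ← L.integral_comp_comm]
  · simp [Circle.smul_def]
  · exact (Real.fourierIntegral_convergent_iff ξ).2 hf

/-- The twisted differential with constant coefficients on Schwartz functions. -/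
noncomputable def schwartzD (p : Fin n → ℂ) (φ : 𝓢(V n, Coeff n j)) : 𝓢(V n, Coeff n (j + 1)) :=
  ∑ i, (∂_{evec i} φ : 𝓢(V n, Coeff n j)).postcompCLM (wedge (bvec i)) + φ.postcompCLM (wedge p)

theorem schwartzD_apply (p : Fin n → ℂ) (φ : 𝓢(V n, Coeff n j)) (x : V n) :
    schwartzD p φ x = ∑ i, wedge (bvec i) (fderiv ℝ φ x (evec i)) + wedge p (φ x) := by
  simp [schwartzD, SchwartzMap.lineDerivOp_apply_eq_fderiv]

/-- The symbol `2πiξ + p` of the twisted differential. -/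
noncomputable def sym (p : Fin n → ℂ) (ξ : V n) : Fin n → ℂ :=
  fun i => 2 * Real.pi * Complex.I * ξ i + p i

theorem sym_eq (p : Fin n → ℂ) (ξ : V n) :
    sym p ξ = ∑ i, (2 * Real.pi * Complex.I * ξ i) • bvec i + p := by
  funext l
  simp [sym, bvec, Pi.single_apply]

theorem wedge_sum {ι : Type*} (s : Finset ι) (p : ι → Fin n → ℂ) (u : Coeff n j) :
    wedge (∑ i ∈ s, p i) u = ∑ i ∈ s, wedge (p i) u :=
  map_sum (AddMonoidHom.mk' (fun p => wedge p u) fun p q => wedge_add p q u) p s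

/-- `∂ᵢ` becomes multiplication by `2πiξᵢ`, so `∑ dxᵢ ∧ ∂ᵢ + p ∧` becomes exterior multiplication by
the symbol. -/
theorem fourier_schwartzD (p : Fin n → ℂ) (φ : 𝓢(V n, Coeff n j)) (ξ : V n) :
    𝓕 (schwartzD p φ) ξ = wedge (sym p ξ) (𝓕 φ ξ) := by
  have h1 : ∀ i, 𝓕 (∂_{evec i} φ : 𝓢(V n, Coeff n j)) ξ = (2 * Real.pi * Complex.I * ξ i) • 𝓕 φ ξ := by
    intro i
    have ht : (inner ℝ · (evec i) : V n → ℝ).HasTemperateGrowth :=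
      ((innerSL ℝ).flip (evec i)).hasTemperateGrowth
    rw [SchwartzMap.fourier_lineDerivOp_eq, _root_.smul_apply,
      SchwartzMap.smulLeftCLM_apply_apply ht, smul_comm, ← Complex.coe_smul, smul_smul]
    simp [evec, EuclideanSpace.inner_single_right, mul_comm]
  have h2 : ∀ {k : ℕ} (ψ : 𝓢(V n, Coeff n k)) (L : Coeff n k →L[ℂ] Coeff n (j + 1)),
      𝓕 (ψ.postcompCLM L) ξ = L (𝓕 ψ ξ) := by
    intro k ψ L
    rw [SchwartzMap.fourier_coe, SchwartzMap.fourier_coe]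
    exact fourier_clm L ψ.integrable ξ
  have h3 : 𝓕 (schwartzD p φ) = ∑ i, 𝓕 ((∂_{evec i} φ : 𝓢(V n, Coeff n j)).postcompCLM (wedge (bvec i))) +
      𝓕 (φ.postcompCLM (wedge p)) := by
    rw [schwartzD, FourierTransform.fourier_add]
    congr 1
    exact map_sum (FourierTransform.fourierCLM ℂ 𝓢(V n, Coeff n (j + 1))) _ _
  rw [h3, sym_eq, wedge_add, wedge_sum, _root_.add_apply, _root_.sum_apply, h2]
  congr 1
  refine Finset.sum_congr rfl fun i _ => ?_
  rw [h2, h1, wedge_smul, map_smul]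

theorem coeff_dTheta_const (a : V n →L[ℝ] ℝ) {ω : Form n j} (hω : ContDiff ℝ (⊤ : ℕ∞) ω)
    (hc : HasCompactSupport ω) : coeff (dTheta (fun _ => a) ω) =
      schwartzD (comps a) ((hasCompactSupport_coeff hc).toSchwartzMap (contDiff_coeff hω)) := by
  funext x
  rw [coeff_dTheta _ (hω.differentiable (by simp)), schwartzD_apply]
  rfl

/-- An integrable function with vanishing Fourier transform is zero. -/
theorem ae_eq_zero_of_fourier_eq_zero {F : V n → ℂ} (hF : Integrable F) (h : ∀ ξ, 𝓕 F ξ = 0) :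
    ∀ᵐ x, F x = 0 := by
  refine ae_eq_zero_of_integral_contDiff_smul_eq_zero hF.locallyIntegrable fun g hg hgc => ?_
  have hψc : HasCompactSupport fun x => (g x : ℂ) := hgc.comp_left (g := Complex.ofReal) rfl
  have hψ : ContDiff ℝ (⊤ : ℕ∞) fun x => (g x : ℂ) := Complex.ofRealCLM.contDiff.comp hg
  let ψ : 𝓢(V n, ℂ) := hψc.toSchwartzMap hψ
  -- Every test function is the Fourier transform of some `η`, and the transform can be moved across
  -- the pairing onto `F`.
  let η : 𝓢(V n, ℂ) := 𝓕⁻ ψ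
  have hη : ∀ x, 𝓕 (η : V n → ℂ) x = g x := by
    intro x
    rw [← SchwartzMap.fourier_coe]
    simp only [η, FourierTransform.fourier_fourierInv_eq]
    rfl
  have key := VectorFourier.integral_fourierIntegral_smul_eq_flip (μ := volume) (ν := volume)
    (L := innerₗ (V n)) (f := η) (g := F) Real.continuous_fourierChar (by exact continuous_inner)
    η.integrable hF
  rw [flip_innerₗ] at key
  have e1 : ∀ x, VectorFourier.fourierIntegral Real.fourierChar volume (innerₗ (V n)) η x = g x := hη
  have e2 : ∀ x, VectorFourier.fourierIntegral Real.fourierChar volume (innerₗ (V n)) F x = 0 := h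
  simp only [e1, e2, smul_zero, integral_zero] at key
  exact key

end Schwartz

end TwistedL2

namespace TwistedL2

open scoped FourierTransform SchwartzMap

/-! ### Fourier multipliers on `L²` forms and test functions -/

section FourierGraph

variable {n j k : ℕ}

/-- The Fourier transform of `L²` forms, coefficientwise. -/
noncomputable abbrev ft : L2Form n j ≃ₗᵢ[ℂ] L2Form n j := Lp.fourierTransformₗᵢ (V n) (Coeff n j)

theorem ft_toLp (φ : 𝓢(V n, Coeff n j)) :
    ft (φ.toLp 2) =ᵐ[volume] (𝓕 φ : 𝓢(V n, Coeff n j)) := by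
  have : ft (φ.toLp 2) = (𝓕 φ : 𝓢(V n, Coeff n j)).toLp 2 := SchwartzMap.toLp_fourier_eq φ
  rw [this]
  exact SchwartzMap.coeFn_toLp (𝓕 φ : 𝓢(V n, Coeff n j)) 2 volume

/-- The Fourier transforms of an approximate identity tend to `1`. -/
theorem tendsto_fourier_bump (β : ℕ → ContDiffBump (0 : V n))
    (hβ : Tendsto (fun m => (β m).rOut) atTop (𝓝 0)) (ξ : V n) :
    Tendsto (fun m => 𝓕 (fun x => ((β m).normed volume x : ℂ)) ξ) atTop (𝓝 1) := by
  have hg : Continuous fun x : V n => (Real.fourierChar (inner ℝ x ξ) : ℂ) := by fun_prop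
  have := ContDiffBump.convolution_tendsto_right_of_continuous (μ := volume) hβ hg 0
  simp only [inner_zero_left, AddChar.map_zero_eq_one, Circle.coe_one] at this
  refine this.congr fun m => ?_
  rw [convolution_def, Real.fourier_eq]
  refine integral_congr_ae (Eventually.of_forall fun x => ?_)
  simp [Circle.smul_def, inner_neg_left, mul_comm]

theorem fourier_translate (φ : 𝓢(V n, Coeff n j)) (y : V n) (hc : HasCompactSupport φ) :
    ∃ ψ : 𝓢(V n, Coeff n j), HasCompactSupport ψ ∧
      ∀ ξ, 𝓕 ψ ξ = (Real.fourierChar (inner ℝ y ξ) : ℂ) • 𝓕 φ ξ := by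
  have hc : HasCompactSupport fun x => φ (x + y) := hc.comp_homeomorph (Homeomorph.addRight y)
  have hs : ContDiff ℝ (⊤ : ℕ∞) fun x => φ (x + y) :=
    (φ.smooth ⊤).comp (contDiff_id.add contDiff_const)
  refine ⟨hc.toSchwartzMap hs, hc, fun ξ => ?_⟩
  rw [SchwartzMap.fourier_coe, SchwartzMap.fourier_coe]
  exact congrFun (VectorFourier.fourierIntegral_comp_add_right Real.fourierChar volume
    (innerₗ (V n)) φ y) ξ

/-- Test functions whose Fourier transforms span at every frequency. -/
theorem exists_test_seq (n j : ℕ) : ∃ (ψ : ℕ → Coeff n j → 𝓢(V n, Coeff n j))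
    (γ : ℕ → V n → ℂ), (∀ m c, HasCompactSupport (ψ m c)) ∧ (∀ ξ, ∃ m, γ m ξ ≠ 0) ∧
      ∀ m c ξ, 𝓕 (ψ m c) ξ = γ m ξ • c := by
  let β : ℕ → ContDiffBump (0 : V n) := fun m =>
    { rIn := 1 / ((m : ℝ) + 1) / 2, rOut := 1 / ((m : ℝ) + 1), rIn_pos := by positivity,
      rIn_lt_rOut := half_lt_self (by positivity) }
  have hβ : Tendsto (fun m => (β m).rOut) atTop (𝓝 0) := tendsto_one_div_add_atTop_nhds_zero_nat
  have hβc : ∀ m, HasCompactSupport fun x => ((β m).normed volume x : ℂ) := fun m =>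
    (β m).hasCompactSupport_normed.comp_left (g := Complex.ofReal) rfl
  have hβs : ∀ m, ContDiff ℝ (⊤ : ℕ∞) fun x => ((β m).normed volume x : ℂ) := fun m =>
    Complex.ofRealCLM.contDiff.comp (β m).contDiff_normed
  have hc : ∀ m (c : Coeff n j), HasCompactSupport fun x => ((β m).normed volume x : ℂ) • c :=
    fun m c => (hβc m).smul_right
  have hs : ∀ m (c : Coeff n j),
      ContDiff ℝ (⊤ : ℕ∞) fun x => ((β m).normed volume x : ℂ) • c :=
    fun m c => (hβs m).smul contDiff_const
  refine ⟨fun m c => (hc m c).toSchwartzMap (hs m c),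
    fun m => 𝓕 (fun x => ((β m).normed volume x : ℂ)), hc, fun ξ => ?_, fun m c ξ => ?_⟩
  · exact ((tendsto_fourier_bump β hβ ξ).eventually_ne one_ne_zero).exists
  · rw [SchwartzMap.fourier_coe]
    exact fourier_clm (ContinuousLinearMap.toSpanSingleton ℂ c)
      ((hβs m).continuous.integrable_of_hasCompactSupport (hβc m)) ξ

/-- Translating `φ` multiplies `𝓕 φ` by a character and keeps the support compact. So the vanishing
of all the integrals says that the integrable function `⟨𝓕 φ, D⟩` has zero Fourier transform, hence
is zero almost everywhere. Countably many test functions, whose transforms span at every frequency,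
then force `D = 0`. No integrability of `D` itself is needed, which matters for unbounded symbols.
-/
theorem ae_eq_zero_of_forall_test {D : V n → Coeff n j}
    (hint : ∀ φ : 𝓢(V n, Coeff n j), HasCompactSupport φ →
      Integrable fun ξ => inner ℂ (𝓕 φ ξ) (D ξ))
    (hzero : ∀ φ : 𝓢(V n, Coeff n j), HasCompactSupport φ →
      ∫ ξ, inner ℂ (𝓕 φ ξ) (D ξ) = 0) : ∀ᵐ ξ, D ξ = 0 := by
  have hpt : ∀ φ : 𝓢(V n, Coeff n j), HasCompactSupport φ →
      ∀ᵐ ξ, inner ℂ (𝓕 φ ξ) (D ξ) = 0 := by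
    intro φ hφ
    refine ae_eq_zero_of_fourier_eq_zero (hint φ hφ) fun y => ?_
    obtain ⟨ψ, hψ, htr⟩ := fourier_translate φ y hφ
    rw [Real.fourier_eq, ← hzero ψ hψ]
    refine integral_congr_ae (Eventually.of_forall fun ξ => ?_)
    dsimp only
    rw [htr, inner_smul_left, Circle.smul_def, smul_eq_mul, ← Circle.coe_inv_eq_conj,
      ← AddChar.map_neg_eq_inv, real_inner_comm]
  obtain ⟨ψ, γ, hψ, hγ, h⟩ := exists_test_seq n j
  let B := EuclideanSpace.basisFun (MultiIndex n j) ℂ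
  have hall : ∀ᵐ ξ, ∀ m I, inner ℂ (𝓕 (ψ m (B I)) ξ) (D ξ) = 0 :=
    ae_all_iff.2 fun m => ae_all_iff.2 fun I => hpt _ (hψ m (B I))
  filter_upwards [hall] with ξ hξ
  obtain ⟨m, hm⟩ := hγ ξ
  rw [← B.sum_repr' (D ξ)]
  refine Finset.sum_eq_zero fun I _ => ?_
  have := hξ m I
  rw [h, inner_smul_left, mul_eq_zero, map_eq_zero] at this
  rw [this.resolve_left hm, zero_smul]

theorem integrable_inner_sub_inner {α E F : Type*} [MeasurableSpace α] {μ : Measure α}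
    [NormedAddCommGroup E] [InnerProductSpace ℂ E] [NormedAddCommGroup F] [InnerProductSpace ℂ F]
    (f g : Lp E 2 μ) (h k : Lp F 2 μ) :
    Integrable (fun x => inner ℂ (f x) (g x) - inner ℂ (h x) (k x)) μ :=
  (L2.integrable_inner f g).sub (L2.integrable_inner h k)

theorem integral_inner_sub_inner {α E F : Type*} [MeasurableSpace α] {μ : Measure α}
    [NormedAddCommGroup E] [InnerProductSpace ℂ E] [NormedAddCommGroup F] [InnerProductSpace ℂ F]
    (f g : Lp E 2 μ) (h k : Lp F 2 μ) :
    ∫ x, (inner ℂ (f x) (g x) - inner ℂ (h x) (k x)) ∂μ = inner ℂ f g - inner ℂ h k := by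
  rw [integral_sub (L2.integrable_inner f g) (L2.integrable_inner h k), ← L2.inner_def,
    ← L2.inner_def]

/-- Testing against compactly supported functions alone already forces the adjoint to act as the
multiplier with the adjoint symbol. -/
theorem ae_eq_of_forall_test {p : Fin n → ℂ} {h : L2Form n (j + 1)} {k : L2Form n j}
    (H : ∀ φ : 𝓢(V n, Coeff n j), HasCompactSupport φ →
      inner ℂ ((schwartzD p φ).toLp 2) h = inner ℂ (φ.toLp 2) k) :
    ft k =ᵐ[volume] fun ξ => ContinuousLinearMap.adjoint (wedge (sym p ξ)) (ft h ξ) := by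
  have hae : ∀ φ : 𝓢(V n, Coeff n j), (fun ξ => inner ℂ (𝓕 φ ξ)
      (ft k ξ - ContinuousLinearMap.adjoint (wedge (sym p ξ)) (ft h ξ))) =ᵐ[volume]
      fun ξ => inner ℂ (ft (φ.toLp 2) ξ) (ft k ξ) -
        inner ℂ (ft ((schwartzD p φ).toLp 2) ξ) (ft h ξ) := by
    intro φ
    filter_upwards [ft_toLp φ, ft_toLp (schwartzD p φ)] with ξ h1 h2
    rw [h1, h2, fourier_schwartzD, inner_sub_right, ContinuousLinearMap.adjoint_inner_right]
  have key : ∀ᵐ ξ, ft k ξ - ContinuousLinearMap.adjoint (wedge (sym p ξ)) (ft h ξ) = 0 := by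
    refine ae_eq_zero_of_forall_test (fun φ _ => ?_) fun φ hφ => ?_
    · exact (integrable_inner_sub_inner _ _ _ _).congr (hae φ).symm
    · rw [integral_congr_ae (hae φ), integral_inner_sub_inner, LinearIsometryEquiv.inner_map_map,
        LinearIsometryEquiv.inner_map_map, H φ hφ, sub_self]
  filter_upwards [key] with ξ hξ
  exact sub_eq_zero.1 hξ

/-- The graph of the Fourier multiplier with symbol `W`. -/
noncomputable def multGraph (W : V n → Coeff n j →L[ℂ] Coeff n k) :
    Submodule ℂ (L2Form n j × L2Form n k) where
  carrier := {x | ft x.2 =ᵐ[volume] fun ξ => W ξ (ft x.1 ξ)}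
  zero_mem' := by
    simp only [Set.mem_ofPred_eq, Prod.fst_zero, Prod.snd_zero, map_zero]
    filter_upwards [Lp.coeFn_zero (Coeff n j) 2 (volume : Measure (V n)),
      Lp.coeFn_zero (Coeff n k) 2 (volume : Measure (V n))] with ξ h1 h2
    rw [h1, h2]
    simp
  add_mem' := by
    intro x y hx hy
    simp only [Set.mem_ofPred_eq, Prod.fst_add, Prod.snd_add, map_add] at hx hy ⊢
    filter_upwards [hx, hy, Lp.coeFn_add (ft x.1) (ft y.1), Lp.coeFn_add (ft x.2) (ft y.2)]
      with ξ h1 h2 h3 h4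
    rw [h3, h4, Pi.add_apply, Pi.add_apply, h1, h2, map_add]
  smul_mem' := by
    intro c x hx
    simp only [Set.mem_ofPred_eq, Prod.smul_fst, Prod.smul_snd, map_smul] at hx ⊢
    filter_upwards [hx, Lp.coeFn_smul c (ft x.1), Lp.coeFn_smul c (ft x.2)] with ξ h1 h2 h3
    rw [h2, h3, Pi.smul_apply, Pi.smul_apply, h1, map_smul]

theorem mem_multGraph {W : V n → Coeff n j →L[ℂ] Coeff n k} {f : L2Form n j} {g : L2Form n k} :
    (f, g) ∈ multGraph W ↔ ft g =ᵐ[volume] fun ξ => W ξ (ft f ξ) := Iff.rfl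

theorem eq_zero_of_mem_multGraph {W : V n → Coeff n j →L[ℂ] Coeff n k} {g : L2Form n k}
    (h : (0, g) ∈ multGraph W) : g = 0 := by
  rw [mem_multGraph, map_zero] at h
  rw [← (ft : L2Form n k ≃ₗᵢ[ℂ] L2Form n k).map_eq_zero_iff]
  apply Lp.ext
  filter_upwards [h, Lp.coeFn_zero (Coeff n j) 2 (volume : Measure (V n)),
    Lp.coeFn_zero (Coeff n k) 2 (volume : Measure (V n))] with ξ h1 h2 h3
  rw [h1, h2, h3]
  simp

/-- An `L²` convergent sequence has an almost everywhere convergent subsequence, along which the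
pointwise relation passes to the limit. -/
theorem isClosed_multGraph (W : V n → Coeff n j →L[ℂ] Coeff n k) :
    IsClosed (multGraph W : Set (L2Form n j × L2Form n k)) := by
  refine IsSeqClosed.isClosed fun x y hx hxy => ?_
  have h1 : Tendsto (fun m => ft (x m).1) atTop (𝓝 (ft y.1)) :=
    (ft.continuous.tendsto _).comp ((continuous_fst.tendsto y).comp hxy)
  have h2 : Tendsto (fun m => ft (x m).2) atTop (𝓝 (ft y.2)) :=
    (ft.continuous.tendsto _).comp ((continuous_snd.tendsto y).comp hxy)
  obtain ⟨ns, hns, h3⟩ := (tendstoInMeasure_of_tendsto_Lp h1).exists_seq_tendsto_ae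
  obtain ⟨ms, hms, h4⟩ :=
    (tendstoInMeasure_of_tendsto_Lp (h2.comp hns.tendsto_atTop)).exists_seq_tendsto_ae
  have hall : ∀ᵐ ξ, ∀ m, ft (x m).2 ξ = W ξ (ft (x m).1 ξ) := ae_all_iff.2 fun m => hx m
  change ft y.2 =ᵐ[volume] fun ξ => W ξ (ft y.1 ξ)
  filter_upwards [h3, h4, hall] with ξ h5 h6 h7
  refine tendsto_nhds_unique h6 ?_
  simp only [Function.comp_apply, h7]
  exact ((W ξ).continuous.tendsto _).comp (h5.comp hms.tendsto_atTop)

/-- Multipliers with adjoint symbols are adjoint. -/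
theorem inner_multGraph {W : V n → Coeff n j →L[ℂ] Coeff n k} {f : L2Form n j} {g h : L2Form n k}
    {l : L2Form n j} (hfg : (f, g) ∈ multGraph W)
    (hhl : (h, l) ∈ multGraph fun ξ => ContinuousLinearMap.adjoint (W ξ)) :
    inner ℂ g h = inner ℂ f l := by
  rw [← ft.inner_map_map g h, ← ft.inner_map_map f l, L2.inner_def, L2.inner_def]
  refine integral_congr_ae ?_
  filter_upwards [mem_multGraph.1 hfg, mem_multGraph.1 hhl] with ξ h1 h2
  rw [h1, h2, ContinuousLinearMap.adjoint_inner_right]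

theorem mem_graphDTheta_const {a : V n →L[ℝ] ℝ} {f : L2Form n j} {g : L2Form n (j + 1)} :
    (f, g) ∈ graphDTheta (fun _ => a) j ↔ ∃ φ : 𝓢(V n, Coeff n j), HasCompactSupport φ ∧
      f = φ.toLp 2 ∧ g = (schwartzD (comps a) φ).toLp 2 := by
  constructor
  · rintro ⟨ω, hω, hc, h1, h2⟩
    refine ⟨(hasCompactSupport_coeff hc).toSchwartzMap (contDiff_coeff hω),
      hasCompactSupport_coeff hc, ?_, ?_⟩
    · exact Lp.ext (h1.trans (SchwartzMap.coeFn_toLp (HasCompactSupport.toSchwartzMap _ _) 2 volume).symm)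
    · rw [coeff_dTheta_const a hω hc] at h2
      exact Lp.ext (h2.trans (SchwartzMap.coeFn_toLp (schwartzD _ _) 2 volume).symm)
  · rintro ⟨φ, hc, rfl, rfl⟩
    have hω := contDiff_ofCoeff (φ.smooth ⊤)
    have hωc := hasCompactSupport_ofCoeff hc
    refine ⟨ofCoeff φ, hω, hωc, ?_, ?_⟩
    · rw [coeff_ofCoeff]
      exact SchwartzMap.coeFn_toLp _ 2 _
    · rw [coeff_dTheta_const a hω hωc]
      have : (hasCompactSupport_coeff hωc).toSchwartzMap (contDiff_coeff hω) = φ := by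
        ext x : 1
        exact congrFun (coeff_ofCoeff φ) x
      rw [this]
      exact SchwartzMap.coeFn_toLp _ 2 _

theorem dense_fst_graphDTheta (θ : OneForm n) (hθ : ContDiff ℝ (⊤ : ℕ∞) θ) :
    Dense {f : L2Form n j | ∃ g, (f, g) ∈ graphDTheta θ j} := by
  refine (Lp.dense_hasCompactSupport_contDiff (F := Coeff n j) (μ := (volume : Measure (V n)))
    (p := 2) ENNReal.ofNat_ne_top).mono ?_
  rintro f ⟨φ, hf, hc, hs⟩
  have hω := contDiff_ofCoeff hs
  have hωc := hasCompactSupport_ofCoeff hc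
  have hd : coeff (dTheta θ (ofCoeff φ)) = fun x =>
      ∑ i, wedge (bvec i) (fderiv ℝ φ x (evec i)) + wedge (comps (θ x)) (φ x) := by
    funext x
    rw [coeff_dTheta θ (hω.differentiable (by simp)), coeff_ofCoeff]
  have hcomp : ∀ x, wedge (comps (θ x)) (φ x) = ∑ i, comps (θ x) i • wedge (bvec i) (φ x) := by
    intro x
    have : comps (θ x) = ∑ i, comps (θ x) i • bvec i := by
      funext l
      simp [bvec, Pi.single_apply]
    conv_lhs => rw [this, wedge_sum]
    simp only [wedge_smul]
  have hcont : Continuous (coeff (dTheta θ (ofCoeff φ))) := by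
    have h1 : Continuous (fderiv ℝ φ) := hs.continuous_fderiv (by simp)
    have h2 := hs.continuous
    have h3 := hθ.continuous
    rw [hd]
    simp only [hcomp]
    have h4 : ∀ i, Continuous fun x => comps (θ x) i := fun i =>
      Complex.continuous_ofReal.comp (h3.clm_apply continuous_const)
    refine (continuous_finsetSum _ fun i _ => ?_).add (continuous_finsetSum _ fun i _ => ?_)
    · exact (wedge (bvec i)).continuous.comp (h1.clm_apply continuous_const)
    · exact (h4 i).smul ((wedge (bvec i)).continuous.comp h2)
  have hcs : HasCompactSupport (coeff (dTheta θ (ofCoeff φ))) := by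
    refine HasCompactSupport.of_support_subset_isCompact hc (K := tsupport φ) fun x hx => ?_
    by_contra hx'
    apply hx
    rw [hd]
    have h1 : φ x = 0 := image_eq_zero_of_notMem_tsupport hx'
    have h2 : fderiv ℝ φ x = 0 := by
      have := fun h => hx' (tsupport_fderiv_subset ℝ (f := φ) (subset_tsupport _ h))
      simpa using this
    simp [h1, h2]
  have hmem : MemLp (coeff (dTheta θ (ofCoeff φ))) 2 volume := hcont.memLp_of_hasCompactSupport hcs
  exact ⟨hmem.toLp _, ofCoeff φ, hω, hωc, by
    rw [coeff_ofCoeff]; exact hf, hmem.coeFn_toLp⟩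

end FourierGraph

end TwistedL2

namespace TwistedL2

/-! ### The incoming differential and the Laplacian as a Hodge Laplacian -/

section PrevNabla

variable {n : ℕ}

/-- If the closure of the graph of `d_θ` is a graph, then it is the graph of `∇_θ`. -/
theorem graph_nabla_of_functional {θ : OneForm n} {j : ℕ}
    (h : ∀ g, (0, g) ∈ (graphDTheta θ j).topologicalClosure → g = 0) :
    (nabla θ j).graph = (graphDTheta θ j).topologicalClosure := by
  have h1 : (graphDTheta θ j).toLinearPMap.graph = graphDTheta θ j :=
    Submodule.toLinearPMap_graph_eq _ fun x hx hx0 => by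
      obtain ⟨x, y⟩ := x
      obtain rfl : x = 0 := hx0
      exact h y (Submodule.le_topologicalClosure _ hx)
  have h2 : (graphDTheta θ j).topologicalClosure.toLinearPMap.graph =
      (graphDTheta θ j).topologicalClosure :=
    Submodule.toLinearPMap_graph_eq _ fun x hx hx0 => by
      obtain ⟨x, y⟩ := x
      obtain rfl : x = 0 := hx0
      exact h y hx
  have hc : (graphDTheta θ j).toLinearPMap.IsClosable :=
    ⟨(graphDTheta θ j).topologicalClosure.toLinearPMap, by rw [h1, h2]⟩
  rw [nabla, ← hc.graph_closure_eq_closure_graph, h1]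

/-- The twisted differential arriving in degree `j` (zero if `j = 0`). -/
noncomputable def prevNabla (θ : OneForm n) : (j : ℕ) → L2Form n (j - 1) →ₗ.[ℂ] L2Form n j
  | 0 => 0
  | j + 1 => nabla θ j

theorem mem_graph_zero {E F : Type*} [AddCommGroup E] [Module ℂ E] [AddCommGroup F] [Module ℂ F]
    {x : E} {y : F} : (x, y) ∈ (0 : E →ₗ.[ℂ] F).graph ↔ y = 0 := by
  rw [LinearPMap.mem_graph_iff]
  constructor
  · rintro ⟨z, -, h⟩
    exact h.symm
  · rintro rfl
    exact ⟨⟨x, trivial⟩, rfl, rfl⟩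

/-- In degree zero the natural subtraction `0 - 1 = 0` makes the incoming space a copy of the
0-forms; the incoming operator there is zero and everywhere defined, so it adds nothing and puts no
condition on the domain. -/
theorem laplacian_eq_hodge (θ : OneForm n) (j : ℕ) :
    laplacian θ j = hodge (prevNabla θ j) (nabla θ j) := by
  cases j with
  | succ j => rfl
  | zero =>
    refine LinearPMap.eq_of_eq_graph ?_
    ext ⟨u, w⟩
    have hd : Dense ((0 : L2Form n (0 - 1) →ₗ.[ℂ] L2Form n 0).domain : Set (L2Form n (0 - 1))) :=
      dense_univ
    rw [mem_graph_hodge]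
    change (u, w) ∈ (pcomp (nabla θ 0).adjoint (nabla θ 0)).graph ↔ _
    rw [mem_graph_pcomp]
    constructor
    · rintro ⟨y, h1, h2⟩
      refine ⟨y, w, 0, 0, h1, h2, ?_, mem_graph_zero.2 rfl, (add_zero w).symm⟩
      refine (mem_graph_adjoint hd).2 fun x z hz => ?_
      rw [mem_graph_zero.1 hz, inner_zero_left, inner_zero_right]
    · rintro ⟨y, w₁, v, w₂, h1, h2, -, h4, rfl⟩
      rw [mem_graph_zero.1 h4, add_zero]
      exact ⟨y, h1, h2⟩

end PrevNabla

/-! ### The complex and the Laplacian of a constant covector -/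

section Constant

variable {n j : ℕ}

theorem graphDTheta_const_le (a : V n →L[ℝ] ℝ) :
    graphDTheta (fun _ => a) j ≤ multGraph fun ξ => wedge (sym (comps a) ξ) := by
  rintro ⟨f, g⟩ h
  obtain ⟨φ, -, rfl, rfl⟩ := mem_graphDTheta_const.1 h
  rw [mem_multGraph]
  filter_upwards [ft_toLp φ, ft_toLp (schwartzD (comps a) φ)] with ξ h1 h2
  rw [h1, h2, fourier_schwartzD]

theorem domain_dense_of_graphDTheta_le {θ : OneForm n} (hθ : ContDiff ℝ (⊤ : ℕ∞) θ)
    {T : L2Form n j →ₗ.[ℂ] L2Form n (j + 1)} (h : graphDTheta θ j ≤ T.graph) :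
    Dense (T.domain : Set (L2Form n j)) :=
  (dense_fst_graphDTheta θ hθ).mono fun f hf => by
    obtain ⟨g, hg⟩ : ∃ g, (f, g) ∈ graphDTheta θ j := hf
    exact mem_domain_of_graph (h hg)

/-- The minimal and the maximal operator agree. The closure lies in the multiplier because that is
closed. Conversely the adjoint of the closure consists of pairs in the adjoint multiplier, and these
pair correctly with everything in the multiplier, which therefore lies in the double adjoint. -/
theorem graph_nabla_const (a : V n →L[ℝ] ℝ) :
    (nabla (fun _ => a) j).graph = multGraph fun ξ => wedge (sym (comps a) ξ) := by
  have hle : (graphDTheta (fun _ => a) j).topologicalClosure ≤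
      multGraph fun ξ => wedge (sym (comps a) ξ) :=
    Submodule.topologicalClosure_minimal _ (graphDTheta_const_le a) (isClosed_multGraph _)
  have hg := graph_nabla_of_functional (θ := fun _ => a) (j := j)
    fun g h => eq_zero_of_mem_multGraph (hle h)
  refine le_antisymm (hg ▸ hle) ?_
  have hsub : graphDTheta (fun _ => a) j ≤ (nabla (fun _ => a) j).graph :=
    hg ▸ Submodule.le_topologicalClosure _
  have hd := domain_dense_of_graphDTheta_le contDiff_const hsub
  have hc : IsClosed ((nabla (fun _ => a) j).graph : Set (L2Form n j × L2Form n (j + 1))) := by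
    rw [hg]
    exact Submodule.isClosed_topologicalClosure _
  rintro ⟨f, g⟩ hfg
  refine mem_graph_of_forall_adjoint hd hc fun y w hyw => inner_multGraph hfg ?_
  refine ae_eq_of_forall_test fun φ hφ => ?_
  exact (mem_graph_adjoint hd).1 hyw _ _ (hsub (mem_graphDTheta_const.2 ⟨φ, hφ, rfl, rfl⟩))

theorem graph_prevNabla_const (a : V n →L[ℝ] ℝ) :
    (prevNabla (fun _ => a) j).graph = multGraph fun ξ => prevWedge (sym (comps a) ξ) j := by
  cases j with
  | succ j => exact graph_nabla_const a
  | zero =>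
    ext ⟨f, g⟩
    refine mem_graph_zero.trans ⟨?_, fun h => ?_⟩
    · rintro rfl
      rw [mem_multGraph, map_zero]
      exact Lp.coeFn_zero _ _ _
    · refine eq_zero_of_mem_multGraph (W := fun _ => (0 : Coeff n 0 →L[ℂ] Coeff n 0)) ?_
      rw [mem_multGraph] at h ⊢
      exact h

theorem isHilbertComplex_const (a : V n →L[ℝ] ℝ) (j : ℕ) :
    IsHilbertComplex (prevNabla (fun _ => a) j) (nabla (fun _ => a) j) where
  denseS := by
    cases j with
    | zero => exact dense_univ
    | succ j =>
      exact domain_dense_of_graphDTheta_le contDiff_const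
        ((graph_nabla_const a).symm ▸ graphDTheta_const_le a)
  closedS := by
    rw [graph_prevNabla_const]
    exact isClosed_multGraph _
  denseT := domain_dense_of_graphDTheta_le contDiff_const
    ((graph_nabla_const a).symm ▸ graphDTheta_const_le a)
  closedT := by
    rw [graph_nabla_const]
    exact isClosed_multGraph _
  comp_eq_zero := by
    intro x y h
    rw [graph_prevNabla_const, mem_multGraph] at h
    rw [graph_nabla_const, mem_multGraph, map_zero]
    filter_upwards [h, Lp.coeFn_zero (Coeff n (j + 1)) 2 (volume : Measure (V n))] with ξ h1 h2
    rw [h1, h2, wedge_prevWedge]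
    rfl

theorem continuous_sym (p : Fin n → ℂ) : Continuous (sym p) := by
  refine continuous_pi fun i => ?_
  unfold sym
  fun_prop

theorem continuous_wedge : Continuous fun p : Fin n → ℂ => (wedge p : Coeff n j →L[ℂ] _) := by
  let L : (Fin n → ℂ) →ₗ[ℂ] Coeff n j →L[ℂ] Coeff n (j + 1) :=
    { toFun := wedge
      map_add' := fun p q => ContinuousLinearMap.ext fun u => wedge_add p q u
      map_smul' := fun c p => ContinuousLinearMap.ext fun u => wedge_smul c p u }
  exact L.continuous_of_finiteDimensional

theorem continuous_prevWedge : Continuous fun p : Fin n → ℂ => prevWedge p j := by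
  cases j with
  | zero => exact continuous_const
  | succ j => exact continuous_wedge

/-- The symbol `|2πiξ + p|²` of the Laplacian. -/
noncomputable def energy (p : Fin n → ℂ) (ξ : V n) : ℝ := ∑ i, ‖sym p ξ i‖ ^ 2

theorem energy_nonneg (p : Fin n → ℂ) (ξ : V n) : 0 ≤ energy p ξ :=
  Finset.sum_nonneg fun _ _ => by positivity

theorem continuous_energy (p : Fin n → ℂ) : Continuous (energy p) :=
  continuous_finsetSum _ fun i _ => ((continuous_apply i).comp (continuous_sym p)).norm.pow 2

/-- The multiplier with symbol `W` is defined at `f` if `W f̂` is dominated by an `L²` function. -/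
theorem exists_mem_multGraph {k l : ℕ} {W : V n → Coeff n j →L[ℂ] Coeff n k} (hW : Continuous W)
    {f : L2Form n j} {g : L2Form n l} (h : ∀ᵐ ξ, ‖W ξ (ft f ξ)‖ ≤ ‖g ξ‖) :
    ∃ y, (f, y) ∈ multGraph W := by
  have hm : AEStronglyMeasurable (fun ξ => W ξ (ft f ξ)) volume :=
    isBoundedBilinearMap_apply.continuous.comp_aestronglyMeasurable
      (hW.aestronglyMeasurable.prodMk (Lp.aestronglyMeasurable (ft f)))
  have hL : MemLp (fun ξ => W ξ (ft f ξ)) 2 volume := (Lp.memLp g).of_le hm h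
  refine ⟨ft.symm (hL.toLp _), ?_⟩
  rw [mem_multGraph, LinearIsometryEquiv.apply_symm_apply]
  exact hL.coeFn_toLp

/-- The graph of the multiplier with a real symbol. -/
noncomputable def scalarGraph (m : V n → ℝ) : Submodule ℂ (L2Form n j × L2Form n j) :=
  multGraph fun ξ => (m ξ : ℂ) • ContinuousLinearMap.id ℂ (Coeff n j)

theorem mem_scalarGraph {m : V n → ℝ} {f g : L2Form n j} :
    (f, g) ∈ scalarGraph m ↔ ft g =ᵐ[volume] fun ξ => (m ξ : ℂ) • ft f ξ := Iff.rfl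

theorem exists_mem_scalarGraph {m : V n → ℝ} (hm : Continuous m) {C : ℝ} (h : ∀ ξ, |m ξ| ≤ C)
    (f : L2Form n j) : ∃ g, (f, g) ∈ scalarGraph m := by
  refine exists_mem_multGraph (g := (C : ℂ) • ft f) (by fun_prop) ?_
  filter_upwards [Lp.coeFn_smul (C : ℂ) (ft f)] with ξ h1
  rw [h1]
  simp only [smul_apply, ContinuousLinearMap.id_apply, Pi.smul_apply, norm_smul,
    Complex.norm_real, Real.norm_eq_abs]
  exact mul_le_mul_of_nonneg_right ((h ξ).trans (le_abs_self C)) (norm_nonneg _)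

theorem norm_wedge_le (p : Fin n → ℂ) : ‖(wedge p : Coeff n j →L[ℂ] _)‖ ≤ √(∑ i, ‖p i‖ ^ 2) := by
  refine ContinuousLinearMap.opNorm_le_bound _ (Real.sqrt_nonneg _) fun u => ?_
  refine abs_le_of_sq_le_sq' ?_ (by positivity) |>.2
  rw [mul_pow, Real.sq_sqrt (Finset.sum_nonneg fun _ _ => by positivity), ← norm_wedge_sq_add]
  exact le_add_of_nonneg_right (by positivity)

/-- If `m û` is in `L²`, with `m` the energy, then `(1 + m)|û|` dominates the transforms of `∇u`, of
the adjoint of the incoming differential at `u`, and of `∇^*∇u`, so all these multipliers are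
defined at `u`. The remaining term is `w - ∇^*∇u` by the Clifford relation. -/
theorem mem_hodge_of_mem_scalarGraph (a : V n →L[ℝ] ℝ) {u w : L2Form n j}
    (h : (u, w) ∈ scalarGraph (energy (comps a))) :
    (u, w) ∈ (hodge (prevNabla (fun _ => a) j) (nabla (fun _ => a) j)).graph := by
  have hC := isHilbertComplex_const a j
  rw [mem_scalarGraph] at h
  have hsum : ft (u + w) =ᵐ[volume] fun ξ => ((1 + energy (comps a) ξ : ℝ) : ℂ) • ft u ξ := by
    rw [map_add]
    filter_upwards [h, Lp.coeFn_add (ft u) (ft w)] with ξ h1 h2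
    rw [h2, Pi.add_apply, h1]
    push_cast
    rw [add_smul, one_smul]
  have hnorm : ∀ᵐ ξ, ‖ft (u + w) ξ‖ = (1 + energy (comps a) ξ) * ‖ft u ξ‖ := by
    filter_upwards [hsum] with ξ h1
    rw [h1, norm_smul, Complex.norm_real, Real.norm_of_nonneg]
    linarith [energy_nonneg (comps a) ξ]
  -- The symbol has size `√m`, and `m ≤ (1 + m)²`.
  have hbd : ∀ (m r s : ℝ), 0 ≤ m → 0 ≤ r → 0 ≤ s → s ^ 2 ≤ m * r ^ 2 → s ≤ (1 + m) * r := by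
    intro m r s hm hr hs h
    refine abs_le_of_sq_le_sq' (h.trans ?_) (by positivity) |>.2
    rw [mul_pow]
    gcongr
    nlinarith
  have hcs := continuous_sym (comps a)
  have hc1 : Continuous fun ξ => (wedge (sym (comps a) ξ) : Coeff n j →L[ℂ] _) :=
    continuous_wedge.comp hcs
  have hc2 : Continuous fun ξ => prevWedge (sym (comps a) ξ) j := continuous_prevWedge.comp hcs
  have hc1' : Continuous fun ξ =>
      ContinuousLinearMap.adjoint (wedge (sym (comps a) ξ) : Coeff n j →L[ℂ] _) :=
    ContinuousLinearMap.adjoint.continuous.comp hc1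
  have hc2' : Continuous fun ξ => ContinuousLinearMap.adjoint (prevWedge (sym (comps a) ξ) j) :=
    ContinuousLinearMap.adjoint.continuous.comp hc2
  obtain ⟨y, hy⟩ := exists_mem_multGraph hc1 (f := u) (g := ft (u + w)) (by
    filter_upwards [hnorm] with ξ h1
    rw [h1]
    refine hbd _ _ _ (energy_nonneg _ _) (norm_nonneg _) (norm_nonneg _) ?_
    rw [energy, ← norm_wedge_sq_add]
    exact le_add_of_nonneg_right (by positivity))
  obtain ⟨v, hv⟩ := exists_mem_multGraph hc2' (f := u) (g := ft (u + w)) (by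
    filter_upwards [hnorm] with ξ h1
    rw [h1]
    refine hbd _ _ _ (energy_nonneg _ _) (norm_nonneg _) (norm_nonneg _) ?_
    rw [energy, ← norm_wedge_sq_add]
    exact le_add_of_nonneg_left (by positivity))
  obtain ⟨w₁, hw₁⟩ := exists_mem_multGraph hc1' (f := y) (g := ft (u + w)) (by
    filter_upwards [hnorm, mem_multGraph.1 hy] with ξ h1 h2
    rw [h1, h2]
    have h3 := norm_wedge_le (j := j) (sym (comps a) ξ)
    calc _ ≤ ‖(wedge (sym (comps a) ξ) : Coeff n j →L[ℂ] _)‖ *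
          (‖(wedge (sym (comps a) ξ) : Coeff n j →L[ℂ] _)‖ * ‖ft u ξ‖) := by
          refine (ContinuousLinearMap.le_opNorm _ _).trans ?_
          rw [LinearIsometryEquiv.norm_map]
          gcongr
          exact ContinuousLinearMap.le_opNorm _ _
      _ ≤ √(energy (comps a) ξ) * (√(energy (comps a) ξ) * ‖ft u ξ‖) := by
          gcongr <;> exact h3
      _ = energy (comps a) ξ * ‖ft u ξ‖ := by
          rw [← mul_assoc, Real.mul_self_sqrt (energy_nonneg _ _)]
      _ ≤ _ := by gcongr; linarith)
  rw [mem_graph_hodge]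
  refine ⟨y, w₁, v, w - w₁, ?_, ?_, ?_, ?_, by abel⟩
  · rw [graph_nabla_const]
    exact hy
  · refine (mem_graph_adjoint hC.denseT).2 fun x z hz => ?_
    rw [graph_nabla_const] at hz
    exact inner_multGraph hz hw₁
  · refine (mem_graph_adjoint hC.denseS).2 fun x z hz => ?_
    rw [graph_prevNabla_const] at hz
    exact inner_multGraph hz hv
  · rw [graph_prevNabla_const, mem_multGraph, map_sub]
    filter_upwards [h, mem_multGraph.1 hy, mem_multGraph.1 hv, mem_multGraph.1 hw₁,
      Lp.coeFn_sub (ft w) (ft w₁)] with ξ h1 h2 h3 h4 h5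
    rw [h5, Pi.sub_apply, h1, h3, h4, h2, energy, ← adjoint_wedge_wedge_add, add_sub_cancel_left]

/-- The Laplacian of a constant covector is the Fourier multiplier with symbol `|2πiξ + a|²`. -/
theorem graph_laplacian_const (a : V n →L[ℝ] ℝ) :
    (laplacian (fun _ => a) j).graph = scalarGraph (energy (comps a)) := by
  rw [laplacian_eq_hodge]
  refine le_antisymm ?_ fun ⟨u, w⟩ h => mem_hodge_of_mem_scalarGraph a h
  rintro ⟨u, w⟩ h
  obtain ⟨R, hR⟩ := (isHilbertComplex_const a j).exists_isNonnegResolvent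
  have hpos : ∀ ξ, 0 < 1 + energy (comps a) ξ := fun ξ => by
    linarith [energy_nonneg (comps a) ξ]
  -- For the other inclusion, dividing by `1 + m` solves `(1 + A) u' = u + w` in the multiplier.
  -- Since `1 + A` has the inverse `R`, this forces `u' = u`.
  obtain ⟨u', hu'⟩ := exists_mem_scalarGraph (m := fun ξ => (1 + energy (comps a) ξ)⁻¹) (C := 1)
    ((continuous_const.add (continuous_energy _)).inv₀ fun ξ => (hpos ξ).ne') (fun ξ => by
      rw [abs_of_pos (inv_pos.2 (hpos ξ))]
      exact inv_le_one_of_one_le₀ (by linarith [energy_nonneg (comps a) ξ])) (u + w)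
  have h' : (u', u + w - u') ∈ scalarGraph (energy (comps a)) := by
    rw [mem_scalarGraph] at hu' ⊢
    rw [map_sub]
    filter_upwards [hu', Lp.coeFn_sub (ft (u + w)) (ft u')] with ξ h1 h2
    have : (1 + energy (comps a) ξ : ℂ) ≠ 0 := by exact_mod_cast (hpos ξ).ne'
    rw [h2, Pi.sub_apply, h1, smul_smul]
    nth_rewrite 1 [← one_smul ℂ (ft (u + w) ξ)]
    rw [← sub_smul]
    congr 1
    push_cast
    field_simp
    ring
  have h1 := (hR.mem_graph _ _).1 (mem_hodge_of_mem_scalarGraph a h')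
  have h2 := (hR.mem_graph _ _).1 h
  rw [add_sub_cancel, h2] at h1
  rw [← h1, add_sub_cancel_left] at h'
  exact h'

end Constant

end TwistedL2

namespace TwistedL2

open scoped BoundedContinuousFunction

/-! ### Multiplication by bounded functions -/

section Multiplication

variable {n j : ℕ}

theorem memLp_mul (w : V n →ᵇ ℝ) (f : L2Form n j) :
    MemLp (fun x => (w x : ℂ) • f x) 2 (volume : Measure (V n)) := by
  refine (Lp.memLp f).of_le_mul (c := ‖w‖) ?_ (Eventually.of_forall fun x => ?_)
  · exact (Complex.continuous_ofReal.comp w.continuous).aestronglyMeasurable.smul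
      (Lp.aestronglyMeasurable f)
  · rw [norm_smul, Complex.norm_real]
    gcongr
    exact w.norm_coe_le_norm x

/-- Multiplication of `L²` forms by a bounded continuous function. -/
noncomputable def mulOp (w : V n →ᵇ ℝ) : L2Form n j →L[ℂ] L2Form n j :=
  LinearMap.mkContinuous
    { toFun := fun f => (memLp_mul w f).toLp _
      map_add' := fun f g => by
        rw [← MemLp.toLp_add]
        refine MemLp.toLp_congr _ _ ?_
        filter_upwards [Lp.coeFn_add f g] with x hx
        rw [hx, Pi.add_apply, Pi.add_apply, smul_add]
      map_smul' := fun c f => by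
        rw [RingHom.id_apply, ← MemLp.toLp_const_smul]
        refine MemLp.toLp_congr _ _ ?_
        filter_upwards [Lp.coeFn_smul c f] with x hx
        rw [hx, Pi.smul_apply, Pi.smul_apply, smul_comm] }
    ‖w‖ fun f => by
      refine Lp.norm_le_mul_norm_of_ae_le_mul ?_
      filter_upwards [(memLp_mul w f).coeFn_toLp] with x hx
      change ‖(memLp_mul w f).toLp _ x‖ ≤ _
      rw [hx, norm_smul, Complex.norm_real]
      gcongr
      exact w.norm_coe_le_norm x

theorem mulOp_coe (w : V n →ᵇ ℝ) (f : L2Form n j) :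
    mulOp w f =ᵐ[volume] fun x => (w x : ℂ) • f x := (memLp_mul w f).coeFn_toLp

theorem inner_mulOp (w : V n →ᵇ ℝ) (f g : L2Form n j) :
    inner ℂ (mulOp w f) g = inner ℂ f (mulOp w g) := by
  rw [L2.inner_def, L2.inner_def]
  refine integral_congr_ae ?_
  filter_upwards [mulOp_coe w f, mulOp_coe w g] with x h1 h2
  rw [h1, h2, inner_smul_left, inner_smul_right, Complex.conj_ofReal]

theorem mulOp_mulOp {w w' : V n →ᵇ ℝ} (h : ∀ x, w x * w' x = 1) (f : L2Form n j) :
    mulOp w (mulOp w' f) = f := by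
  apply Lp.ext
  filter_upwards [mulOp_coe w (mulOp w' f), mulOp_coe w' f] with x h1 h2
  rw [h1, h2, smul_smul, ← Complex.ofReal_mul, h x, Complex.ofReal_one, one_smul]

theorem mulOp_translate {w : V n →ᵇ ℝ} {v : V n} (h : ∀ x, w (x + v) = w x) (f : L2Form n j) :
    mulOp w (translate v f) = translate v (mulOp w f) := by
  apply Lp.ext
  have hq := (measurePreserving_add_right (volume : Measure (V n)) v).quasiMeasurePreserving.ae_eq
    (mulOp_coe w f)
  filter_upwards [mulOp_coe w (translate v f), translate_coe v f, translate_coe v (mulOp w f), hq]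
    with x h1 h2 h3 h4
  simp only [Function.comp_apply] at h4
  rw [h1, h2, h3, h4, h x]

end Multiplication

/-! ### Translation invariance of the twisted differential -/

section Translation

variable {n j : ℕ} {θ : OneForm n}

theorem graphDTheta_translate {v : V n} (hθ : ∀ x, θ (x + v) = θ x) {f : L2Form n j}
    {g : L2Form n (j + 1)} (h : (f, g) ∈ graphDTheta θ j) :
    (translate v f, translate v g) ∈ graphDTheta θ j := by
  obtain ⟨ω, hω, hc, h1, h2⟩ := h
  have hq := (measurePreserving_add_right (volume : Measure (V n)) v).quasiMeasurePreserving
  refine ⟨fun x => ω (x + v), hω.comp (contDiff_id.add contDiff_const),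
    hc.comp_homeomorph (Homeomorph.addRight v), (translate_coe v f).trans (hq.ae_eq h1),
    (translate_coe v g).trans ((hq.ae_eq h2).trans (Eventually.of_forall fun x => ?_))⟩
  change coeff (dTheta θ ω) (x + v) = coeff (dTheta θ fun x => ω (x + v)) x
  have : fderiv ℝ (fun x => ω (x + v)) x = fderiv ℝ ω (x + v) := fderiv_comp_add_right v
  simp only [coeff_eq, dTheta, extDeriv, this, hθ]

theorem closure_graphDTheta_map {θ' : OneForm n} {A : L2Form n j →L[ℂ] L2Form n j}
    {B : L2Form n (j + 1) →L[ℂ] L2Form n (j + 1)}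
    (hAB : ∀ f g, (f, g) ∈ graphDTheta θ j → (A f, B g) ∈ graphDTheta θ' j)
    {f : L2Form n j} {g : L2Form n (j + 1)} (h : (f, g) ∈ (graphDTheta θ j).topologicalClosure) :
    (A f, B g) ∈ (graphDTheta θ' j).topologicalClosure :=
  map_mem_closure (f := Prod.map A B) (A.continuous.prodMap B.continuous) h
    fun x hx => hAB x.1 x.2 hx

end Translation

/-! ### Symmetries of adjoints -/

section Adjoint

variable {H K : Type*}
  [NormedAddCommGroup H] [InnerProductSpace ℂ H] [CompleteSpace H]
  [NormedAddCommGroup K] [InnerProductSpace ℂ K] [CompleteSpace K]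

theorem mem_graph_adjoint_map {T : H →ₗ.[ℂ] K} (hT : Dense (T.domain : Set H)) (U : H ≃ₗᵢ[ℂ] H)
    (W : K ≃ₗᵢ[ℂ] K) (h : ∀ x z, (x, z) ∈ T.graph → (U.symm x, W.symm z) ∈ T.graph) {y : K} {w : H}
    (hy : (y, w) ∈ T.adjoint.graph) : (W y, U w) ∈ T.adjoint.graph := by
  rw [mem_graph_adjoint hT] at hy ⊢
  intro x z hxz
  have := hy _ _ (h x z hxz)
  rwa [← W.inner_map_map, ← U.inner_map_map, W.apply_symm_apply, U.apply_symm_apply] at this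

end Adjoint

/-! ### Conjugation by `e^φ` -/

section Conjugation

variable {n j : ℕ}

/-- Leibniz: `d(e^φ ω) = e^φ (dφ ∧ ω + dω)`, so the exact part of `θ` is absorbed by the factor
`e^φ`. -/
theorem graphDTheta_conj {θ θ' : OneForm n} {φ : V n → ℝ} (hφ : ContDiff ℝ (⊤ : ℕ∞) φ)
    (hθ : ∀ x, θ x = θ' x + fderiv ℝ φ x) (w : V n →ᵇ ℝ) (hw : ∀ x, w x = Real.exp (φ x))
    {f : L2Form n j} {g : L2Form n (j + 1)} (h : (f, g) ∈ graphDTheta θ j) :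
    (mulOp w f, mulOp w g) ∈ graphDTheta θ' j := by
  obtain ⟨ω, hω, hc, h1, h2⟩ := h
  have he : ContDiff ℝ (⊤ : ℕ∞) fun x => Real.exp (φ x) := hφ.exp
  have hω' : ContDiff ℝ (⊤ : ℕ∞) fun x => Real.exp (φ x) • ω x := he.smul hω
  have hcoeff : coeff (fun x => Real.exp (φ x) • ω x) = fun x => Real.exp (φ x) • coeff ω x := by
    funext x
    simp only [coeff_eq, map_smul]
  refine ⟨fun x => Real.exp (φ x) • ω x, hω', hc.smul_left (f := fun x => Real.exp (φ x)), ?_, ?_⟩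
  · filter_upwards [mulOp_coe w f, h1] with x h3 h4
    rw [h3, h4, hcoeff, hw, Complex.coe_smul]
  · filter_upwards [mulOp_coe w g, h2] with x h3 h4
    rw [h3, h4, hw, Complex.coe_smul, coeff_dTheta _ (hω'.differentiable (by simp)),
      coeff_dTheta _ (hω.differentiable (by simp)), hcoeff]
    have hd : ∀ v, fderiv ℝ (fun x => Real.exp (φ x) • coeff ω x) x v =
        Real.exp (φ x) • ((fderiv ℝ φ x v : ℂ) • coeff ω x + fderiv ℝ (coeff ω) x v) := by
      intro v
      have e1 : HasFDerivAt (fun x => Real.exp (φ x)) (Real.exp (φ x) • fderiv ℝ φ x) x :=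
        ((hφ.differentiable (by simp)) x).hasFDerivAt.exp
      have e2 : HasFDerivAt (coeff ω) (fderiv ℝ (coeff ω) x) x :=
        (((contDiff_coeff hω).differentiable (by simp)) x).hasFDerivAt
      have e3 : HasFDerivAt (fun x => Real.exp (φ x) • coeff ω x) _ x := e1.smul e2
      rw [e3.fderiv]
      simp only [_root_.add_apply, _root_.smul_apply, ContinuousLinearMap.smulRight_apply,
        smul_add, Complex.coe_smul, smul_smul, smul_eq_mul]
      rw [add_comm]
    have hsplit : wedge (comps (θ x)) (coeff ω x) = wedge (comps (θ' x)) (coeff ω x) +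
        ∑ i, (fderiv ℝ φ x (evec i) : ℂ) • wedge (bvec i) (coeff ω x) := by
      have : comps (θ x) = comps (θ' x) + ∑ i, (fderiv ℝ φ x (evec i) : ℂ) • bvec i := by
        funext l
        simp [hθ, comps, bvec, Pi.single_apply]
      rw [this, wedge_add, wedge_sum]
      simp only [wedge_smul]
    have hr : ∀ (p : Fin n → ℂ) (r : ℝ) (u : Coeff n j), wedge p (r • u) = r • wedge p u := by
      intro p r u
      rw [← Complex.coe_smul, map_smul, Complex.coe_smul]
    simp only [hd, hr, map_add, map_smul, hsplit, smul_add, Finset.sum_add_distrib, Finset.smul_sum]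
    abel

/-- A decomposition `θ = a + dφ` with `a` constant and `φ` smooth and periodic. -/
structure IsDecomposition (b : Module.Basis (Fin n) ℝ (V n)) (θ : OneForm n) (a : V n →L[ℝ] ℝ)
    (φ : V n → ℝ) : Prop where
  smooth : ContDiff ℝ (⊤ : ℕ∞) φ
  periodic : IsPeriodic b φ
  eq : ∀ x, θ x = a + fderiv ℝ φ x

theorem IsPeriodic.exists_bound {b : Module.Basis (Fin n) ℝ (V n)} {φ : V n → ℝ}
    (hφ : IsPeriodic b φ) (hc : Continuous φ) : ∃ C, ∀ x, |φ x| ≤ C := by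
  have hK : IsCompact (closure (ZSpan.fundamentalDomain b)) :=
    (ZSpan.fundamentalDomain_isBounded b).isCompact_closure
  obtain ⟨C, hC⟩ := hK.exists_bound_of_continuousOn hc.continuousOn
  refine ⟨C, fun x => ?_⟩
  have h1 : φ x = φ (ZSpan.fract b x) := by
    have := hφ (ZSpan.floor b x) (ZSpan.floor b x).2 (ZSpan.fract b x)
    rwa [ZSpan.fract_apply, sub_add_cancel] at this
  rw [h1]
  exact hC _ (subset_closure (ZSpan.fract_mem_fundamentalDomain b x))

variable {b : Module.Basis (Fin n) ℝ (V n)} {θ : OneForm n} {a : V n →L[ℝ] ℝ} {φ : V n → ℝ}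

/-- The function `e^φ` for a smooth periodic function `φ`. -/
theorem exists_expBCF {φ : V n → ℝ} (hφ : IsPeriodic b φ) (hc : Continuous φ) :
    ∃ w : V n →ᵇ ℝ, ∀ x, w x = Real.exp (φ x) := by
  obtain ⟨C, hC⟩ := hφ.exists_bound hc
  exact ⟨BoundedContinuousFunction.ofNormedAddCommGroup (fun x => Real.exp (φ x))
    (Real.continuous_exp.comp hc) (Real.exp C) fun x => by
      rw [Real.norm_of_nonneg (Real.exp_pos _).le]
      exact Real.exp_le_exp.2 ((le_abs_self _).trans (hC x)), fun x => rfl⟩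

namespace IsDecomposition

/-- `e^φ` and `e^{-φ}`. -/
theorem exists_weights (h : IsDecomposition b θ a φ) : ∃ w w' : V n →ᵇ ℝ,
    (∀ x, w x = Real.exp (φ x)) ∧ (∀ x, w' x = Real.exp (-φ x)) := by
  obtain ⟨w, hw⟩ := exists_expBCF h.periodic h.smooth.continuous
  obtain ⟨w', hw'⟩ := exists_expBCF (b := b) (φ := fun x => -φ x)
    (fun v hv x => congrArg Neg.neg (h.periodic v hv x)) h.smooth.continuous.neg
  exact ⟨w, w', hw, hw'⟩

theorem smooth_form (h : IsDecomposition b θ a φ) : ContDiff ℝ (⊤ : ℕ∞) θ := by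
  have : θ = fun x => a + fderiv ℝ φ x := funext h.eq
  rw [this]
  exact contDiff_const.add (h.smooth.fderiv_right (by simp))

theorem periodic_form (h : IsDecomposition b θ a φ) : IsPeriodic b θ := by
  intro v hv x
  have : fderiv ℝ φ (x + v) = fderiv ℝ φ x := by
    rw [← fderiv_comp_add_right v]
    congr 1
    exact funext fun y => h.periodic v hv y
  rw [h.eq, h.eq, this]

/-- Stated for the closure of the graph, not for `nabla θ`, because `d_θ` is not yet known to be
closable; closability follows from this lemma, as `e^φ` is injective and the constant operator is
closed. -/
theorem closure_conj (h : IsDecomposition b θ a φ) {w : V n →ᵇ ℝ}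
    (hw : ∀ x, w x = Real.exp (φ x)) {f : L2Form n j} {g : L2Form n (j + 1)}
    (hfg : (f, g) ∈ (graphDTheta θ j).topologicalClosure) :
    (mulOp w f, mulOp w g) ∈ (nabla (fun _ => a) j).graph := by
  have hle : (graphDTheta (fun _ => a) j).topologicalClosure ≤ (nabla (fun _ => a) j).graph := by
    rw [graph_nabla_const]
    exact Submodule.topologicalClosure_minimal _ (graphDTheta_const_le a) (isClosed_multGraph _)
  exact hle (closure_graphDTheta_map (fun f g hfg => graphDTheta_conj h.smooth h.eq w hw hfg) hfg)

theorem graph_nabla (h : IsDecomposition b θ a φ) :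
    (nabla θ j).graph = (graphDTheta θ j).topologicalClosure := by
  obtain ⟨w, w', hw, hw'⟩ := h.exists_weights
  refine graph_nabla_of_functional fun g hg => ?_
  have h1 := h.closure_conj hw hg
  rw [map_zero] at h1
  have h2 := graph_functional h1 (nabla (fun _ => a) j).graph.zero_mem
  rw [← mulOp_mulOp (w := w') (w' := w) (fun x => by
    rw [hw, hw', ← Real.exp_add, neg_add_cancel, Real.exp_zero]) g, h2, map_zero]

theorem const (a : V n →L[ℝ] ℝ) : IsDecomposition b (fun _ => a) a fun _ => 0 where
  smooth := contDiff_const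
  periodic _ _ _ := rfl
  eq x := by simp

theorem conj (h : IsDecomposition b θ a φ) {w : V n →ᵇ ℝ}
    (hw : ∀ x, w x = Real.exp (φ x)) {f : L2Form n j} {g : L2Form n (j + 1)}
    (hfg : (f, g) ∈ (nabla θ j).graph) :
    (mulOp w f, mulOp w g) ∈ (nabla (fun _ => a) j).graph :=
  h.closure_conj hw (h.graph_nabla ▸ hfg)

theorem conj_symm (h : IsDecomposition b θ a φ) {w' : V n →ᵇ ℝ}
    (hw' : ∀ x, w' x = Real.exp (-φ x)) {f : L2Form n j} {g : L2Form n (j + 1)}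
    (hfg : (f, g) ∈ (nabla (fun _ => a) j).graph) :
    (mulOp w' f, mulOp w' g) ∈ (nabla θ j).graph := by
  rw [h.graph_nabla]
  rw [(const (b := b) a).graph_nabla] at hfg
  refine closure_graphDTheta_map (fun f g hfg => graphDTheta_conj h.smooth.neg
    (fun x => ?_) w' hw' hfg) hfg
  have : fderiv ℝ (fun x => -φ x) x = -fderiv ℝ φ x := fderiv_neg
  rw [this, h.eq, add_neg_cancel_right]

theorem conj_prev (h : IsDecomposition b θ a φ) {w : V n →ᵇ ℝ}
    (hw : ∀ x, w x = Real.exp (φ x)) {f : L2Form n (j - 1)} {g : L2Form n j}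
    (hfg : (f, g) ∈ (prevNabla θ j).graph) :
    (mulOp w f, mulOp w g) ∈ (prevNabla (fun _ => a) j).graph := by
  cases j with
  | zero => rw [mem_graph_zero.1 hfg, map_zero]; exact mem_graph_zero.2 rfl
  | succ j => exact h.conj hw hfg

theorem conj_symm_prev (h : IsDecomposition b θ a φ) {w' : V n →ᵇ ℝ}
    (hw' : ∀ x, w' x = Real.exp (-φ x)) {f : L2Form n (j - 1)} {g : L2Form n j}
    (hfg : (f, g) ∈ (prevNabla (fun _ => a) j).graph) :
    (mulOp w' f, mulOp w' g) ∈ (prevNabla θ j).graph := by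
  cases j with
  | zero => rw [mem_graph_zero.1 hfg, map_zero]; exact mem_graph_zero.2 rfl
  | succ j => exact h.conj_symm hw' hfg

theorem dense_domain (h : IsDecomposition b θ a φ) :
    Dense ((nabla θ j).domain : Set (L2Form n j)) :=
  domain_dense_of_graphDTheta_le h.smooth_form
    (h.graph_nabla.symm ▸ Submodule.le_topologicalClosure _)

theorem isHilbertComplex (h : IsDecomposition b θ a φ) (j : ℕ) :
    IsHilbertComplex (prevNabla θ j) (nabla θ j) where
  denseS := by
    cases j with
    | zero => exact dense_univ
    | succ j => exact h.dense_domain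
  closedS := by
    cases j with
    | zero =>
      have : ((prevNabla θ 0).graph : Set (L2Form n (0 - 1) × L2Form n 0)) =
          Prod.snd ⁻¹' {0} := by
        ext ⟨x, y⟩
        exact mem_graph_zero
      rw [this]
      exact isClosed_singleton.preimage continuous_snd
    | succ j =>
      change IsClosed ((nabla θ j).graph : Set (L2Form n j × L2Form n (j + 1)))
      rw [h.graph_nabla]
      exact Submodule.isClosed_topologicalClosure _
  denseT := h.dense_domain
  closedT := by
    rw [h.graph_nabla]
    exact Submodule.isClosed_topologicalClosure _
  comp_eq_zero := by
    intro x y hxy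
    obtain ⟨w, w', hw, hw'⟩ := h.exists_weights
    have h1 := (isHilbertComplex_const a j).comp_eq_zero _ _ (h.conj_prev hw hxy)
    have h2 := h.conj_symm hw' h1
    rwa [map_zero, mulOp_mulOp fun x => by
      rw [hw, hw', ← Real.exp_add, neg_add_cancel, Real.exp_zero]] at h2

theorem graph_translate (h : IsDecomposition b θ a φ) {v : V n}
    (hv : v ∈ Submodule.span ℤ (Set.range b)) {f : L2Form n j} {g : L2Form n (j + 1)}
    (hfg : (f, g) ∈ (nabla θ j).graph) : (translate v f, translate v g) ∈ (nabla θ j).graph := by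
  rw [h.graph_nabla] at hfg ⊢
  exact closure_graphDTheta_map (A := (translate v).toContinuousLinearEquiv.toContinuousLinearMap)
    (B := (translate v).toContinuousLinearEquiv.toContinuousLinearMap)
    (fun f g hfg => graphDTheta_translate (h.periodic_form v hv) hfg) hfg

theorem graph_prev_translate (h : IsDecomposition b θ a φ) {v : V n}
    (hv : v ∈ Submodule.span ℤ (Set.range b)) {f : L2Form n (j - 1)} {g : L2Form n j}
    (hfg : (f, g) ∈ (prevNabla θ j).graph) :
    (translate v f, translate v g) ∈ (prevNabla θ j).graph := by
  cases j with
  | zero => rw [mem_graph_zero.1 hfg, map_zero]; exact mem_graph_zero.2 rfl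
  | succ j => exact h.graph_translate hv hfg

theorem laplacian_translate (h : IsDecomposition b θ a φ) {v : V n}
    (hv : v ∈ Submodule.span ℤ (Set.range b)) {f g : L2Form n j}
    (hfg : (f, g) ∈ (laplacian θ j).graph) :
    (translate v f, translate v g) ∈ (laplacian θ j).graph := by
  have hC := h.isHilbertComplex j
  have hv' := neg_mem hv
  rw [laplacian_eq_hodge, mem_graph_hodge] at hfg ⊢
  obtain ⟨y, w₁, x, w₂, h1, h2, h3, h4, rfl⟩ := hfg
  refine ⟨translate v y, translate v w₁, translate v x, translate v w₂, h.graph_translate hv h1,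
    ?_, ?_, h.graph_prev_translate hv h4, map_add _ _ _⟩
  · refine mem_graph_adjoint_map hC.denseT _ _ (fun x z hxz => ?_) h2
    rw [translate_symm, translate_symm]
    exact h.graph_translate hv' hxz
  · refine mem_graph_adjoint_map hC.denseS _ _ (fun x z hxz => ?_) h3
    rw [translate_symm, translate_symm]
    exact h.graph_prev_translate hv' hxz

/-- The family is obtained by choice, so it inherits the invariance of the Laplacian through the
uniqueness of cuts. -/
theorem isEquivariant_spectralFamily (h : IsDecomposition b θ a φ) {t : ℝ} (ht : 0 < t) :
    IsEquivariant b (spectralFamily (laplacian θ j) t) := by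
  obtain ⟨R, hR⟩ := (h.isHilbertComplex j).exists_isNonnegResolvent
  rw [← laplacian_eq_hodge] at hR
  intro v hv f
  refine IsCut.comm hR ht (hR.isCut_spectralFamily t) (translate v)
    (fun u w huw => h.laplacian_translate hv huw) (fun u w huw => ?_) f
  rw [translate_symm, translate_symm]
  exact h.laplacian_translate (neg_mem hv) huw

end IsDecomposition

end Conjugation

end TwistedL2

namespace TwistedL2

open scoped BoundedContinuousFunction

/-! ### Comparison of spectral distribution functions -/

section Comparison

variable {n j : ℕ} {b : Module.Basis (Fin n) ℝ (V n)} {θ : OneForm n} {a : V n →L[ℝ] ℝ}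
  {φ : V n → ℝ}

namespace IsDecomposition

theorem exists_resolvent (h : IsDecomposition b θ a φ) (j : ℕ) :
    ∃ R, IsNonnegResolvent (laplacian θ j) R := by
  rw [laplacian_eq_hodge]
  exact (h.isHilbertComplex j).exists_isNonnegResolvent

theorem gker_translate (h : IsDecomposition b θ a φ) {v : V n}
    (hv : v ∈ Submodule.span ℤ (Set.range b)) {x : L2Form n j} (hx : x ∈ gker (nabla θ j)) :
    translate v x ∈ gker (nabla θ j) := by
  have := h.graph_translate hv (mem_gker.1 hx)
  rwa [map_zero] at this

/-- The equivariant comparison maps between the complexes of `θ` and of its constant part. -/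
theorem exists_comparison (h : IsDecomposition b θ a φ) (j : ℕ) :
    (∃ (J : L2Form n j →L[ℂ] L2Form n j) (c C : ℝ), IsComparison (prevNabla θ j) (nabla θ j)
      (prevNabla (fun _ => a) j) (nabla (fun _ => a) j) J c C ∧ IsEquivariant b J) ∧
    ∃ (J : L2Form n j →L[ℂ] L2Form n j) (c C : ℝ), IsComparison (prevNabla (fun _ => a) j)
      (nabla (fun _ => a) j) (prevNabla θ j) (nabla θ j) J c C ∧ IsEquivariant b J := by
  obtain ⟨w, w', hw, hw'⟩ := h.exists_weights
  have e1 : ∀ x, w x * w' x = 1 := fun x => by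
    rw [hw, hw', ← Real.exp_add, add_neg_cancel, Real.exp_zero]
  have e2 : ∀ x, w' x * w x = 1 := fun x => by rw [mul_comm, e1]
  have hp : ∀ v ∈ Submodule.span ℤ (Set.range b), ∀ x, w (x + v) = w x := fun v hv x => by
    rw [hw, hw, h.periodic v hv]
  have hp' : ∀ v ∈ Submodule.span ℤ (Set.range b), ∀ x, w' (x + v) = w' x := fun v hv x => by
    rw [hw', hw', h.periodic v hv]
  have h0 := const (b := b) a
  have i1 : Intertwines (prevNabla θ j) (nabla θ j) (prevNabla (fun _ => a) j)
      (nabla (fun _ => a) j) (mulOp w) (mulOp w') (mulOp w) (mulOp w') :=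
    { apply_apply := mulOp_mulOp e1
      apply_apply' := mulOp_mulOp e2
      symm := inner_mulOp w
      symm' := inner_mulOp w'
      symmL := inner_mulOp w'
      mapT := fun u y huy => h.conj hw huy
      kerT := fun u hu => by
        have := h.conj_symm hw' hu
        rwa [map_zero] at this
      mapS := fun x y hxy => h.conj_symm_prev hw' hxy }
  have i2 : Intertwines (prevNabla (fun _ => a) j) (nabla (fun _ => a) j) (prevNabla θ j)
      (nabla θ j) (mulOp w') (mulOp w) (mulOp w') (mulOp w) :=
    { apply_apply := mulOp_mulOp e2
      apply_apply' := mulOp_mulOp e1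
      symm := inner_mulOp w'
      symm' := inner_mulOp w
      symmL := inner_mulOp w
      mapT := fun u y huy => h.conj_symm hw' huy
      kerT := fun u hu => by
        have := h.conj hw hu
        rwa [map_zero] at this
      mapS := fun x y hxy => h.conj_prev hw hxy }
  constructor
  · obtain ⟨J, c, C, hJ, hU⟩ := i1.exists_comparison (h.isHilbertComplex j) (h0.isHilbertComplex j)
    refine ⟨J, c, C, hJ, fun v hv f => hU (translate v) (fun x => h.gker_translate hv)
      (fun x hx => ?_) (fun x => h0.gker_translate hv) (fun x hx => ?_)
      (mulOp_translate (hp v hv)) (mulOp_translate (hp' v hv)) f⟩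
    · rw [translate_symm]; exact h.gker_translate (neg_mem hv) hx
    · rw [translate_symm]; exact h0.gker_translate (neg_mem hv) hx
  · obtain ⟨J, c, C, hJ, hU⟩ := i2.exists_comparison (h0.isHilbertComplex j) (h.isHilbertComplex j)
    refine ⟨J, c, C, hJ, fun v hv f => hU (translate v) (fun x => h0.gker_translate hv)
      (fun x hx => ?_) (fun x => h.gker_translate hv) (fun x hx => ?_)
      (mulOp_translate (hp' v hv)) (mulOp_translate (hp v hv)) f⟩
    · rw [translate_symm]; exact h0.gker_translate (neg_mem hv) hx
    · rw [translate_symm]; exact h.gker_translate (neg_mem hv) hx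

end IsDecomposition

/-- `Q J` is bounded below by `c/2` on the range of `P`, where `P` is the projection at `t` and `Q`
that of the other Laplacian at `κt` with `κ = 4C/c²`; the trace comparison then gives `D = ‖J‖² /
(c/2)²`. -/
theorem spectralDistribution_le_of_comparison {θ θ' : OneForm n} {a' : V n →L[ℝ] ℝ} {φ' : V n → ℝ}
    (h : IsDecomposition b θ a φ) (h' : IsDecomposition b θ' a' φ')
    {J : L2Form n j →L[ℂ] L2Form n j} {c C : ℝ}
    (hJ : IsComparison (prevNabla θ j) (nabla θ j) (prevNabla θ' j) (nabla θ' j) J c C)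
    (hJe : IsEquivariant b J) : ∃ (D : ℝ≥0) (κ : ℝ), 0 < κ ∧ ∀ t, 0 < t →
      spectralDistribution b θ j t ≤ D * spectralDistribution b θ' j (κ * t) := by
  have hc := hJ.c_pos
  have hCp := hJ.C_pos
  obtain ⟨R, hR⟩ := h.exists_resolvent j
  obtain ⟨R', hR'⟩ := h'.exists_resolvent j
  refine ⟨Real.toNNReal (‖J‖ ^ 2 / (c / 2) ^ 2), 4 * C / c ^ 2, by positivity, fun t ht => ?_⟩
  have ht' : 0 < 4 * C / c ^ 2 * t := by positivity
  have hP := hR.isCut_spectralFamily t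
  have hQ := hR'.isCut_spectralFamily (4 * C / c ^ 2 * t)
  refine vnTrace_le_of_bounded_below b hP.proj hQ.proj (h.isEquivariant_spectralFamily ht)
    (h'.isEquivariant_spectralFamily ht') hJe (by positivity : 0 < c / 2) fun u hu => ?_
  rw [laplacian_eq_hodge] at hP hQ hR' hu
  have hQ' := hJ.le_norm_cut (h.isHilbertComplex j) (h'.isHilbertComplex j) hR' ht hP hQ hu
  rwa [laplacian_eq_hodge]

theorem IsDecomposition.spectralDistribution_le (h : IsDecomposition b θ a φ) (j : ℕ) :
    ∃ (D : ℝ≥0) (κ : ℝ), 0 < κ ∧ ∀ t, 0 < t →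
      spectralDistribution b θ j t ≤ D * spectralDistribution b (fun _ => a) j (κ * t) := by
  obtain ⟨⟨J, c, C, hJ, hJe⟩, -⟩ := h.exists_comparison j
  exact spectralDistribution_le_of_comparison h (IsDecomposition.const a) hJ hJe

theorem IsDecomposition.spectralDistribution_const_le (h : IsDecomposition b θ a φ) (j : ℕ) :
    ∃ (D : ℝ≥0) (κ : ℝ), 0 < κ ∧ ∀ t, 0 < t →
      spectralDistribution b (fun _ => a) j t ≤ D * spectralDistribution b θ j (κ * t) := by
  obtain ⟨-, J, c, C, hJ, hJe⟩ := h.exists_comparison j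
  exact spectralDistribution_le_of_comparison (IsDecomposition.const a) h hJ hJe

end Comparison

/-! ### Vanishing of the reduced cohomology -/

section Betti

variable {n j : ℕ} {b : Module.Basis (Fin n) ℝ (V n)} {θ : OneForm n} {a : V n →L[ℝ] ℝ}
  {φ : V n → ℝ}

theorem norm_covector_sq (a : V n →L[ℝ] ℝ) : ‖a‖ ^ 2 = ∑ i, a (evec i) ^ 2 := by
  let y := (InnerProductSpace.toDual ℝ (V n)).symm a
  have h1 : ‖y‖ = ‖a‖ := LinearIsometryEquiv.norm_map _ _
  rw [← h1, EuclideanSpace.real_norm_sq_eq]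
  refine Finset.sum_congr rfl fun i _ => ?_
  have : a (evec i) = inner ℝ y (evec i) := (InnerProductSpace.toDual_symm_apply).symm
  rw [this, evec, EuclideanSpace.inner_single_right]
  simp

/-- `2πξᵢ` is the imaginary and `aᵢ` the real part of the symbol, so there is no cross term. -/
theorem energy_eq (a : V n →L[ℝ] ℝ) (ξ : V n) :
    energy (comps a) ξ = 4 * Real.pi ^ 2 * ‖ξ‖ ^ 2 + ‖a‖ ^ 2 := by
  rw [norm_covector_sq, EuclideanSpace.real_norm_sq_eq, energy, Finset.mul_sum,
    ← Finset.sum_add_distrib]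
  refine Finset.sum_congr rfl fun i _ => ?_
  rw [← Complex.normSq_eq_norm_sq, Complex.normSq_apply]
  simp [sym, comps]
  ring

theorem energy_ae_ne_zero (hn : 0 < n) (a : V n →L[ℝ] ℝ) : ∀ᵐ ξ, energy (comps a) ξ ≠ 0 := by
  have : Nonempty (Fin n) := ⟨⟨0, hn⟩⟩
  filter_upwards [Measure.ae_ne volume (0 : V n)] with ξ hξ
  rw [energy_eq]
  have : 0 < ‖ξ‖ := norm_pos_iff.2 hξ
  positivity

theorem eq_zero_of_scalarGraph_zero {m : V n → ℝ} (hm : ∀ᵐ ξ, m ξ ≠ 0) {u : L2Form n j}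
    (h : (u, 0) ∈ scalarGraph m) : u = 0 := by
  rw [← (ft : L2Form n j ≃ₗᵢ[ℂ] L2Form n j).map_eq_zero_iff]
  apply Lp.ext
  rw [mem_scalarGraph, map_zero] at h
  filter_upwards [h, hm, Lp.coeFn_zero (Coeff n j) 2 (volume : Measure (V n))] with ξ h1 h2 h3
  rw [h3] at h1 ⊢
  have h4 : (m ξ : ℂ) ≠ 0 := by exact_mod_cast h2
  exact (smul_eq_zero.1 h1.symm).resolve_left h4

theorem orthogonal_closedImage {u : L2Form n j} (hu : u ∈ (closedImage θ j)ᗮ)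
    (hd : Dense ((prevNabla θ j).domain : Set (L2Form n (j - 1)))) :
    (u, 0) ∈ (prevNabla θ j).adjoint.graph := by
  refine (mem_graph_adjoint hd).2 fun x z hxz => ?_
  rw [inner_zero_right]
  cases j with
  | zero => rw [mem_graph_zero.1 hxz, inner_zero_left]
  | succ j =>
    refine (Submodule.mem_orthogonal _ _).1 hu z (Submodule.le_topologicalClosure _ ?_)
    obtain ⟨y, -, hy⟩ := (LinearPMap.mem_graph_iff _).1 hxz
    exact ⟨y, hy⟩

/-- A vector of the reduced cohomology has zero energy, so its image under `J` has zero energy for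
the constant complex and is killed by a multiplier that is nonzero almost everywhere. As `J` is
bounded below, the vector is zero. -/
theorem IsDecomposition.reducedCohomology_eq_bot (h : IsDecomposition b θ a φ) (hn : 0 < n) :
    reducedCohomology θ j = ⊥ := by
  rw [eq_bot_iff]
  rintro u ⟨hu1, hu2⟩
  have hC := h.isHilbertComplex j
  have hT : (u, (0 : L2Form n (j + 1))) ∈ (nabla θ j).graph := by
    obtain ⟨x, hx, rfl⟩ := hu1
    exact (LinearPMap.mem_graph_iff _).2 ⟨x, rfl, hx⟩
  have hS := orthogonal_closedImage hu2 hC.denseS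
  obtain ⟨⟨J, c, C, hJ, -⟩, -⟩ := h.exists_comparison j
  obtain ⟨y₀, z₀, hy, hz, hf⟩ := hJ.form u 0 0 hT hS
  rw [norm_zero, norm_zero] at hf
  have hy0 : y₀ = 0 := by
    rw [← norm_eq_zero, ← sq_eq_zero_iff]
    nlinarith [sq_nonneg ‖y₀‖, sq_nonneg ‖z₀‖]
  have hz0 : z₀ = 0 := by
    rw [← norm_eq_zero, ← sq_eq_zero_iff]
    nlinarith [sq_nonneg ‖y₀‖, sq_nonneg ‖z₀‖]
  rw [hy0] at hy
  rw [hz0] at hz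
  have hA : (J u, (0 : L2Form n j)) ∈ (laplacian (fun _ => a) j).graph := by
    rw [laplacian_eq_hodge, mem_graph_hodge]
    exact ⟨0, 0, 0, 0, hy, Submodule.zero_mem _, hz, Submodule.zero_mem _, (add_zero 0).symm⟩
  rw [graph_laplacian_const] at hA
  have hJu := eq_zero_of_scalarGraph_zero (energy_ae_ne_zero hn a) hA
  have := hJ.le_norm u
  rw [hJu, norm_zero] at this
  have hu : ‖u‖ ≤ 0 := by
    by_contra hpos
    nlinarith [hJ.c_pos, mul_pos hJ.c_pos (not_le.1 hpos)]
  exact norm_le_zero_iff.1 hu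

theorem vnTrace_zero : vnTrace b (0 : L2Form n j →L[ℂ] L2Form n j) = 0 := by
  simp [vnTrace]

theorem IsDecomposition.twistedBetti_eq_zero (h : IsDecomposition b θ a φ) (hn : 0 < n) :
    twistedBetti b θ j = 0 := by
  rw [twistedBetti, vnDim, ← vnTrace_zero (b := b) (j := j)]
  congr 1
  have : (reducedCohomology θ j).topologicalClosure = ⊥ := by
    rw [h.reducedCohomology_eq_bot hn]
    exact IsClosed.submodule_topologicalClosure_eq isClosed_singleton
  ext1 x
  have h1 := Submodule.starProjection_apply_mem (reducedCohomology θ j).topologicalClosure x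
  generalize (reducedCohomology θ j).topologicalClosure.starProjection x = y at h1
  rw [this] at h1
  exact h1

end Betti

/-! ### Spectral projections of the constant Laplacian -/

section FourierCut

variable {n j : ℕ} {b : Module.Basis (Fin n) ℝ (V n)}

/-- The space of forms with Fourier transform supported in `F`. -/
noncomputable def bandlimited (F : Set (V n)) : Submodule ℂ (L2Form n j) :=
  (suppIn F).comap (ft : L2Form n j ≃ₗᵢ[ℂ] L2Form n j).toLinearEquiv.toLinearMap

theorem mem_bandlimited {F : Set (V n)} {f : L2Form n j} : f ∈ bandlimited F ↔ ft f ∈ suppIn F :=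
  Iff.rfl

theorem bandlimited_hasOrthogonalProjection {F : Set (V n)} (hF : MeasurableSet F) :
    (bandlimited F : Submodule ℂ (L2Form n j)).HasOrthogonalProjection :=
  @Submodule.HasOrthogonalProjection.ofCompleteSpace _ _ _ _ _ _
    (((isClosed_suppIn hF).preimage
      (ft : L2Form n j ≃ₗᵢ[ℂ] L2Form n j).continuous).completeSpace_coe)

theorem ft_starProjection {F : Set (V n)} (hF : MeasurableSet F)
    [(bandlimited F : Submodule ℂ (L2Form n j)).HasOrthogonalProjection] (f : L2Form n j) :
    ft ((bandlimited F).starProjection f) = restrictTo hF (ft f) := by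
  rw [← LinearIsometryEquiv.eq_symm_apply]
  refine Submodule.eq_starProjection_of_mem_of_inner_eq_zero ?_ fun w hw => ?_
  · rw [mem_bandlimited, LinearIsometryEquiv.apply_symm_apply]
    exact restrictTo_mem hF _
  · rw [← ft.inner_map_map, map_sub, LinearIsometryEquiv.apply_symm_apply, inner_sub_left,
      sub_eq_zero, ← inner_conj_symm, ← inner_conj_symm (restrictTo hF (ft f))]
    rw [inner_restrictTo hF (mem_bandlimited.1 hw)]

/-- The Fourier projection to low energies is the spectral projection of the Laplacian. -/
theorem isCut_bandlimited (a : V n →L[ℝ] ℝ) (t : ℝ)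
    [(bandlimited {ξ | energy (comps a) ξ ≤ t} : Submodule ℂ (L2Form n j)).HasOrthogonalProjection] :
    IsCut (laplacian (fun _ => a) j) t (bandlimited {ξ | energy (comps a) ξ ≤ t}).starProjection := by
  have hm : MeasurableSet {ξ | energy (comps a) ξ ≤ t} :=
    (isClosed_le (continuous_energy _) continuous_const).measurableSet
  have hinner : ∀ {u w : L2Form n j}, (u, w) ∈ scalarGraph (energy (comps a)) →
      (inner ℂ u w).re = ∫ ξ, energy (comps a) ξ * ‖ft u ξ‖ ^ 2 ∧
        Integrable fun ξ => energy (comps a) ξ * ‖ft u ξ‖ ^ 2 := by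
    intro u w h
    have h1 : (fun ξ => inner ℂ (ft u ξ) (ft w ξ)) =ᵐ[volume]
        fun ξ => ((energy (comps a) ξ * ‖ft u ξ‖ ^ 2 : ℝ) : ℂ) := by
      filter_upwards [mem_scalarGraph.1 h] with ξ h1
      rw [h1, inner_smul_right, inner_self_eq_norm_sq_to_K]
      push_cast
      rfl
    have h2 := (L2.integrable_inner (𝕜 := ℂ) (ft u) (ft w)).congr h1
    refine ⟨?_, h2.re⟩
    rw [← ft.inner_map_map, L2.inner_def, integral_congr_ae h1, integral_complex_ofReal, Complex.ofReal_re]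
  have hnorm : ∀ u : L2Form n j, t * ‖u‖ ^ 2 = ∫ ξ, t * ‖ft u ξ‖ ^ 2 ∧
      Integrable fun ξ => t * ‖ft u ξ‖ ^ 2 := by
    intro u
    have h1 : (fun ξ => inner ℂ (ft u ξ) (ft u ξ)) =ᵐ[volume]
        fun ξ => ((‖ft u ξ‖ ^ 2 : ℝ) : ℂ) := by
      refine Eventually.of_forall fun ξ => ?_
      dsimp only
      rw [inner_self_eq_norm_sq_to_K]
      push_cast
      rfl
    have h2 := (L2.integrable_inner (𝕜 := ℂ) (ft u) (ft u)).congr h1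
    refine ⟨?_, Integrable.const_mul h2.re t⟩
    rw [integral_const_mul, ← re_inner_self, ← ft.inner_map_map, L2.inner_def, integral_congr_ae h1,
      integral_complex_ofReal, Complex.ofReal_re]
  constructor
  · exact isStarProjection_starProjection
  · intro u w h
    rw [graph_laplacian_const, mem_scalarGraph] at h ⊢
    rw [ft_starProjection hm, ft_starProjection hm]
    filter_upwards [h, restrictTo_coe hm (ft u), restrictTo_coe hm (ft w)] with ξ h1 h2 h3
    rw [h2, h3]
    by_cases hξ : ξ ∈ {ξ | energy (comps a) ξ ≤ t}
    · rw [Set.indicator_of_mem hξ, Set.indicator_of_mem hξ, h1]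
    · rw [Set.indicator_of_notMem hξ, Set.indicator_of_notMem hξ, smul_zero]
  · intro u
    obtain ⟨g, hg⟩ : ∃ g, ((bandlimited {ξ | energy (comps a) ξ ≤ t}).starProjection u, g) ∈
        scalarGraph (energy (comps a)) := by
      refine exists_mem_multGraph (g := (t : ℂ) • ft u) ?_ ?_
      · have := continuous_energy (comps a)
        fun_prop
      · rw [ft_starProjection hm]
        filter_upwards [restrictTo_coe hm (ft u), Lp.coeFn_smul (t : ℂ) (ft u)] with ξ h1 h2
        rw [h1, h2]
        by_cases hξ : ξ ∈ {ξ | energy (comps a) ξ ≤ t}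
        · rw [Set.indicator_of_mem hξ]
          simp only [smul_apply, ContinuousLinearMap.id_apply, Pi.smul_apply, norm_smul,
            Complex.norm_real, Real.norm_eq_abs]
          refine mul_le_mul_of_nonneg_right ?_ (norm_nonneg _)
          rw [abs_of_nonneg (energy_nonneg _ _)]
          exact le_trans hξ (le_abs_self t)
        · rw [Set.indicator_of_notMem hξ, map_zero, norm_zero]
          exact norm_nonneg _
    rw [← graph_laplacian_const] at hg
    exact mem_domain_of_graph hg
  · intro u w h hu
    rw [graph_laplacian_const] at h
    rw [(hinner h).1, (hnorm u).1]
    refine integral_mono_ae (hinner h).2 (hnorm u).2 ?_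
    have hmem : u ∈ bandlimited {ξ | energy (comps a) ξ ≤ t} := by
      rw [← hu]
      exact Submodule.starProjection_apply_mem _ _
    filter_upwards [mem_suppIn.1 (mem_bandlimited.1 hmem)] with ξ h1
    by_cases hξ : ξ ∈ {ξ | energy (comps a) ξ ≤ t}
    · exact mul_le_mul_of_nonneg_right hξ (by positivity)
    · simp [h1 hξ]
  · intro u w h hu hu0
    rw [graph_laplacian_const] at h
    rw [(hinner h).1, (hnorm u).1]
    have hz : ∀ᵐ ξ, ξ ∈ {ξ | energy (comps a) ξ ≤ t} → ft u ξ = 0 := by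
      have h1 := ft_starProjection hm u
      rw [hu, map_zero] at h1
      have h2 := restrictTo_coe hm (ft u)
      rw [← h1] at h2
      filter_upwards [h2, Lp.coeFn_zero (Coeff n j) 2 (volume : Measure (V n))] with ξ h3 h4 hξ
      rw [Set.indicator_of_mem (s := {ξ | energy (comps a) ξ ≤ t}) hξ, h4] at h3
      exact h3.symm
    have hle : (fun ξ => t * ‖ft u ξ‖ ^ 2) ≤ᵐ[volume] fun ξ => energy (comps a) ξ * ‖ft u ξ‖ ^ 2 := by
      filter_upwards [hz] with ξ h1
      by_cases hξ : ξ ∈ {ξ | energy (comps a) ξ ≤ t}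
      · simp [h1 hξ]
      · exact mul_le_mul_of_nonneg_right (le_of_lt (not_le.1 hξ)) (by positivity)
    refine lt_of_le_of_ne (integral_mono_ae (hnorm u).2 (hinner h).2 hle) fun heq => hu0 ?_
    -- Equal integrals of ordered integrands force equality almost everywhere, so `û` vanishes also
    -- where the energy exceeds `t`.
    have := (integral_eq_iff_of_ae_le (hnorm u).2 (hinner h).2 hle).1 heq
    rw [← (ft : L2Form n j ≃ₗᵢ[ℂ] L2Form n j).map_eq_zero_iff]
    apply Lp.ext
    filter_upwards [this, hz, Lp.coeFn_zero (Coeff n j) 2 (volume : Measure (V n))] with ξ h1 h2 h3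
    rw [h3]
    by_cases hξ : ξ ∈ {ξ | energy (comps a) ξ ≤ t}
    · exact h2 hξ
    · have h4 : t < energy (comps a) ξ := not_le.1 hξ
      have h5 : (energy (comps a) ξ - t) * ‖ft u ξ‖ ^ 2 = 0 := by linarith
      have h6 := (mul_eq_zero.1 h5).resolve_left (by linarith)
      simpa using h6

theorem spectralFamily_const (a : V n →L[ℝ] ℝ) {t : ℝ} (ht : 0 < t)
    [(bandlimited {ξ | energy (comps a) ξ ≤ t} : Submodule ℂ (L2Form n j)).HasOrthogonalProjection] :
    spectralFamily (laplacian (fun _ => a) j) t =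
      (bandlimited {ξ | energy (comps a) ξ ≤ t}).starProjection := by
  obtain ⟨R, hR⟩ := (isHilbertComplex_const a j).exists_isNonnegResolvent
  rw [← laplacian_eq_hodge] at hR
  exact IsCut.unique hR ht (hR.isCut_spectralFamily t) (isCut_bandlimited a t)

/-- Below `‖a‖²` the set of admissible frequencies is empty. -/
theorem spectralDistribution_const_eq_zero (a : V n →L[ℝ] ℝ) {t : ℝ} (ht : 0 < t)
    (hta : t < ‖a‖ ^ 2) : spectralDistribution b (fun _ => a) j t = 0 := by
  have hm : MeasurableSet {ξ | energy (comps a) ξ ≤ t} :=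
    (isClosed_le (continuous_energy _) continuous_const).measurableSet
  have := bandlimited_hasOrthogonalProjection (j := j) hm
  rw [spectralDistribution, spectralFamily_const a ht, ← vnTrace_zero (b := b) (j := j)]
  congr 1
  ext1 u
  change _ = (0 : L2Form n j)
  rw [← (ft : L2Form n j ≃ₗᵢ[ℂ] L2Form n j).map_eq_zero_iff, ft_starProjection hm]
  apply Lp.ext
  filter_upwards [restrictTo_coe hm (ft u),
    Lp.coeFn_zero (Coeff n j) 2 (volume : Measure (V n))] with ξ h1 h2
  rw [h1, h2, Set.indicator_of_notMem]
  · rfl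
  · change ¬ energy (comps a) ξ ≤ t
    rw [not_le, energy_eq]
    have : 0 ≤ 4 * Real.pi ^ 2 * ‖ξ‖ ^ 2 := by positivity
    linarith

end FourierCut

end TwistedL2

namespace TwistedL2

open scoped FourierTransform SchwartzMap

/-! ### The Fourier integral of compactly localised `L²` forms -/

section FourierIntegral

variable {n j : ℕ}

theorem continuous_fourier {E : Type*} [NormedAddCommGroup E] [NormedSpace ℂ E] {f : V n → E}
    (hf : Integrable f) : Continuous (𝓕 f) :=
  VectorFourier.fourierIntegral_continuous Real.continuous_fourierChar
    (L := innerₗ (V n)) (by exact continuous_inner) hf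

theorem norm_fourier_le {E : Type*} [NormedAddCommGroup E] [NormedSpace ℂ E] (f : V n → E)
    (ξ : V n) : ‖𝓕 f ξ‖ ≤ ∫ x, ‖f x‖ :=
  VectorFourier.norm_fourierIntegral_le_integral_norm _ _ _ _ _

theorem integral_inner_fourier {E : Type*} [NormedAddCommGroup E] [InnerProductSpace ℂ E]
    [CompleteSpace E] {f : V n → E} (hf : Integrable f) (φ : 𝓢(V n, E)) :
    ∫ ξ, inner ℂ (𝓕 φ ξ) (𝓕 f ξ) = ∫ x, inner ℂ (φ x) (f x) := by
  have key := VectorFourier.integral_sesq_fourierIntegral_eq_neg_flip (μ := volume) (ν := volume)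
    (f := f) (g := (𝓕 φ : 𝓢(V n, E))) (innerSL ℂ) (L := innerₗ (V n)) Real.continuous_fourierChar
    (by exact continuous_inner) hf (𝓕 φ : 𝓢(V n, E)).integrable
  have e1 : ∀ x, VectorFourier.fourierIntegral Real.fourierChar volume (-(innerₗ (V n)).flip)
      (𝓕 φ : 𝓢(V n, E)) x = φ x := by
    intro x
    rw [flip_innerₗ]
    have : 𝓕⁻ (𝓕 φ : 𝓢(V n, E)) x = φ x := by simp
    rw [SchwartzMap.fourierInv_coe] at this
    exact this
  have e2 : ∀ ξ, VectorFourier.fourierIntegral Real.fourierChar volume (innerₗ (V n)) f ξ =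
    𝓕 f ξ := fun ξ => rfl
  simp only [e1, e2, innerSL_apply_apply] at key
  have h := congrArg (starRingEnd ℂ) key
  rw [← integral_conj, ← integral_conj] at h
  simpa only [inner_conj_symm] using h

theorem integrable_inner_fourier {E : Type*} [NormedAddCommGroup E] [InnerProductSpace ℂ E]
    [CompleteSpace E] {f : V n → E} (hf : Integrable f) (φ : 𝓢(V n, E)) :
    Integrable fun ξ => inner ℂ (𝓕 φ ξ) (𝓕 f ξ) := by
  have hφ : Integrable (fun ξ => 𝓕 φ ξ) volume := (𝓕 φ : 𝓢(V n, E)).integrable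
  refine (hφ.norm.mul_const (∫ x, ‖f x‖)).mono'
    (hφ.aestronglyMeasurable.inner (continuous_fourier hf).aestronglyMeasurable)
    (Eventually.of_forall fun ξ => ?_)
  refine (norm_inner_le_norm _ _).trans ?_
  gcongr
  exact norm_fourier_le _ _

theorem inner_sub_fourier {E : Type*} [NormedAddCommGroup E] [InnerProductSpace ℂ E]
    [CompleteSpace E] {f : V n → E} (hf : Integrable f) (φ : 𝓢(V n, E))
    {P : Lp E 2 (volume : Measure (V n))} (hP : P =ᵐ[volume] (𝓕 φ : 𝓢(V n, E)))
    (G : Lp E 2 (volume : Measure (V n))) :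
    Integrable (fun ξ => inner ℂ (𝓕 φ ξ) (G ξ - 𝓕 f ξ)) ∧
      ∫ ξ, inner ℂ (𝓕 φ ξ) (G ξ - 𝓕 f ξ) = inner ℂ P G - ∫ x, inner ℂ (φ x) (f x) := by
  have hae : (fun ξ => inner ℂ (𝓕 φ ξ) (G ξ)) =ᵐ[volume] fun ξ => inner ℂ (P ξ) (G ξ) := by
    filter_upwards [hP] with ξ h1
    rw [h1]
  have hi1 : Integrable fun ξ => inner ℂ (𝓕 φ ξ) (G ξ) :=
    (L2.integrable_inner (𝕜 := ℂ) P G).congr hae.symm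
  have hi2 := integrable_inner_fourier hf φ
  simp only [inner_sub_right]
  refine ⟨hi1.sub hi2, ?_⟩
  rw [integral_sub hi1 hi2, integral_congr_ae hae, integral_inner_fourier hf, ← L2.inner_def]

theorem inner_toLp_eq {E : Type*} [NormedAddCommGroup E] [InnerProductSpace ℂ E]
    [CompleteSpace E] (φ : 𝓢(V n, E)) (f : Lp E 2 (volume : Measure (V n))) :
    inner ℂ (φ.toLp 2) f = ∫ x, inner ℂ (φ x) (f x) := by
  rw [L2.inner_def]
  refine integral_congr_ae ?_
  filter_upwards [SchwartzMap.coeFn_toLp φ 2 volume] with x hx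
  rw [hx]

/-- On integrable functions the `L²` Fourier transform is given by the Fourier integral. -/
theorem ft_eq_fourier {f : L2Form n j} (hf : Integrable f) :
    ft f =ᵐ[volume] 𝓕 (f : V n → Coeff n j) := by
  have key : ∀ᵐ ξ, ft f ξ - 𝓕 (f : V n → Coeff n j) ξ = 0 := by
    refine ae_eq_zero_of_forall_test
      (fun φ _ => (inner_sub_fourier hf φ (ft_toLp φ) (ft f)).1) fun φ _ => ?_
    rw [(inner_sub_fourier hf φ (ft_toLp φ) (ft f)).2, LinearIsometryEquiv.inner_map_map,
      inner_toLp_eq, sub_self]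
  filter_upwards [key] with ξ hξ
  exact sub_eq_zero.1 hξ

theorem integrable_of_mem_suppIn {F : Set (V n)} (hF : MeasurableSet F) (hF' : volume F ≠ ∞)
    {f : L2Form n j} (hf : f ∈ suppIn F) : Integrable f := by
  have h1 : MemLp f 1 (volume.restrict F) := by
    have : IsFiniteMeasure (volume.restrict F) := ⟨by simpa using hF'.lt_top⟩
    exact ((Lp.memLp f).restrict F).mono_exponent (by norm_num)
  have h2 : IntegrableOn f F := memLp_one_iff_integrable.1 h1
  refine ((integrable_indicator_iff hF).2 h2).congr ?_
  filter_upwards [mem_suppIn.1 hf] with x hx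
  by_cases h : x ∈ F <;> simp [h, hx]

end FourierIntegral

/-! ### Plane waves on the fundamental domain -/

section Waves

variable {n j : ℕ} {F : Set (V n)}

theorem memLp_wave (hF : MeasurableSet F) (hF' : volume F ≠ ∞) (ξ : V n) (c : Coeff n j) :
    MemLp (F.indicator fun x => (Real.fourierChar (inner ℝ x ξ) : ℂ) • c) 2 volume := by
  refine (memLp_indicator_const 2 hF c (Or.inr hF')).of_le ?_ (Eventually.of_forall fun x => ?_)
  · have : Continuous fun x : V n => (Real.fourierChar (inner ℝ x ξ) : ℂ) • c := by fun_prop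
    exact this.aestronglyMeasurable.indicator hF
  · by_cases h : x ∈ F
    · rw [Set.indicator_of_mem h, Set.indicator_of_mem h, norm_smul, Circle.norm_coe, one_mul]
    · simp [h]

/-- The plane wave with frequency `ξ` restricted to `F`. -/
noncomputable def wave (hF : MeasurableSet F) (hF' : volume F ≠ ∞) (ξ : V n) (c : Coeff n j) :
    L2Form n j := (memLp_wave hF hF' ξ c).toLp _

theorem wave_mem (hF : MeasurableSet F) (hF' : volume F ≠ ∞) (ξ : V n) (c : Coeff n j) :
    wave hF hF' ξ c ∈ suppIn F := by
  filter_upwards [(memLp_wave hF hF' ξ c).coeFn_toLp] with x hx hxF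
  change (memLp_wave hF hF' ξ c).toLp _ x = 0
  rw [hx, Set.indicator_of_notMem hxF]

theorem inner_wave (hF : MeasurableSet F) (hF' : volume F ≠ ∞) (ξ : V n) (c : Coeff n j)
    {f : L2Form n j} (hf : f ∈ suppIn F) :
    inner ℂ (wave hF hF' ξ c) f = inner ℂ c (𝓕 (f : V n → Coeff n j) ξ) := by
  have hi := integrable_of_mem_suppIn hF hF' hf
  rw [Real.fourier_eq]
  have h2 : Integrable fun x => Real.fourierChar (-inner ℝ x ξ) • f x :=
    (Real.fourierIntegral_convergent_iff ξ).2 hi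
  have h1 := (innerSL ℂ c).integral_comp_comm h2
  simp only [innerSL_apply_apply] at h1
  rw [← h1, L2.inner_def]
  refine integral_congr_ae ?_
  filter_upwards [(memLp_wave hF hF' ξ c).coeFn_toLp, hf] with x h3 h4
  change inner ℂ ((memLp_wave hF hF' ξ c).toLp _ x) _ = _
  rw [h3]
  by_cases h : x ∈ F
  · rw [Set.indicator_of_mem h, inner_smul_left, Circle.smul_def, inner_smul_right,
      ← Circle.coe_inv_eq_conj, AddChar.map_neg_eq_inv]
  · rw [h4 h]
    simp

theorem ofReal_norm_wave_sq (hF : MeasurableSet F) (hF' : volume F ≠ ∞) (ξ : V n) (c : Coeff n j) :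
    ENNReal.ofReal (‖wave hF hF' ξ c‖ ^ 2) = ‖c‖ₑ ^ 2 * volume F := by
  rw [ofReal_norm_sq, ← lintegral_indicator_const hF]
  refine lintegral_congr_ae ?_
  filter_upwards [(memLp_wave hF hF' ξ c).coeFn_toLp] with x hx
  change ‖(memLp_wave hF hF' ξ c).toLp _ x‖ₑ ^ 2 = _
  rw [hx]
  by_cases h : x ∈ F
  · rw [Set.indicator_of_mem h, Set.indicator_of_mem h, ← ofReal_norm, norm_smul, Circle.norm_coe,
      one_mul, ofReal_norm]
  · simp [h]

/-- Bessel's inequality for the Fourier integrals of orthonormal families supported in `F`. -/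
theorem sum_enorm_fourier_sq_le (hF : MeasurableSet F) (hF' : volume F ≠ ∞) (ξ : V n)
    {s : Finset (L2Form n j)} (hs : Orthonormal ℂ (fun e : s => (e : L2Form n j)))
    (hsF : ∀ e ∈ s, e ∈ suppIn F) :
    ∑ e ∈ s, ‖𝓕 (e : V n → Coeff n j) ξ‖ₑ ^ 2 ≤ Fintype.card (MultiIndex n j) * volume F := by
  let B := EuclideanSpace.basisFun (MultiIndex n j) ℂ
  -- Each coordinate of the Fourier integral at `ξ` is an inner product with a plane wave on `F`,
  -- whose squared norm is the volume of `F`.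
  have h1 : ∀ e ∈ s, ‖𝓕 (e : V n → Coeff n j) ξ‖ₑ ^ 2 =
      ∑ I, ENNReal.ofReal (‖inner ℂ e (wave hF hF' ξ (B I))‖ ^ 2) := by
    intro e he
    rw [← ofReal_norm, ← ENNReal.ofReal_pow (norm_nonneg _), ← B.sum_sq_norm_inner_right,
      ENNReal.ofReal_sum_of_nonneg fun _ _ => by positivity]
    refine Finset.sum_congr rfl fun I _ => ?_
    rw [← inner_wave hF hF' ξ (B I) (hsF e he), ← inner_conj_symm, RCLike.norm_conj]
  rw [Finset.sum_congr rfl h1, Finset.sum_comm]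
  have h2 : ∀ I, ∑ e ∈ s, ENNReal.ofReal (‖inner ℂ e (wave hF hF' ξ (B I))‖ ^ 2) ≤ volume F := by
    intro I
    have := tsum_ofReal_inner_le hs (wave hF hF' ξ (B I))
    rw [ofReal_norm_wave_sq, tsum_fintype, Finset.sum_coe_sort s fun e =>
      ENNReal.ofReal (‖inner ℂ e (wave hF hF' ξ (B I))‖ ^ 2)] at this
    have h3 : ‖B I‖ₑ = 1 := by rw [← ofReal_norm, B.norm_eq_one]; simp
    rwa [h3, one_pow, one_mul] at this
  refine (Finset.sum_le_sum fun I _ => h2 I).trans ?_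
  rw [Finset.sum_const, nsmul_eq_mul, Finset.card_univ]

end Waves

/-! ### Upper and lower bounds for the trace of frequency cutoffs -/

section TraceBounds

variable {n j : ℕ} (b : Module.Basis (Fin n) ℝ (V n))

theorem ofReal_inner_bandlimited {B : Set (V n)} (hB : MeasurableSet B)
    [(bandlimited B : Submodule ℂ (L2Form n j)).HasOrthogonalProjection] {e : L2Form n j}
    (he : Integrable e) : ENNReal.ofReal (inner ℂ e ((bandlimited B).starProjection e)).re =
      ∫⁻ ξ in B, ‖𝓕 (e : V n → Coeff n j) ξ‖ₑ ^ 2 := by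
  have hP : IsStarProjection (bandlimited B : Submodule ℂ (L2Form n j)).starProjection :=
    isStarProjection_starProjection
  rw [← hP.apply_apply, ← hP.inner_apply, re_inner_self, ← ft.norm_map, ft_starProjection hB,
    ofReal_norm_restrictTo]
  refine lintegral_congr_ae ?_
  filter_upwards [ae_restrict_of_ae (ft_eq_fourier he)] with ξ hξ
  rw [hξ]

theorem volume_fundamentalDomain_ne_top : volume (ZSpan.fundamentalDomain b) ≠ ∞ :=
  (ZSpan.fundamentalDomain_isBounded b).measure_lt_top.ne

/-- Each partial trace is the integral over `B` of `∑ ‖𝓕 e ξ‖²`, which Bessel's inequality bounds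
uniformly in `ξ`. -/
theorem vnTrace_bandlimited_le {B : Set (V n)} (hB : MeasurableSet B)
    [(bandlimited B : Submodule ℂ (L2Form n j)).HasOrthogonalProjection] :
    vnTrace b (bandlimited B : Submodule ℂ (L2Form n j)).starProjection ≤
      Fintype.card (MultiIndex n j) * volume (ZSpan.fundamentalDomain b) * volume B := by
  have hF := ZSpan.fundamentalDomain_measurableSet b
  have hF' := volume_fundamentalDomain_ne_top b
  refine iSup_le fun s => iSup_le fun hs => iSup_le fun hsF => ?_
  have hi : ∀ e ∈ s, Integrable e := fun e he => integrable_of_mem_suppIn hF hF' (hsF e he)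
  rw [Finset.sum_congr rfl fun e he => ofReal_inner_bandlimited hB (hi e he)]
  calc _ = ∫⁻ ξ in B, ∑ e ∈ s, ‖𝓕 (e : V n → Coeff n j) ξ‖ₑ ^ 2 := by
        rw [lintegral_finsetSum' _ fun e he =>
          ((continuous_fourier (hi e he)).enorm.measurable.pow_const 2).aemeasurable]
    _ ≤ ∫⁻ _ in B, Fintype.card (MultiIndex n j) * volume (ZSpan.fundamentalDomain b) :=
        lintegral_mono fun ξ => sum_enorm_fourier_sq_le hF hF' ξ hs hsF
    _ = _ := by rw [setLIntegral_const]

/-- A unit form supported in the fundamental domain whose Fourier transform does not vanish near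
the origin gives a lower bound for the trace of low frequency projections. -/
theorem exists_le_vnTrace_bandlimited (hj : j ≤ n) : ∃ (c : ℝ≥0) (r : ℝ), 0 < c ∧ 0 < r ∧
    ∀ B : Set (V n), MeasurableSet B → B ⊆ Metric.ball 0 r →
      ∀ [(bandlimited B : Submodule ℂ (L2Form n j)).HasOrthogonalProjection],
        c * volume B ≤ vnTrace b (bandlimited B : Submodule ℂ (L2Form n j)).starProjection := by
  have hF := ZSpan.fundamentalDomain_measurableSet b
  have hF' := volume_fundamentalDomain_ne_top b
  have hF0 : volume (ZSpan.fundamentalDomain b) ≠ 0 := ZSpan.measure_fundamentalDomain_ne_zero b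
  let I : MultiIndex n j := Fin.castLEOrderEmb hj
  let c := EuclideanSpace.basisFun (MultiIndex n j) ℂ I
  have hc : ‖c‖ = 1 := (EuclideanSpace.basisFun (MultiIndex n j) ℂ).norm_eq_one I
  -- The constant form `c` cut off to the fundamental domain; the Fourier integral at the origin of
  -- its normalisation `e` pairs with `c` to `‖f‖ > 0`, and stays above `‖f‖ / 2` nearby.
  let f : L2Form n j := wave hF hF' 0 c
  have hf0 : 0 < ‖f‖ := by
    refine norm_pos_iff.2 fun h0 => hF0 ?_
    have := ofReal_norm_wave_sq hF hF' 0 c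
    rw [← ofReal_norm, hc] at this
    have h0' : wave hF hF' 0 c = 0 := h0
    simpa [h0'] using this.symm
  let e : L2Form n j := ((‖f‖⁻¹ : ℝ) : ℂ) • f
  have heF : e ∈ suppIn (ZSpan.fundamentalDomain b) :=
    Submodule.smul_mem _ _ (wave_mem hF hF' 0 c)
  have hen : ‖e‖ = 1 := by
    rw [norm_smul, Complex.norm_real, norm_inv, norm_norm, inv_mul_cancel₀ hf0.ne']
  have hei := integrable_of_mem_suppIn hF hF' heF
  have h0 : ‖f‖ ≤ ‖𝓕 (e : V n → Coeff n j) 0‖ := by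
    have h1 := inner_wave hF hF' 0 c heF
    have h2 : inner ℂ (wave hF hF' 0 c) e = ((‖f‖ : ℝ) : ℂ) := by
      change inner ℂ f _ = _
      rw [inner_smul_right, inner_self_eq_norm_sq_to_K]
      change ((‖f‖⁻¹ : ℝ) : ℂ) * ((‖f‖ : ℝ) : ℂ) ^ 2 = _
      rw [← Complex.ofReal_pow, ← Complex.ofReal_mul]
      congr 1
      field_simp
    have h3 := norm_inner_le_norm (𝕜 := ℂ) c (𝓕 (e : V n → Coeff n j) 0)
    rwa [← h1, h2, hc, one_mul, Complex.norm_real, norm_norm] at h3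
  have hev : ∀ᶠ ξ in 𝓝 (0 : V n), ‖f‖ / 2 < ‖𝓕 (e : V n → Coeff n j) ξ‖ :=
    (continuous_fourier hei).norm.continuousAt.eventually
      (lt_mem_nhds (lt_of_lt_of_le (half_lt_self hf0) h0))
  obtain ⟨r, hr, hball⟩ := Metric.eventually_nhds_iff_ball.1 hev
  refine ⟨Real.toNNReal ((‖f‖ / 2) ^ 2), r, Real.toNNReal_pos.2 (by positivity), hr,
    fun B hB hBr _ => ?_⟩
  have hs : Orthonormal ℂ (fun e' : ({e} : Finset (L2Form n j)) => (e' : L2Form n j)) := by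
    refine ⟨fun e' => ?_, fun x y hxy => ?_⟩
    · change ‖(e' : L2Form n j)‖ = 1
      rw [Finset.mem_singleton.1 e'.2, hen]
    · exact (hxy (Subtype.ext ((Finset.mem_singleton.1 x.2).trans
        (Finset.mem_singleton.1 y.2).symm))).elim
  refine le_iSup_of_le {e} (le_iSup_of_le hs (le_iSup_of_le (fun e' he' => ?_) ?_))
  · rw [Finset.mem_singleton.1 he']
    exact heF
  · rw [Finset.sum_singleton, ofReal_inner_bandlimited hB hei, ← setLIntegral_const]
    refine setLIntegral_mono' hB fun ξ hξ => ?_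
    change ENNReal.ofReal _ ≤ _
    rw [← ofReal_norm, ← ENNReal.ofReal_pow (norm_nonneg _)]
    refine ENNReal.ofReal_le_ofReal ?_
    have := hball ξ (hBr hξ)
    gcongr

theorem energy_zero_le_iff {t : ℝ} (ht : 0 ≤ t) (ξ : V n) :
    energy (comps (0 : V n →L[ℝ] ℝ)) ξ ≤ t ↔ ‖ξ‖ ≤ √t / (2 * Real.pi) := by
  rw [energy_eq, norm_zero, le_div_iff₀ (by positivity), Real.le_sqrt (by positivity) ht]
  constructor <;> intro h <;> nlinarith

/-- The set is a ball of radius `√t / 2π`; this is where the exponent `n/2` comes from. -/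
theorem volume_lowEnergy {t : ℝ} (ht : 0 < t) :
    volume {ξ : V n | energy (comps (0 : V n →L[ℝ] ℝ)) ξ ≤ t} =
      ENNReal.ofReal (t ^ ((n : ℝ) / 2)) *
        (ENNReal.ofReal (((2 * Real.pi) ^ n)⁻¹) * volume (Metric.ball (0 : V n) 1)) := by
  have h1 : {ξ : V n | energy (comps (0 : V n →L[ℝ] ℝ)) ξ ≤ t} =
      Metric.closedBall 0 (√t / (2 * Real.pi)) := by
    ext ξ
    rw [mem_closedBall_zero_iff]
    exact energy_zero_le_iff ht.le ξ
  have h2 : (√t / (2 * Real.pi)) ^ n = t ^ ((n : ℝ) / 2) * ((2 * Real.pi) ^ n)⁻¹ := by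
    rw [div_pow, div_eq_mul_inv, Real.sqrt_eq_rpow, ← Real.rpow_natCast, ← Real.rpow_mul ht.le]
    congr 2
    ring
  rw [h1, Measure.addHaar_closedBall _ _ (by positivity), finrank_euclideanSpace_fin, h2,
    ENNReal.ofReal_mul (by positivity), mul_assoc]

theorem volConst_ne (n : ℕ) : ENNReal.ofReal (((2 * Real.pi) ^ n)⁻¹) *
    volume (Metric.ball (0 : V n) 1) ≠ ∞ ∧ ENNReal.ofReal (((2 * Real.pi) ^ n)⁻¹) *
    volume (Metric.ball (0 : V n) 1) ≠ 0 :=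
  ⟨ENNReal.mul_ne_top ENNReal.ofReal_ne_top measure_ball_lt_top.ne,
    mul_ne_zero (by simp only [ne_eq, ENNReal.ofReal_eq_zero, not_le]; positivity)
      (Metric.measure_ball_pos _ _ one_pos).ne'⟩

theorem measurableSet_lowEnergy (p : Fin n → ℂ) (t : ℝ) : MeasurableSet {ξ | energy p ξ ≤ t} :=
  (isClosed_le (continuous_energy _) continuous_const).measurableSet

theorem exists_spectralDistribution_zero_le (j : ℕ) : ∃ C : ℝ≥0, ∀ t, 0 < t →
    spectralDistribution b (fun _ => 0) j t ≤ C * ENNReal.ofReal (t ^ ((n : ℝ) / 2)) := by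
  set K := ENNReal.ofReal (((2 * Real.pi) ^ n)⁻¹) * volume (Metric.ball (0 : V n) 1) with hK
  have hfin : Fintype.card (MultiIndex n j) * volume (ZSpan.fundamentalDomain b) * K ≠ ∞ :=
    ENNReal.mul_ne_top (ENNReal.mul_ne_top (ENNReal.natCast_ne_top _)
      (volume_fundamentalDomain_ne_top b)) (volConst_ne n).1
  refine ⟨(Fintype.card (MultiIndex n j) * volume (ZSpan.fundamentalDomain b) * K).toNNReal,
    fun t ht => ?_⟩
  have hm := measurableSet_lowEnergy (comps (0 : V n →L[ℝ] ℝ)) t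
  have := bandlimited_hasOrthogonalProjection (j := j) hm
  rw [ENNReal.coe_toNNReal hfin, spectralDistribution, spectralFamily_const 0 ht]
  refine (vnTrace_bandlimited_le b hm).trans (le_of_eq ?_)
  rw [volume_lowEnergy ht]
  ring

theorem exists_le_spectralDistribution_zero (hj : j ≤ n) : ∃ c : ℝ≥0, 0 < c ∧
    ∀ᶠ t in 𝓝[>] (0 : ℝ), c * ENNReal.ofReal (t ^ ((n : ℝ) / 2)) ≤
      spectralDistribution b (fun _ => 0) j t := by
  obtain ⟨c, r, hc, hr, h⟩ := exists_le_vnTrace_bandlimited b hj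
  set K := ENNReal.ofReal (((2 * Real.pi) ^ n)⁻¹) * volume (Metric.ball (0 : V n) 1) with hK
  refine ⟨c * K.toNNReal, mul_pos hc (ENNReal.toNNReal_pos (volConst_ne n).2 (volConst_ne n).1), ?_⟩
  have hlim : Tendsto (fun t : ℝ => √t / (2 * Real.pi)) (𝓝[>] 0) (𝓝 0) := by
    have : Tendsto (fun t : ℝ => √t / (2 * Real.pi)) (𝓝 0) (𝓝 (√0 / (2 * Real.pi))) :=
      (Real.continuous_sqrt.div_const _).tendsto 0
    rw [Real.sqrt_zero, zero_div] at this
    exact this.mono_left nhdsWithin_le_nhds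
  filter_upwards [hlim.eventually (gt_mem_nhds hr), self_mem_nhdsWithin] with t htr ht
  have ht : 0 < t := ht
  have hm := measurableSet_lowEnergy (comps (0 : V n →L[ℝ] ℝ)) t
  have := bandlimited_hasOrthogonalProjection (j := j) hm
  rw [spectralDistribution, spectralFamily_const 0 ht]
  refine le_trans (le_of_eq ?_) (h _ hm fun ξ hξ => ?_)
  · rw [volume_lowEnergy ht, ENNReal.coe_mul, ENNReal.coe_toNNReal (volConst_ne n).1]
    ring
  · rw [mem_ball_zero_iff]
    exact lt_of_le_of_lt ((energy_zero_le_iff ht.le ξ).1 hξ) htr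

end TraceBounds

end TwistedL2

namespace TwistedL2

/-! ### Closed and harmonic 1-forms on the torus -/

section PeriodicForms

variable {n : ℕ} {b : Module.Basis (Fin n) ℝ (V n)} {θ : OneForm n} {a : V n →L[ℝ] ℝ} {φ : V n → ℝ}

theorem IsExact.exists_isDecomposition (h : IsExact b θ) : ∃ φ, IsDecomposition b θ 0 φ := by
  obtain ⟨f, h1, h2, h3⟩ := h
  exact ⟨f, h1, h2, fun x => by rw [h3, zero_add]⟩

theorem IsDecomposition.isExact (h : IsDecomposition b θ 0 φ) : IsExact b θ :=
  ⟨φ, h.smooth, h.periodic, fun x => by rw [h.eq, zero_add]⟩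

/-- A closed form on the torus is the sum of a constant form and an exact form. -/
theorem IsClosedOneForm.exists_isDecomposition (hθ : IsClosedOneForm b θ) :
    ∃ a φ, IsDecomposition b θ a φ := by
  -- Poincaré lemma: a primitive exists on `ℝⁿ`, though it need not be periodic.
  obtain ⟨f, hf⟩ := convex_univ.exists_forall_hasFDerivAt_of_fderiv_symmetric isOpen_univ
    (hθ.smooth.differentiable (by simp)).differentiableOn fun x _ u v => hθ.closed x u v
  have hf : ∀ x, HasFDerivAt f (θ x) x := fun x => hf x (Set.mem_univ x)
  have hfs : ContDiff ℝ (⊤ : ℕ∞) f := by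
    refine contDiff_infty_iff_fderiv.2 ⟨fun x => (hf x).differentiableAt, ?_⟩
    rw [show fderiv ℝ f = θ from funext fun x => (hf x).fderiv]
    exact hθ.smooth
  have hconst : ∀ v ∈ Submodule.span ℤ (Set.range b), ∀ x, f (x + v) = f x + (f v - f 0) := by
    intro v hv x
    have hd : ∀ x, HasFDerivAt (fun x => f (x + v) - f x) (0 : V n →L[ℝ] ℝ) x := by
      intro x
      have h1 := ((hasFDerivAt_comp_add_right v).2 (hf (x + v))).sub (hf x)
      rwa [hθ.periodic v hv, sub_self] at h1
    have := is_const_of_fderiv_eq_zero (fun x => (hd x).differentiableAt)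
      (fun x => (hd x).fderiv) x 0
    simp only [zero_add] at this
    linarith
  -- The increments of `f` under lattice vectors do not depend on the point; `a` is the linear map
  -- with the same increments on the basis, hence on the whole lattice, so `f - a` is periodic.
  let a : V n →L[ℝ] ℝ :=
    LinearMap.toContinuousLinearMap (b.constr ℝ fun i => f (b i) - f 0)
  have ha : ∀ i, a (b i) = f (b i) - f 0 := fun i => b.constr_basis ℝ _ i
  have hper : ∀ v ∈ Submodule.span ℤ (Set.range b), ∀ x, f (x + v) = f x + a v := by
    intro v hv
    rw [← Submodule.mem_toAddSubgroup, Submodule.span_int_eq_addSubgroupClosure] at hv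
    induction hv using AddSubgroup.closure_induction with
    | mem v hv =>
      obtain ⟨i, rfl⟩ := hv
      intro x
      rw [hconst _ (Submodule.subset_span ⟨i, rfl⟩), ha]
    | zero => simp
    | add u v _ _ hu hv =>
      intro x
      rw [← add_assoc, hv, hu, map_add, add_assoc]
    | neg v _ hv =>
      intro x
      have := hv (x + -v)
      rw [neg_add_cancel_right] at this
      rw [map_neg]
      linarith
  refine ⟨a, fun x => f x - a x, hfs.sub a.contDiff, fun v hv x => ?_, fun x => ?_⟩
  · simp only [hper v hv, map_add]
    ring
  · have h1 : HasFDerivAt (fun x => f x - a x) (θ x - a) x := (hf x).sub a.hasFDerivAt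
    rw [h1.fderiv, add_sub_cancel]

theorem IsPeriodic.fderiv_add_right {f : V n → ℝ} (hf : IsPeriodic b f) : IsPeriodic b (fderiv ℝ f) := by
  intro v hv x
  rw [← fderiv_comp_add_right]
  congr 1
  exact funext fun y => hf v hv y

/-- A translate of a fundamental domain is again a fundamental domain. -/
theorem IsPeriodic.setIntegral_add_right {f : V n → ℝ} (hf : IsPeriodic b f) (v : V n) :
    ∫ x in ZSpan.fundamentalDomain b, f (x + v) = ∫ x in ZSpan.fundamentalDomain b, f x := by
  have h1 := ZSpan.isAddFundamentalDomain b (volume : Measure (V n))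
  have h2 := h1.vadd_of_comm v
  have h3 := h2.setIntegral_eq h1 (f := f) fun g x => by
    rw [Submodule.vadd_def, vadd_eq_add, add_comm]
    exact hf g g.2 x
  rw [← h3, ← Set.image_vadd]
  change _ = ∫ x in (fun x => v + x) '' ZSpan.fundamentalDomain b, f x
  rw [(measurePreserving_add_left volume v).setIntegral_image_emb
    (MeasurableEquiv.addLeft v).measurableEmbedding]
  simp [add_comm]

/-- The integral of a derivative of a periodic function over a fundamental domain vanishes. -/
theorem IsPeriodic.setIntegral_fderiv_eq_zero {f : V n → ℝ} (hf : IsPeriodic b f)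
    (hs : ContDiff ℝ 1 f) (v : V n) :
    ∫ x in ZSpan.fundamentalDomain b, fderiv ℝ f x v = 0 := by
  have : IsFiniteMeasure (volume.restrict (ZSpan.fundamentalDomain b)) :=
    ⟨by simpa using (volume_fundamentalDomain_ne_top b).lt_top⟩
  have hc : Continuous fun x => fderiv ℝ f x v := (hs.continuous_fderiv one_ne_zero).clm_apply
    continuous_const
  obtain ⟨C, hC⟩ := IsPeriodic.exists_bound (b := b) (φ := fun x => fderiv ℝ f x v)
    (fun u hu x => by dsimp only; rw [hf.fderiv_add_right u hu]) hc
  obtain ⟨D, hD⟩ := hf.exists_bound hs.continuous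
  -- Differentiation under the integral of `t ↦ ∫ f(x + tv)`, which is constant by translation
  -- invariance.
  have key := hasDerivAt_integral_of_dominated_loc_of_deriv_le
    (μ := volume.restrict (ZSpan.fundamentalDomain b))
    (F := fun (t : ℝ) x => f (x + t • v)) (F' := fun (t : ℝ) x => fderiv ℝ f (x + t • v) v)
    (x₀ := 0) (s := Set.univ) (bound := fun _ => C) univ_mem
    (Eventually.of_forall fun t =>
      (hs.continuous.comp (continuous_id.add continuous_const)).aestronglyMeasurable)
    (Integrable.of_bound (hs.continuous.comp
      (continuous_id.add continuous_const)).aestronglyMeasurable D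
      (Eventually.of_forall fun x => hD _))
    (hc.comp (continuous_id.add continuous_const)).aestronglyMeasurable
    (Eventually.of_forall fun x t _ => hC _) (integrable_const C)
    (Eventually.of_forall fun x t _ => by
      have h1 : HasDerivAt (fun t : ℝ => x + t • v) v t := by
        simpa using ((hasDerivAt_id t).smul_const v).const_add x
      exact ((hs.differentiable one_ne_zero) _).hasFDerivAt.comp_hasDerivAt t h1)
  have h2 := key.2
  simp only [hf.setIntegral_add_right, zero_smul, add_zero] at h2
  exact h2.unique (hasDerivAt_const _ _)

/-- A harmonic form on the torus is constant. -/
theorem IsDecomposition.eq_const (h : IsDecomposition b θ a φ) (hθ : IsCoclosed θ) (x : V n) :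
    θ x = a := by
  have hd : ContDiff ℝ (⊤ : ℕ∞) (fderiv ℝ φ) := (contDiff_infty_iff_fderiv.1 h.smooth).2
  have hdφ : ∀ x, DifferentiableAt ℝ φ x := fun x => h.smooth.differentiable (by simp) x
  have hddφ : ∀ x, DifferentiableAt ℝ (fderiv ℝ φ) x := fun x => hd.differentiable (by simp) x
  have hθ' : θ = fun x => a + fderiv ℝ φ x := funext h.eq
  -- Coclosedness makes `φ` harmonic, so the divergence of `φ ∇φ` is `|∇φ|²`; integrated over the
  -- torus it gives zero.
  have hsum : ∀ x, ∑ i : Fin n, fderiv ℝ (fun x => φ x * fderiv ℝ φ x (evec i)) x (evec i) =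
      ‖fderiv ℝ φ x‖ ^ 2 := by
    intro x
    have h1 := hθ x
    rw [hθ', fderiv_const_add] at h1
    have h2 : ∀ i : Fin n, fderiv ℝ (fun x => φ x * fderiv ℝ φ x (evec i)) x (evec i) =
        φ x * fderiv ℝ (fderiv ℝ φ) x (evec i) (evec i) + fderiv ℝ φ x (evec i) ^ 2 := by
      intro i
      have h3 : HasFDerivAt (fun x => fderiv ℝ φ x (evec i))
          ((fderiv ℝ (fderiv ℝ φ) x).flip (evec i)) x :=
        ((ContinuousLinearMap.apply ℝ ℝ (evec i)).hasFDerivAt.comp x (hddφ x).hasFDerivAt)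
      have h4 : HasFDerivAt (fun x => φ x * fderiv ℝ φ x (evec i))
        (φ x • (fderiv ℝ (fderiv ℝ φ) x).flip (evec i) + fderiv ℝ φ x (evec i) • fderiv ℝ φ x) x :=
        (hdφ x).hasFDerivAt.mul h3
      rw [h4.fderiv]
      simp [pow_two]
    rw [Finset.sum_congr rfl fun i _ => h2 i, Finset.sum_add_distrib, ← Finset.mul_sum,
      norm_covector_sq]
    change φ x * (∑ i : Fin n, fderiv ℝ (fderiv ℝ φ) x (evec i) (evec i)) + _ = _
    rw [show ∑ i : Fin n, fderiv ℝ (fderiv ℝ φ) x (evec i) (evec i) = 0 from h1, mul_zero,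
      zero_add]
  have hsm : ∀ i : Fin n, ContDiff ℝ 1 fun x => φ x * fderiv ℝ φ x (evec i) := fun i =>
    (h.smooth.mul (hd.clm_apply contDiff_const)).of_le (by exact_mod_cast le_top)
  have hper : ∀ i : Fin n, IsPeriodic b fun x => φ x * fderiv ℝ φ x (evec i) := fun i v hv x => by
    simp only [h.periodic v hv, h.periodic.fderiv_add_right v hv]
  have : IsFiniteMeasure (volume.restrict (ZSpan.fundamentalDomain b)) :=
    ⟨by simpa using (volume_fundamentalDomain_ne_top b).lt_top⟩
  have hcont : Continuous fun x => ‖fderiv ℝ φ x‖ ^ 2 := hd.continuous.norm.pow 2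
  have hint : ∀ f : V n → ℝ, Continuous f → IsPeriodic b f →
      IntegrableOn f (ZSpan.fundamentalDomain b) := by
    intro f hf hp
    obtain ⟨C, hC⟩ := hp.exists_bound hf
    exact Integrable.of_bound hf.aestronglyMeasurable C (Eventually.of_forall hC)
  have hzero : ∫ x in ZSpan.fundamentalDomain b, ‖fderiv ℝ φ x‖ ^ 2 = 0 := by
    simp only [← hsum]
    rw [integral_finsetSum]
    · exact Finset.sum_eq_zero fun i _ => IsPeriodic.setIntegral_fderiv_eq_zero (hper i) (hsm i) _
    · exact fun i _ => hint _ (((hsm i).continuous_fderiv one_ne_zero).clm_apply continuous_const)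
        fun v hv x => by rw [IsPeriodic.fderiv_add_right (hper i) v hv]
  rw [integral_eq_zero_iff_of_nonneg (fun x => by positivity)
    (hint _ hcont fun v hv x => by rw [h.periodic.fderiv_add_right v hv])] at hzero
  -- Periodicity spreads the vanishing from the fundamental domain to all of `ℝⁿ`.
  have hnull : volume {x | fderiv ℝ φ x ≠ 0} = 0 := by
    refine (ZSpan.isAddFundamentalDomain b volume).measure_zero_of_invariant _ (fun g => ?_) ?_
    · ext x
      rw [Set.mem_vadd_set_iff_neg_vadd_mem, Submodule.vadd_def, vadd_eq_add, add_comm]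
      change fderiv ℝ φ _ ≠ 0 ↔ fderiv ℝ φ x ≠ 0
      rw [h.periodic.fderiv_add_right _ (-g).2]
    · rw [← Measure.restrict_apply₀' (ZSpan.fundamentalDomain_measurableSet b).nullMeasurableSet]
      rw [Filter.EventuallyEq, ae_iff] at hzero
      simpa using hzero
  have hall : fderiv ℝ φ = 0 := by
    refine (hd.continuous.ae_eq_iff_eq volume continuous_zero).1 ?_
    exact ae_iff.2 hnull
  rw [h.eq, hall]
  simp

end PeriodicForms

end TwistedL2

namespace TwistedL2

/-! ### Spectra of scalar Fourier multipliers -/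

section Spectrum

variable {n j : ℕ}

theorem multGraph_unique {W : V n → Coeff n j →L[ℂ] Coeff n j} {f g h : L2Form n j}
    (hg : (f, g) ∈ multGraph W) (hh : (f, h) ∈ multGraph W) : g = h := by
  have := Submodule.sub_mem _ hg hh
  rw [Prod.mk_sub_mk, sub_self] at this
  exact sub_eq_zero.1 (eq_zero_of_mem_multGraph this)

theorem norm_le_of_mem_multGraph {W : V n → Coeff n j →L[ℂ] Coeff n j} {f g : L2Form n j} {C : ℝ}
    (hg : (f, g) ∈ multGraph W) (hC : ∀ᵐ ξ, ‖W ξ (ft f ξ)‖ ≤ C * ‖ft f ξ‖) :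
    ‖g‖ ≤ C * ‖f‖ := by
  rw [← ft.norm_map g, ← ft.norm_map f]
  refine Lp.norm_le_mul_norm_of_ae_le_mul ?_
  filter_upwards [mem_multGraph.1 hg, hC] with ξ h1 h2
  rwa [h1]

theorem exists_mem_multGraph_of_norm_le {W : V n → Coeff n j →L[ℂ] Coeff n j} (hW : Continuous W)
    {f : L2Form n j} {C : ℝ} (hC : ∀ᵐ ξ, ‖W ξ (ft f ξ)‖ ≤ C * ‖ft f ξ‖) :
    ∃ g, (f, g) ∈ multGraph W := by
  refine exists_mem_multGraph (g := (C : ℂ) • ft f) hW ?_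
  filter_upwards [Lp.coeFn_smul (C : ℂ) (ft f), hC] with ξ h1 h2
  rw [h1, Pi.smul_apply, norm_smul, Complex.norm_real, Real.norm_eq_abs]
  exact h2.trans (mul_le_mul_of_nonneg_right (le_abs_self C) (norm_nonneg _))

theorem exists_clm_of_graph {H K : Type*} [NormedAddCommGroup H] [NormedSpace ℂ H]
    [NormedAddCommGroup K] [NormedSpace ℂ K] {G : Submodule ℂ (H × K)} (hG : ∀ f, ∃ g, (f, g) ∈ G)
    {C : ℝ} (hC : ∀ f g, (f, g) ∈ G → ‖g‖ ≤ C * ‖f‖) : ∃ R : H →L[ℂ] K, ∀ f, (f, R f) ∈ G := by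
  choose R hR using hG
  have huniq : ∀ {f g h}, (f, g) ∈ G → (f, h) ∈ G → g = h := by
    intro f g h hg hh
    have h1 : ((0 : H), g - h) ∈ G := by
      have := Submodule.sub_mem _ hg hh
      rwa [Prod.mk_sub_mk, sub_self] at this
    have h2 := hC _ _ h1
    rw [norm_zero, mul_zero] at h2
    exact sub_eq_zero.1 (norm_le_zero_iff.1 h2)
  let L : H →ₗ[ℂ] K :=
    { toFun := R
      map_add' := fun f g => huniq (hR _) (Submodule.add_mem _ (hR f) (hR g))
      map_smul' := fun c f => huniq (hR _) (Submodule.smul_mem _ c (hR f)) }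
  exact ⟨L.mkContinuous C fun f => hC _ _ (hR f), hR⟩

/-- Bounded Fourier multipliers are bounded operators. -/
theorem exists_multiplier {W : V n → Coeff n j →L[ℂ] Coeff n j} (hW : Continuous W) {C : ℝ}
    (hC : ∀ ξ, ‖W ξ‖ ≤ C) : ∃ R : L2Form n j →L[ℂ] L2Form n j, ∀ f, (f, R f) ∈ multGraph W := by
  have hC' : ∀ f : L2Form n j, ∀ᵐ ξ, ‖W ξ (ft f ξ)‖ ≤ C * ‖ft f ξ‖ := fun f =>
    Eventually.of_forall fun ξ => (W ξ).le_of_opNorm_le (hC ξ) _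
  exact exists_clm_of_graph (fun f => exists_mem_multGraph_of_norm_le hW (hC' f))
    fun f g h => norm_le_of_mem_multGraph h (hC' f)

theorem isResolventPoint_of_le {A : L2Form n j →ₗ.[ℂ] L2Form n j} {m : V n → ℝ}
    (hm : Continuous m) (hA : A.graph = scalarGraph m) {z : ℂ} {δ : ℝ} (hδ : 0 < δ)
    (hz : ∀ ξ, δ ≤ ‖(m ξ : ℂ) - z‖) : IsResolventPoint A z := by
  have hne : ∀ ξ, (m ξ : ℂ) - z ≠ 0 := fun ξ => norm_pos_iff.1 (hδ.trans_le (hz ξ))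
  have hmc : Continuous fun ξ => (m ξ : ℂ) - z := by fun_prop
  let W : V n → Coeff n j →L[ℂ] Coeff n j := fun ξ =>
    ((m ξ : ℂ) - z)⁻¹ • ContinuousLinearMap.id ℂ (Coeff n j)
  have hW : Continuous W := (hmc.inv₀ hne).smul continuous_const
  have hC : ∀ ξ, ‖W ξ‖ ≤ δ⁻¹ := by
    intro ξ
    refine ContinuousLinearMap.opNorm_le_bound _ (by positivity) fun x => ?_
    change ‖((m ξ : ℂ) - z)⁻¹ • x‖ ≤ _
    rw [norm_smul, norm_inv]
    gcongr
    exact hz ξ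
  obtain ⟨R, hR⟩ := exists_multiplier hW hC
  have hgraph : ∀ u, (R u, u + z • R u) ∈ A.graph := by
    intro u
    rw [hA, mem_scalarGraph, map_add, map_smul]
    filter_upwards [mem_multGraph.1 (hR u), Lp.coeFn_add (ft u) (z • ft (R u)),
      Lp.coeFn_smul z (ft (R u))] with ξ h1 h2 h3
    have h4 : ft u ξ = ((m ξ : ℂ) - z) • ft (R u) ξ := by
      rw [h1]
      exact (smul_inv_smul₀ (hne ξ) _).symm
    rw [h2, Pi.add_apply, h3, Pi.smul_apply, h4, ← add_smul, sub_add_cancel]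
  refine ⟨R, fun u => ?_, fun u => ?_⟩
  · obtain ⟨y, h1, h2⟩ := LinearPMap.mem_graph_iff _ |>.1 (hgraph u)
    have h1 : (y : L2Form n j) = R u := h1
    have h2 : A y = u + z • R u := h2
    refine ⟨h1 ▸ y.2, ?_⟩
    rw [show (⟨R u, h1 ▸ y.2⟩ : A.domain) = y from Subtype.ext h1.symm, h2, add_sub_cancel_right]
  · refine multGraph_unique (hR _) ?_
    have hu : ((u : L2Form n j), A u) ∈ A.graph := A.mem_graph u
    rw [hA, mem_scalarGraph] at hu
    rw [mem_multGraph, map_sub, map_smul]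
    filter_upwards [hu, Lp.coeFn_sub (ft (A u)) (z • ft (u : L2Form n j)),
      Lp.coeFn_smul z (ft (u : L2Form n j))] with ξ h1 h2 h3
    rw [h2, Pi.sub_apply, h3, Pi.smul_apply, h1, ← sub_smul]
    exact (inv_smul_smul₀ (hne ξ) _).symm

/-- A form with frequencies in a small ball about `ξ₀` is an approximate eigenvector, with error at
most `ε` times its norm. A bounded inverse `R` would give `1 ≤ ‖R‖ ε`, which `ε = (‖R‖ + 1)⁻¹`
excludes. -/
theorem not_isResolventPoint {A : L2Form n j →ₗ.[ℂ] L2Form n j} (hj : j ≤ n) {m : V n → ℝ}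
    (hm : Continuous m) (hA : A.graph = scalarGraph m) (ξ₀ : V n) :
    ¬ IsResolventPoint A (m ξ₀ : ℂ) := by
  rintro ⟨R, -, hR⟩
  set ε : ℝ := (‖R‖ + 1)⁻¹ with hε
  have hε0 : 0 < ε := by positivity
  obtain ⟨r, hr, hball⟩ := Metric.continuousAt_iff.1 hm.continuousAt ε hε0
  let c := EuclideanSpace.basisFun (MultiIndex n j) ℂ (Fin.castLEOrderEmb hj)
  have hc : ‖c‖ = 1 := (EuclideanSpace.basisFun (MultiIndex n j) ℂ).norm_eq_one _
  let F : L2Form n j := indicatorConstLp 2 (μ := volume)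
    (measurableSet_ball (x := ξ₀) (ε := r)) measure_ball_lt_top.ne c
  have hF0 : 0 < ‖F‖ := by
    rw [norm_indicatorConstLp (by norm_num) (by norm_num), hc, one_mul]
    exact Real.rpow_pos_of_pos (ENNReal.toReal_pos (Metric.measure_ball_pos _ _ hr).ne'
      measure_ball_lt_top.ne) _
  let f : L2Form n j := ft.symm F
  have hf : ft f = F := LinearIsometryEquiv.apply_symm_apply _ _
  have hfn : ‖f‖ = ‖F‖ := LinearIsometryEquiv.norm_map _ _
  let W : V n → Coeff n j →L[ℂ] Coeff n j := fun ξ =>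
    ((m ξ : ℂ) - (m ξ₀ : ℂ)) • ContinuousLinearMap.id ℂ (Coeff n j)
  have hW : Continuous W := by fun_prop
  have hb : ∀ᵐ ξ, ‖W ξ (ft f ξ)‖ ≤ ε * ‖ft f ξ‖ := by
    rw [hf]
    filter_upwards [indicatorConstLp_coeFn (p := 2) (μ := (volume : Measure (V n)))
      (hs := measurableSet_ball (x := ξ₀) (ε := r)) (hμs := measure_ball_lt_top.ne) (c := c)]
      with ξ h1
    change ‖((m ξ : ℂ) - (m ξ₀ : ℂ)) • F ξ‖ ≤ _
    by_cases h : ξ ∈ Metric.ball ξ₀ r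
    · rw [norm_smul, ← Complex.ofReal_sub, Complex.norm_real]
      have := hball h
      rw [Real.dist_eq] at this
      gcongr
      exact this.le
    · have h2 : F ξ = 0 := h1.trans (Set.indicator_of_notMem h _)
      rw [h2]
      simp
  obtain ⟨g, hg⟩ := exists_mem_multGraph_of_norm_le hW hb
  have hgraph : (f, g + (m ξ₀ : ℂ) • f) ∈ A.graph := by
    rw [hA, mem_scalarGraph, map_add, map_smul]
    filter_upwards [mem_multGraph.1 hg, Lp.coeFn_add (ft g) ((m ξ₀ : ℂ) • ft f),
      Lp.coeFn_smul (m ξ₀ : ℂ) (ft f)] with ξ h1 h2 h3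
    rw [h2, Pi.add_apply, h3, Pi.smul_apply, h1]
    change ((m ξ : ℂ) - (m ξ₀ : ℂ)) • ft f ξ + _ = _
    rw [← add_smul, sub_add_cancel]
  obtain ⟨y, h1, h2⟩ := LinearPMap.mem_graph_iff _ |>.1 hgraph
  have h1 : (y : L2Form n j) = f := h1
  have h2 : A y = g + (m ξ₀ : ℂ) • f := h2
  have h3 := hR y
  rw [h1, h2, add_sub_cancel_right] at h3
  have h4 : ‖f‖ ≤ ‖R‖ * (ε * ‖f‖) := by
    conv_lhs => rw [← h3]
    exact (R.le_opNorm g).trans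
      (mul_le_mul_of_nonneg_left (norm_le_of_mem_multGraph hg hb) (norm_nonneg _))
  have h5 : ‖R‖ * ε < 1 := by
    rw [hε, ← div_eq_mul_inv, div_lt_one (by positivity)]
    linarith
  rw [← mul_assoc, hfn] at h4
  nlinarith

/-- The spectrum of the twisted Laplacian of a constant form. -/
theorem spec_laplacian_const (hn : 0 < n) (hj : j ≤ n) (a : V n →L[ℝ] ℝ) :
    spec (laplacian (fun _ => a) j) = Complex.ofReal '' Set.Ici (‖a‖ ^ 2) := by
  have hle : ∀ ξ, ‖a‖ ^ 2 ≤ energy (comps a) ξ := fun ξ => by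
    rw [energy_eq]
    have : 0 ≤ 4 * Real.pi ^ 2 * ‖ξ‖ ^ 2 := by positivity
    linarith
  ext z
  constructor
  · intro hz
    by_contra hcon
    have hclosed : IsClosed (Complex.ofReal '' Set.Ici (‖a‖ ^ 2)) :=
      Complex.isometry_ofReal.isClosedEmbedding.isClosedMap _ isClosed_Ici
    obtain ⟨δ, hδ, hball⟩ := Metric.isOpen_iff.1 hclosed.isOpen_compl z hcon
    refine hz (isResolventPoint_of_le (continuous_energy _) (graph_laplacian_const a) hδ
      fun ξ => ?_)
    by_contra hlt
    have hmem : (energy (comps a) ξ : ℂ) ∈ Metric.ball z δ := by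
      rw [Metric.mem_ball, dist_eq_norm]
      exact not_le.1 hlt
    exact hball hmem ⟨_, hle ξ, rfl⟩
  · rintro ⟨s, hs, rfl⟩
    have hs : ‖a‖ ^ 2 ≤ s := hs
    have h0 : 0 ≤ s - ‖a‖ ^ 2 := sub_nonneg.2 hs
    -- A frequency of energy exactly `s`, placed on the first coordinate axis.
    let ξ : V n := (√(s - ‖a‖ ^ 2) / (2 * Real.pi)) • evec ⟨0, hn⟩
    have h1 : ‖ξ‖ = √(s - ‖a‖ ^ 2) / (2 * Real.pi) := by
      rw [norm_smul, evec, PiLp.norm_single, norm_one, mul_one, Real.norm_eq_abs,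
        abs_of_nonneg (by positivity)]
    have h2 : energy (comps a) ξ = s := by
      rw [energy_eq, h1, div_pow, Real.sq_sqrt h0]
      field_simp
      ring
    rw [← h2]
    exact not_isResolventPoint hj (continuous_energy _) (graph_laplacian_const a) ξ

end Spectrum

/-! ### The Novikov-Shubin invariant -/

section NovikovShubin

variable {n : ℕ} {b : Module.Basis (Fin n) ℝ (V n)} {θ : OneForm n} {j : ℕ}

theorem novikovShubin_eq_top (h : ∀ᶠ t in 𝓝[>] (0 : ℝ), spectralDistribution b θ j t = 0) :
    novikovShubin b θ j = ⊤ := by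
  refine EReal.eq_top_iff_forall_lt _ |>.2 fun β => ?_
  -- Every exponent is admissible, with constant `0`; `β + 1` makes the inequality strict.
  refine lt_of_lt_of_le (EReal.coe_lt_coe_iff.2 (lt_add_one β)) (le_sSup ⟨β + 1, rfl, 0, ?_⟩)
  filter_upwards [h] with t ht
  rw [ht, zero_tsub]
  exact zero_le

/-- An admissible `β > α` would bound the positive constant `c` by a multiple of `t ^ (β - α)`,
which tends to zero. -/
theorem novikovShubin_eq {α : ℝ} (hb : twistedBetti b θ j = 0) {C : ℝ≥0}
    (hC : ∀ᶠ t in 𝓝[>] (0 : ℝ), spectralDistribution b θ j t ≤ C * ENNReal.ofReal (t ^ α))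
    {c D : ℝ≥0} (hc : 0 < c) (hD : ∀ᶠ t in 𝓝[>] (0 : ℝ),
      c * ENNReal.ofReal (t ^ α) ≤ D * spectralDistribution b θ j t) :
    novikovShubin b θ j = (α : EReal) := by
  refine le_antisymm (sSup_le ?_) (le_sSup ⟨α, rfl, C, by simpa only [hb, tsub_zero] using hC⟩)
  rintro _ ⟨β, rfl, C', hC'⟩
  rw [EReal.coe_le_coe_iff]
  by_contra! hlt
  have hlim : Tendsto (fun t : ℝ => (D * C' : ℝ) * t ^ (β - α)) (𝓝[>] 0) (𝓝 0) := by
    have h1 : Tendsto (fun t : ℝ => (D * C' : ℝ) * t ^ (β - α)) (𝓝 0)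
        (𝓝 ((D * C' : ℝ) * 0 ^ (β - α))) :=
      ((Real.continuousAt_rpow_const 0 (β - α) (Or.inr (sub_pos.2 hlt).le)).tendsto).const_mul _
    rw [Real.zero_rpow (sub_pos.2 hlt).ne', mul_zero] at h1
    exact h1.mono_left nhdsWithin_le_nhds
  have hle : ∀ᶠ t in 𝓝[>] (0 : ℝ), (c : ℝ) ≤ (D * C' : ℝ) * t ^ (β - α) := by
    filter_upwards [hC', hD, self_mem_nhdsWithin] with t h1 h2 ht
    have ht : 0 < t := ht
    rw [hb, tsub_zero] at h1
    have h3 : (c : ℝ≥0∞) * ENNReal.ofReal (t ^ α) ≤ D * (C' * ENNReal.ofReal (t ^ β)) :=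
      h2.trans (by gcongr)
    have h4 := ENNReal.toReal_mono (by finiteness) h3
    simp only [ENNReal.toReal_mul, ENNReal.coe_toReal,
      ENNReal.toReal_ofReal (Real.rpow_nonneg ht.le _)] at h4
    rw [Real.rpow_sub ht, ← mul_div_assoc, le_div_iff₀ (Real.rpow_pos_of_pos ht _), mul_assoc]
    exact h4
  exact absurd (ge_of_tendsto hlim hle) (not_le.2 (by exact_mod_cast hc))

theorem IsDecomposition.novikovShubin_eq_top {a : V n →L[ℝ] ℝ} {φ : V n → ℝ}
    (h : IsDecomposition b θ a φ) (ha : a ≠ 0) : novikovShubin b θ j = ⊤ := by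
  obtain ⟨D, κ, hκ, hle⟩ := h.spectralDistribution_le j
  have hpos : 0 < ‖a‖ ^ 2 := by positivity
  refine TwistedL2.novikovShubin_eq_top ?_
  filter_upwards [Ioo_mem_nhdsGT (div_pos hpos hκ)] with t ht
  have h1 : κ * t < ‖a‖ ^ 2 := by
    have := (lt_div_iff₀ hκ).1 ht.2
    linarith
  have h2 := hle t ht.1
  rw [spectralDistribution_const_eq_zero a (mul_pos hκ ht.1) h1, mul_zero] at h2
  exact le_zero_iff.1 h2

theorem IsDecomposition.novikovShubin_eq {φ : V n → ℝ} (h : IsDecomposition b θ 0 φ)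
    (hn : 0 < n) (hj : j ≤ n) : novikovShubin b θ j = (((n : ℝ) / 2 : ℝ) : EReal) := by
  obtain ⟨D, κ, hκ, hle⟩ := h.spectralDistribution_le j
  obtain ⟨D', κ', hκ', hle'⟩ := h.spectralDistribution_const_le j
  obtain ⟨C, hC⟩ := exists_spectralDistribution_zero_le b j
  obtain ⟨c, hc, hlow⟩ := exists_le_spectralDistribution_zero b hj
  have hsplit : ∀ s t : ℝ, 0 < s → 0 < t → ENNReal.ofReal ((s * t) ^ ((n : ℝ) / 2)) =
      (Real.toNNReal (s ^ ((n : ℝ) / 2)) : ℝ≥0∞) * ENNReal.ofReal (t ^ ((n : ℝ) / 2)) := by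
    intro s t hs ht
    rw [Real.mul_rpow hs.le ht.le, ENNReal.ofReal_mul (Real.rpow_nonneg hs.le _)]
    rfl
  refine TwistedL2.novikovShubin_eq (h.twistedBetti_eq_zero hn)
    (C := D * C * Real.toNNReal (κ ^ ((n : ℝ) / 2))) (D := D')
    (c := c * Real.toNNReal (κ'⁻¹ ^ ((n : ℝ) / 2))) ?_
    (mul_pos hc (Real.toNNReal_pos.2 (by positivity))) ?_
  · filter_upwards [self_mem_nhdsWithin] with t ht
    have ht : 0 < t := ht
    refine (hle t ht).trans ((mul_le_mul_right (hC _ (mul_pos hκ ht)) _).trans (le_of_eq ?_))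
    rw [hsplit κ t hκ ht, ENNReal.coe_mul, ENNReal.coe_mul]
    ring
  · have hlim : Tendsto (fun t : ℝ => κ'⁻¹ * t) (𝓝[>] 0) (𝓝[>] 0) := by
      refine tendsto_nhdsWithin_iff.2 ⟨?_, ?_⟩
      · have : Tendsto (fun t : ℝ => κ'⁻¹ * t) (𝓝 0) (𝓝 (κ'⁻¹ * 0)) :=
          (continuous_const.mul continuous_id).tendsto 0
        rw [mul_zero] at this
        exact this.mono_left nhdsWithin_le_nhds
      · filter_upwards [self_mem_nhdsWithin] with t ht
        exact mul_pos (inv_pos.2 hκ') ht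
    filter_upwards [hlim.eventually hlow, self_mem_nhdsWithin] with t h1 ht
    have ht : 0 < t := ht
    -- The comparison at `t / κ'` bounds the constant distribution there by that of `θ` at `t`; the
    -- rescaling only changes the constant.
    have h2 := hle' (κ'⁻¹ * t) (mul_pos (inv_pos.2 hκ') ht)
    rw [mul_inv_cancel_left₀ hκ'.ne'] at h2
    rw [hsplit _ t (inv_pos.2 hκ') ht] at h1
    rw [ENNReal.coe_mul, mul_assoc]
    exact h1.trans h2

end NovikovShubin

end TwistedL2
theorem proposition5p4 {n : ℕ} (hn : 0 < n)
    (b : Module.Basis (Fin n) ℝ (TwistedL2.V n)) (θ : TwistedL2.OneForm n)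
    (hθ : TwistedL2.IsClosedOneForm b θ) (j : ℕ) (hj : j ≤ n) :
    TwistedL2.twistedBetti b θ j = 0 ∧
    (∃ E, TwistedL2.IsSpectralFamily (TwistedL2.laplacian θ j) E) ∧
    (TwistedL2.IsExact b θ → TwistedL2.novikovShubin b θ j = (((n : ℝ) / 2 : ℝ) : EReal)) ∧
    (¬ TwistedL2.IsExact b θ → TwistedL2.novikovShubin b θ j = ⊤) ∧
    (TwistedL2.IsCoclosed θ → ∀ x,
      TwistedL2.spec (TwistedL2.laplacian θ j) = Complex.ofReal '' Set.Ici (‖θ x‖ ^ 2) ∧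
      IsLeast {t : ℝ | (t : ℂ) ∈ TwistedL2.spec (TwistedL2.laplacian θ j)} (‖θ x‖ ^ 2)) := by
  obtain ⟨a, φ, h⟩ := hθ.exists_isDecomposition
  refine ⟨h.twistedBetti_eq_zero hn, ?_, fun hex => ?_, fun hex => ?_, fun hco x => ?_⟩
  · obtain ⟨R, hR⟩ := h.exists_resolvent j
    exact ⟨_, hR.isSpectralFamily⟩
  -- An exact form is decomposed anew by its own primitive, with constant part `0`.
  · obtain ⟨f, hf⟩ := hex.exists_isDecomposition
    exact hf.novikovShubin_eq hn hj
  · refine h.novikovShubin_eq_top ?_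
    rintro rfl
    exact hex h.isExact
  · have hconst : θ = fun _ => a := funext fun y => h.eq_const hco y
    have hspec : TwistedL2.spec (TwistedL2.laplacian θ j) =
        Complex.ofReal '' Set.Ici (‖θ x‖ ^ 2) := by
      rw [hconst]
      exact TwistedL2.spec_laplacian_const hn hj a
    refine ⟨hspec, ?_⟩
    rw [hspec]
    have : {t : ℝ | (t : ℂ) ∈ Complex.ofReal '' Set.Ici (‖θ x‖ ^ 2)} = Set.Ici (‖θ x‖ ^ 2) := by
      ext t
      exact Complex.ofReal_injective.mem_set_image
    rw [this]
    exact isLeast_Ici
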